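/- **Setting.** Let $m$ be Lebesgue measure. All partitions are understood modulo null sets: intervals are taken open, and the null set of base points in no element of $\mathcal Z$ is discarded. *Tower.* The base is $\hat\Delta_0=[0,N]=\bigcup_{i=1}^N\hat\Delta_0^{(i)}$, a union of $N\ge 1$ unit intervals $\hat\Delta_0^{(i)}=[i-1,i]$. Let $\mathcal Z$ be a countable partition of $\hat\Delta_0$ into intervals, each contained in one $\hat\Delta_0^{(i)}$, and let $R:\hat\Delta_0\to\mathbb Z^+$ be constant on the elements of $\mathcal Z$. The tower $\hat\Delta$ consists of the points $(z,n)$, $0\le n<R(z)$, where everything directly above a hole interval (see below) is deleted; $\hat\Delta_l$ is its level $n=l$. Put $\hat F(z,l)=(z,l+1)$ if $l+1<R(z)$; if $l+1=R(z)$ then $\hat F(z,l)$ lies in the base. *Hole.* The hole $\tilde H=\bigcup_l\tilde H_l\subset\hat\Delta$ consists of finitely many open intervals on each level $l$, each lying over one $\hat\Delta_0^{(i)}$ and each a union of sets $\hat F^l(\omega)$, $\omega\in\mathcal Z$. Let $\Delta=\hat\Delta\setminus\tilde H$, $\Delta_l=\hat\Delta_l\setminus\tilde H$. If $\omega\in\mathcal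 Z$ does not fall into the hole before returning, then $\hat F^{R}|_\omega$ is continuous, one-to-one and onto some $\hat\Delta_0^{(i)}$. *Markov partition.* Each $\Delta_l$ is partitioned into countably many intervals $\Delta_{l,j}$, each lying over one $\hat\Delta_0^{(i)}$ and each a union of sets $\hat F^l(\omega)$, $\omega\in\mathcal Z$. Each $\Delta_{l,j}$ either moves up as a whole to level $l+1$, its image consisting of elements of the partition and hole intervals, or is mapped by $\hat F$ continuously and one-to-one onto a union $\bigcup_{k=k_1}^{k_2}\hat\Delta_0^{(k)}$ of consecutive base intervals; the elements of the second kind are denoted $\Delta_{l,j}^*$. *Properties.* For constants $\alpha>0$, $\gamma>1$, $\beta>0$, $C>0$: - (a) $\hat F$ is $C^{1+\alpha}$ on each $\Delta_{l,j}$ (for $\Delta^*_{l,j}$ it is enough that this holds on each of the sets $\hat F^l(\omega)$, $\omega\in\mathcal Z$, of which it consists); - (b) $|\hat F'|\ge\gamma e^{\beta l}$ on $\Delta_{l,j}^*$; - (c) $\left|\frac{\hat F'(x')}{\hat F'(y')}-1\right|\le C|\hat F(x')-\hat F(y')|^\alpha$ whenever $x',y'$ lie in the same $\Delta_{l,j}^*$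 and $\hat F(x'),\hat F(y')$ lie in the same base interval. *Operator and space.* Let $F$ be the restriction of $\hat F$ to $\{x\in\Delta:\hat F(x)\in\Delta\}$, let $\mathcal Pf(x)=\sum_{y\in F^{-1}x}f(y)/|F'(y)|$ and $\mathcal P_1f=\mathcal Pf/|\mathcal Pf|_{L^1(\Delta)}$. Let $\theta\in(0,1)$ be as in (H1) below and fix any $\xi>0$ with $e^{-\xi}>\max\{\theta,e^{-\alpha\beta}\}$. Let $X$ be the set of $f:\Delta\to\mathbb R$ with $\max\{\|f\|_\infty,\|f\|_r\}<\infty$, where $$\|f\|_\infty=\sup_{l,j}e^{-\xi l}\sup_{\Delta_{l,j}}|f|,\qquad \|f\|_r=\sup_{l,j}\ e^{-\xi l}\sup_{\substack{x\ne y\in\Delta_{l,j}\\ f(x)\ne0}}\frac{|f(x)-f(y)|}{|x-y|^\alpha|f(x)|}.$$ A probability density $\psi$ on $\Delta$, with $\mu=\psi\,dm$, is called a *nontrivial conditionally invariant density* if $\mu(F^{-1}\Delta)>0$ and $\mu(F^{-1}A)/\mu(F^{-1}\Delta)=\mu(A)$ for every Borel set $A\subset\Delta$. $F$ is *transitive on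 components* if for all $1\le i,j\le N$ there is $n\ge1$ such that every point of $\Delta_0\cap\hat\Delta_0^{(j)}$ is $F^n(x)$ for some $x\in\Delta_0\cap\hat\Delta_0^{(i)}$. *Hypotheses.* Put $a=\max\{e^{-\xi},(1+C)\gamma^{-\alpha}\}$, $b=1+C$ and $D=(1+C)\sum_{\Delta_{l,j}^*}e^{\xi l}m(\Delta_{l,j}^*)$. - (H1) There is $A>0$ with $m(\hat\Delta_l)\le A\theta^l$ for all $l\ge0$. - (H2) $(1+C)/\gamma^\alpha<1$. - (H3) $D\,m(\tilde H_0)+\sum_{l\ge1}e^{\xi(l-1)}m(\tilde H_l)\le\frac{(1-a)^2}{4b}$; or, when $m(\tilde H_0)=0$, only $\sum_{l\ge1}e^{\xi(l-1)}m(\tilde H_l)\le\frac{(1-a)^2}{b}$. Moreover the hole does not swallow almost the whole tower: $\sum_{l\ge0}e^{\xi l}m(\Delta_l)\ge\frac{1-a}{2b}$ (automatic if $m(\tilde H_0)\le\frac12$). **Theorem 2.1.** Let a tower with holes as above satisfy (a)–(c) and (H1)–(H3). Then there is a probability density $\varphi\in X$ with $\mathcal P_1\varphi=\varphi$. If in addition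 $F$ is transitive on components, then $\varphi$ is the unique nontrivial conditionally invariant density in $X$, and $\varphi$ is bounded away from zero on $\Delta$. -/

import Mathlib

open Set MeasureTheory
open scoped ENNReal

noncomputable section

/-- The raw data of a one-dimensional tower with `N` unit base intervals, a hole and a partition.
The base is `[0, N]`, its `i`-th interval (`i < N`) is `[i, i + 1]`, and the part of the tower at
level `l` is recorded through its projection to the base, so that a point of the tower is a pair
`(z, l)`.  As usual, partitions are understood modulo Lebesgue-null sets: all intervals are open
and the null set of points of the base lying in no element of `Z` is discarded. -/
structure TowerData where
  /-- number of base intervals -/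
  N : ℕ
  /-- the countable partition of the base -/
  Z : Set (Set ℝ)
  /-- the return time -/
  R : ℝ → ℕ
  /-- the return map to the base (the `R z`-th iterate of the tower map at `(z, 0)`) -/
  G : ℝ → ℝ
  /-- the hole intervals of level `l` -/
  hole : ℕ → Set (Set ℝ)
  /-- the elements of the Markov partition on level `l` -/
  part : ℕ → Set (Set ℝ)

namespace TowerData

variable (T : TowerData)

/-- The interior of the `i`-th base interval. -/
def baseInt (i : ℕ) : Set ℝ := Ioo (i : ℝ) (i + 1)

/-- The points of the base lying in some element of `Z`. -/
def cells : Set ℝ := ⋃₀ T.Z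

/-- The hole on level `l`. -/
def holeAt (l : ℕ) : Set ℝ := ⋃₀ T.hole l

/-- The tower including its hole: `(z, n)` with `n < R z`, where everything directly above a hole
interval is deleted. -/
def hat : Set (ℝ × ℕ) :=
  {x | x.1 ∈ T.cells ∧ x.2 < T.R x.1 ∧ ∀ k < x.2, x.1 ∉ T.holeAt k}

/-- The tower without its hole. -/
def Del : Set (ℝ × ℕ) := {x | x ∈ T.hat ∧ x.1 ∉ T.holeAt x.2}

/-- Level `l` of the tower including the hole. -/
def hatLevel (l : ℕ) : Set ℝ := {z | (z, l) ∈ T.hat}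

/-- Level `l` of the tower without the hole. -/
def level (l : ℕ) : Set ℝ := {z | (z, l) ∈ T.Del}

/-- The tower map.  Only its values on `T.Del` are used, and the open map is its restriction to the
points of `T.Del` whose image lies in `T.Del`. -/
def F (x : ℝ × ℕ) : ℝ × ℕ := if x.2 + 1 < T.R x.1 then (x.1, x.2 + 1) else (T.G x.1, 0)

/-- The derivative of the tower map. -/
def dF (x : ℝ × ℕ) : ℝ := if x.2 + 1 < T.R x.1 then 1 else deriv T.G x.1

/-- The element `J` of the partition of level `l` is mapped to the base. -/
def Returns (l : ℕ) (J : Set ℝ) : Prop := ∀ z ∈ J ∩ T.cells, T.R z = l + 1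

/-- A nonempty bounded open interval inside one of the base intervals. -/
def IsCell (I : Set ℝ) : Prop :=
  (∃ a b : ℝ, a < b ∧ I = Ioo a b) ∧ ∃ i < T.N, I ⊆ baseInt i

/-- Up to a null set, `I` is a union of elements of `Z`. -/
def IsUnionOfZ (I : Set ℝ) : Prop := ∀ ω ∈ T.Z, ω ⊆ I ∨ Disjoint ω I

/-- The data form a tower with several bases, holes and a countable Markov partition. -/
structure IsTower : Prop where
  N_pos : 1 ≤ T.N
  -- `Z` is a countable partition (mod 0) of the base into intervals
  Z_countable : T.Z.Countable
  Z_cell : ∀ ω ∈ T.Z, T.IsCell ω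
  Z_disjoint : T.Z.PairwiseDisjoint id
  Z_cover : volume (Icc (0 : ℝ) T.N \ T.cells) = 0
  -- the return time is positive and constant on the elements of `Z`
  R_pos : ∀ z ∈ T.cells, 0 < T.R z
  R_const : ∀ ω ∈ T.Z, ∀ x ∈ ω, ∀ y ∈ ω, T.R x = T.R y
  -- finitely many open hole intervals on each level, consisting of elements of `Z`
  hole_finite : ∀ l, (T.hole l).Finite
  hole_cell : ∀ l, ∀ I ∈ T.hole l, T.IsCell I
  hole_union : ∀ l, ∀ I ∈ T.hole l, T.IsUnionOfZ I
  hole_sub : ∀ l, ∀ I ∈ T.hole l, I ∩ T.cells ⊆ T.hatLevel l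
  -- an element of `Z` which does not fall into the hole returns onto one base interval
  Z_return : ∀ l, ∀ ω ∈ T.Z, (∀ z ∈ ω, (z, l) ∈ T.Del ∧ T.R z = l + 1) →
    ContinuousOn T.G ω ∧ InjOn T.G ω ∧ ∃ i < T.N, T.G '' ω = baseInt i
  -- countable partition of each level into intervals consisting of elements of `Z`
  part_countable : ∀ l, (T.part l).Countable
  part_cell : ∀ l, ∀ J ∈ T.part l, T.IsCell J
  part_union : ∀ l, ∀ J ∈ T.part l, T.IsUnionOfZ J
  part_disjoint : ∀ l, (T.part l).PairwiseDisjoint id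
  part_cover : ∀ l, ⋃₀ T.part l ∩ T.cells = T.level l
  -- Markov property: an element either moves up as a whole, onto a union of elements and hole
  -- intervals, or it is mapped homeomorphically onto a union of consecutive base intervals
  markov_or : ∀ l, ∀ J ∈ T.part l, T.Returns l J ∨ ∀ z ∈ J ∩ T.cells, l + 1 < T.R z
  markov_up : ∀ l, ∀ J ∈ T.part l, ∀ J' ∈ T.part (l + 1), J' ⊆ J ∨ Disjoint J' J
  markov_ret : ∀ l, ∀ J ∈ T.part l, T.Returns l J →
    ContinuousOn T.G J ∧ InjOn T.G J ∧
      ∃ k₁ k₂ : ℕ, k₁ ≤ k₂ ∧ k₂ < T.N ∧ T.G '' J = Ioo (k₁ : ℝ) (k₂ + 1)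

/-- Property (a): the tower map is `C^{1+α}` on the elements of the partition.  On the elements that
do not return it is a translation to the next level; on a returning element, regularity is only
required on each of the finitely many elements of `Z` of which it consists (each of them is mapped
onto one base interval), so the derivative may jump where the image passes from one base interval
to the next. -/
def PropA (α : ℝ) : Prop :=
  ∀ l, ∀ J ∈ T.part l, T.Returns l J → ∀ ω ∈ T.Z, ω ⊆ J →
    (∀ z ∈ ω, DifferentiableAt ℝ T.G z) ∧
    ∃ K : ℝ, ∀ x ∈ ω, ∀ y ∈ ω, |deriv T.G x - deriv T.G y| ≤ K * |x - y| ^ α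

/-- Property (b): expansion at returns. -/
def PropB (γ β : ℝ) : Prop :=
  ∀ l, ∀ J ∈ T.part l, T.Returns l J → ∀ z ∈ J ∩ T.cells,
    γ * Real.exp (β * l) ≤ |deriv T.G z|

/-- Property (c): bounded distortion at returns, over each base interval. -/
def PropC (C α : ℝ) : Prop :=
  ∀ l, ∀ J ∈ T.part l, T.Returns l J → ∀ i < T.N, ∀ x ∈ J ∩ T.cells, ∀ y ∈ J ∩ T.cells,
    T.G x ∈ baseInt i → T.G y ∈ baseInt i →
      |deriv T.G x / deriv T.G y - 1| ≤ C * |T.G x - T.G y| ^ α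

/-- (H1): exponential decay of the levels. -/
def H1 (θ : ℝ) : Prop :=
  ∃ A : ℝ, 0 < A ∧ ∀ l : ℕ, volume (T.hatLevel l) ≤ ENNReal.ofReal (A * θ ^ l)

/-- (H2): nonlinearity small compared with the expansion. -/
def H2 (C γ α : ℝ) : Prop := (1 + C) / γ ^ α < 1

/-- The constant `a` in the conditions on the hole. -/
def consA (C γ α ξ : ℝ) : ℝ := max (Real.exp (-ξ)) ((1 + C) / γ ^ α)

/-- The constant `b` in the conditions on the hole. -/
def consB (C : ℝ) : ℝ := 1 + C

/-- `D = (1 + C) ∑ e^{ξ l} m(J)`, the sum running over all levels `l` and all returning elements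
`J` of level `l`. -/
def consD (C ξ : ℝ) : ℝ≥0∞ :=
  ENNReal.ofReal (1 + C) *
    ∑' l : ℕ, ∑' J : {J : Set ℝ // J ∈ T.part l ∧ T.Returns l J},
      ENNReal.ofReal (Real.exp (ξ * l)) * volume J.1

/-- `∑_{l ≥ 1} e^{ξ (l - 1)} m(H_l)`. -/
def upperHole (ξ : ℝ) : ℝ≥0∞ :=
  ∑' l : ℕ, ENNReal.ofReal (Real.exp (ξ * l)) * volume (T.holeAt (l + 1))

/-- (H3) in its general form. -/
def H3gen (C γ α ξ : ℝ) : Prop :=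
  T.consD C ξ * volume (T.holeAt 0) + T.upperHole ξ ≤
    ENNReal.ofReal ((1 - consA C γ α ξ) ^ 2 / (4 * consB C))

/-- The form to which (H3) reduces when there is no hole in the base. -/
def H3noBase (C γ α ξ : ℝ) : Prop :=
  volume (T.holeAt 0) = 0 ∧
    T.upperHole ξ ≤ ENNReal.ofReal ((1 - consA C γ α ξ) ^ 2 / consB C)

/-- (H3): the smallness condition on the weighted measure of the hole. -/
def H3 (C γ α ξ : ℝ) : Prop := T.H3gen C γ α ξ ∨ T.H3noBase C γ α ξ

/-- The hole does not swallow almost the whole tower: the weighted measure `∑ e^{ξ l} m(Δ_l)` of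
what is left is at least `(1 - a) / (2 b)` (which is less than `1 / 2`).  This holds as soon as
at least half of one base interval is not in the hole. -/
def HoleNotHuge (C γ α ξ : ℝ) : Prop :=
  ENNReal.ofReal ((1 - consA C γ α ξ) / (2 * consB C)) ≤
    ∑' l : ℕ, ENNReal.ofReal (Real.exp (ξ * l)) * volume (T.level l)

/-- `‖f‖_∞`, the weighted supremum. -/
def normInf (ξ : ℝ) (f : ℝ × ℕ → ℝ) : ℝ≥0∞ :=
  ⨆ (l : ℕ) (J ∈ T.part l) (z ∈ J ∩ T.cells),
    ENNReal.ofReal (Real.exp (-(ξ * l)) * |f (z, l)|)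

/-- `‖f‖_r`, the weighted Hölder quotient relative to the size of `f`. -/
def normR (α ξ : ℝ) (f : ℝ × ℕ → ℝ) : ℝ≥0∞ :=
  ⨆ (l : ℕ) (J ∈ T.part l) (x ∈ J ∩ T.cells) (y ∈ J ∩ T.cells) (_ : f (x, l) ≠ 0),
    ENNReal.ofReal
      (|f (x, l) - f (y, l)| / (|x - y| ^ α * |f (x, l)|) * Real.exp (-(ξ * l)))

/-- The space `X` of functions on `T.Del` with `max ‖f‖_∞ ‖f‖_r < ∞`.  Functions are given on all
of `ℝ × ℕ`, but only their values on `T.Del` matter.  (If `‖f‖_r < ∞`, then `f` is continuous on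
each element of the partition, so the supremum in `‖f‖_∞` is the essential supremum and `f` is
measurable on `T.Del`.) -/
def MemX (α ξ : ℝ) (f : ℝ × ℕ → ℝ) : Prop := max (T.normInf ξ f) (T.normR α ξ f) < ∞

/-- Lebesgue measure on the levels of the tower. -/
def leb : Measure (ℝ × ℕ) := (volume : Measure ℝ).prod Measure.count

/-- The transfer operator of the open map. -/
def transfer (f : ℝ × ℕ → ℝ) (x : ℝ × ℕ) : ℝ :=
  ∑' y : {y : ℝ × ℕ // y ∈ T.Del ∧ T.F y = x}, f y.1 / |T.dF y.1|

/-- The normalized transfer operator. -/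
def transfer₁ (f : ℝ × ℕ → ℝ) (x : ℝ × ℕ) : ℝ :=
  T.transfer f x / ∫ y in T.Del, |T.transfer f y| ∂leb

/-- `f` is a probability density on `T.Del`. -/
def IsProbDensity (f : ℝ × ℕ → ℝ) : Prop :=
  (∀ x ∈ T.Del, 0 ≤ f x) ∧ IntegrableOn f T.Del leb ∧ ∫ x in T.Del, f x ∂leb = 1

/-- The measure on `T.Del` with density `f`. -/
def measureOf (f : ℝ × ℕ → ℝ) : Measure (ℝ × ℕ) :=
  (leb.restrict T.Del).withDensity fun x => ENNReal.ofReal (f x)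

/-- The preimage of `A` under the open map. -/
def preim (A : Set (ℝ × ℕ)) : Set (ℝ × ℕ) := {x | x ∈ T.Del ∧ T.F x ∈ A}

/-- `f` is the density of a nontrivial conditionally invariant probability measure `μ`:
`μ (F⁻¹ Δ) ≠ 0`, and `μ (F⁻¹ A) / μ (F⁻¹ Δ) = μ A` for all Borel sets `A ⊆ Δ`. -/
def IsCondInvDensity (f : ℝ × ℕ → ℝ) : Prop :=
  T.IsProbDensity f ∧ T.measureOf f (T.preim T.Del) ≠ 0 ∧
    ∀ A : Set (ℝ × ℕ), MeasurableSet A → A ⊆ T.Del →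
      T.measureOf f (T.preim A) / T.measureOf f (T.preim T.Del) = T.measureOf f A

/-- The part of the base of the tower (without hole) in the `i`-th base interval. -/
def base (i : ℕ) : Set (ℝ × ℕ) := {x | x ∈ T.Del ∧ x.2 = 0 ∧ x.1 ∈ baseInt i}

/-- Transitivity on components: the points over any base interval that survive up to some positive
time `m` cover at that time any given base interval. -/
def TransitiveOnComponents : Prop :=
  ∀ i < T.N, ∀ j < T.N, ∃ m : ℕ, 1 ≤ m ∧
    T.base j ⊆ T.F^[m] '' {x | x ∈ T.base i ∧ ∀ k ≤ m, T.F^[k] x ∈ T.Del}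

end TowerData

end

/-!
The proof replaces the fixed point theorem for the normalized transfer operator by a linear
argument in a cone of densities.

Seen from the base, the tower map is given by countably many branches `(l, ω)`: elements `ω` of `Z`
that survive up to level `l` and return from there onto a whole base interval.  On higher levels the
transfer operator `P` shifts functions up; on the base it is a sum over branches
(`IsTower.transfer_zero`).  Expansion and bounded distortion on the branches give the Lasota-Yorke
inequality `‖P f‖_r ≤ a ‖f‖_r + C` for nonnegative `f` (`IsExpanding.transfer_holder`) and bound the
supremum of `P f` on the base by the mass of `f` (`IsExpanding.transfer_base_le`).  Since `P` is
dual to the open map (`IsExpanding.setLIntegral_transfer`), the mass lost in one step is the mass that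
falls into the hole, which the smallness of the hole controls.  Hence, for `K = b / (1 - a)` and a
suitable `M`, the cone of functions `f ≥ 0` with `‖f‖_r ≤ K` and `‖f‖_∞ ≤ M ∫ f` is invariant, and
`∫ P f ≥ a ∫ f` on it (`IsExpanding.isPositiveMap`).

A positive linear map of a cone has approximate eigenvectors of total mass one, namely normalized
partial sums of Neumann series near their radius of convergence
(`IsPositiveMap.exists_approx_eigenvector`).  The functions of the cone are equicontinuous, so these
converge along a subsequence to an eigenfunction `φ`, at every point of the tower
(`IsExpanding.exists_eigenfunction`).

For uniqueness, the values of an eigenfunction over one base interval are comparable, because they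
are on each branch, uniformly (`IsExpanding.exists_branch_comparable`).  By transitivity a nonzero
eigenfunction is thus bounded away from zero on the base (`IsExpanding.exists_base_lower`).  Its
values on level `l` are those on the base divided by the `l`-th power of the eigenvalue, so two
eigenfunctions can be compared on the whole tower, which forces their eigenvalues to agree.  If `f`
and `g` are eigenfunctions and `c` is the largest constant with `c g ≤ f`, iterating the
Lasota-Yorke inequality shows that `f - c g` is again a regular eigenfunction (`IsExpanding.eigen_sub`); were it
not zero, it would be bounded below by a multiple of `g`, contrary to the choice of `c`.  Finally,
by duality and continuity every conditionally invariant density in `X` is an eigenfunction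
(`IsExpanding.isEigen_of_condInv`).
-/

open Filter Topology

noncomputable section

namespace TowerData

/-! ### Branches of the return map -/

/-- A returning branch: a pair `(l, ω)` such that the element `ω` of `Z` survives up to level `l`
and returns to the base from there. -/
def IsBranch (T : TowerData) (p : ℕ × Set ℝ) : Prop :=
  p.2 ∈ T.Z ∧ ∀ z ∈ p.2, (z, p.1) ∈ T.Del ∧ T.R z = p.1 + 1

/-- The type of returning branches. -/
abbrev Branch (T : TowerData) : Type := {p : ℕ × Set ℝ // T.IsBranch p}

/-- The level from which a branch returns. -/
def Branch.lev {T : TowerData} (p : T.Branch) : ℕ := p.1.1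

/-- The element of `Z` on which a branch is defined. -/
def Branch.dom {T : TowerData} (p : T.Branch) : Set ℝ := p.1.2

/-- The inverse of the return map along a branch. -/
def Branch.inv {T : TowerData} (p : T.Branch) : ℝ → ℝ := Function.invFunOn T.G p.dom

/-- The hypotheses on the tower other than those on the size of the hole, together with the one
consequence of the decay of the levels that is used: the weighted measure of the tower is finite. -/
structure IsExpanding (T : TowerData) (α γ β C ξ : ℝ) : Prop where
  tower : T.IsTower
  alpha_pos : 0 < α
  one_lt_gamma : 1 < γ
  beta_pos : 0 < β
  C_pos : 0 < C
  xi_pos : 0 < ξ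
  xi_lt : ξ < α * β
  propA : T.PropA α
  propB : T.PropB γ β
  propC : T.PropC C α
  nonlin : H2 C γ α
  weight_ne_top : ∑' l : ℕ, ENNReal.ofReal (Real.exp (ξ * l)) * volume (T.level l) ≠ ∞

variable {T : TowerData}

namespace IsTower

variable (hT : T.IsTower)
include hT

omit hT in
theorem exists_Z {z : ℝ} {l : ℕ} (h : (z, l) ∈ T.Del) : ∃ ω ∈ T.Z, z ∈ ω := h.1.1

theorem Z_open {ω : Set ℝ} (h : ω ∈ T.Z) : IsOpen ω := by
  obtain ⟨⟨a, b, -, rfl⟩, -⟩ := hT.Z_cell ω h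
  exact isOpen_Ioo

theorem Z_ordConnected {ω : Set ℝ} (h : ω ∈ T.Z) : ω.OrdConnected := by
  obtain ⟨⟨a, b, -, rfl⟩, -⟩ := hT.Z_cell ω h
  exact ordConnected_Ioo

theorem Z_nonempty {ω : Set ℝ} (h : ω ∈ T.Z) : ω.Nonempty := by
  obtain ⟨⟨a, b, hab, rfl⟩, -⟩ := hT.Z_cell ω h
  exact nonempty_Ioo.2 hab

theorem Z_eq {ω ω' : Set ℝ} (h : ω ∈ T.Z) (h' : ω' ∈ T.Z) {z : ℝ} (hz : z ∈ ω) (hz' : z ∈ ω') :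
    ω = ω' := by
  by_contra hne
  exact disjoint_left.1 (hT.Z_disjoint h h' hne) hz hz'

theorem Z_base {ω : Set ℝ} (h : ω ∈ T.Z) : ∃ i < T.N, ω ⊆ baseInt i := (hT.Z_cell ω h).2

theorem holeAt_iff {ω : Set ℝ} (h : ω ∈ T.Z) {z w : ℝ} (hz : z ∈ ω) (hw : w ∈ ω) {k : ℕ} :
    z ∈ T.holeAt k ↔ w ∈ T.holeAt k := by
  have key : ∀ z ∈ ω, ∀ w ∈ ω, z ∈ T.holeAt k → w ∈ T.holeAt k := by
    rintro z hz w hw ⟨I, hI, hzI⟩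
    rcases hT.hole_union k I hI ω h with h1 | h1
    · exact ⟨I, hI, h1 hw⟩
    · exact absurd hzI (disjoint_left.1 h1 hz)
  exact ⟨key z hz w hw, key w hw z hz⟩

/-- Each level of the tower is a union of elements of `Z`. -/
theorem Del_iff {ω : Set ℝ} (h : ω ∈ T.Z) {z w : ℝ} (hz : z ∈ ω) (hw : w ∈ ω) {l : ℕ} :
    (z, l) ∈ T.Del ↔ (w, l) ∈ T.Del := by
  have hzc : z ∈ T.cells := ⟨ω, h, hz⟩
  have hwc : w ∈ T.cells := ⟨ω, h, hw⟩
  simp only [Del, hat, mem_ofPred_eq, hT.R_const ω h z hz w hw, hzc, hwc, true_and,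
    hT.holeAt_iff h hz hw]

omit hT in
theorem Del_pred {z : ℝ} {l : ℕ} (h : (z, l + 1) ∈ T.Del) : (z, l) ∈ T.Del := by
  obtain ⟨⟨h1, h2, h3⟩, -⟩ := h
  simp only at h1 h2 h3
  exact ⟨⟨h1, by simp only; omega, fun k hk => h3 k (by simp only at hk; omega)⟩,
    h3 l (by omega)⟩

omit hT in
theorem Del_zero {z : ℝ} {l : ℕ} (h : (z, l) ∈ T.Del) : (z, 0) ∈ T.Del := by
  induction l with
  | zero => exact h
  | succ l ih => exact ih (Del_pred h)

omit hT in
theorem R_of_Del_succ {z : ℝ} {l : ℕ} (h : (z, l + 1) ∈ T.Del) : l + 1 < T.R z := h.1.2.1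

omit hT in
theorem F_of_Del_succ {z : ℝ} {l : ℕ} (h : (z, l + 1) ∈ T.Del) : T.F (z, l) = (z, l + 1) := by
  simp [F, R_of_Del_succ h]

omit hT in
/-- A point of the tower that is not mapped up is on its top level, and returns to the base. -/
theorem F_eq_or {z : ℝ} {l : ℕ} (h : (z, l) ∈ T.Del) :
    (l + 1 < T.R z ∧ T.F (z, l) = (z, l + 1)) ∨ (T.R z = l + 1 ∧ T.F (z, l) = (T.G z, 0)) := by
  have h1 : l < T.R z := h.1.2.1
  by_cases h2 : l + 1 < T.R z
  · exact Or.inl ⟨h2, by simp [F, h2]⟩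
  · exact Or.inr ⟨by omega, by simp [F, h2]⟩

theorem exists_branch {z : ℝ} {l : ℕ} (h : (z, l) ∈ T.Del) (hR : T.R z = l + 1) :
    ∃ p : T.Branch, z ∈ p.dom ∧ p.lev = l := by
  obtain ⟨ω, hω, hz⟩ := exists_Z h
  exact ⟨⟨(l, ω), hω, fun w hw => ⟨(hT.Del_iff hω hz hw).1 h,
    by rw [← hT.R_const ω hω z hz w hw, hR]⟩⟩, hz, rfl⟩

omit hT in
theorem branch_Z (p : T.Branch) : p.dom ∈ T.Z := p.2.1

omit hT in
theorem branch_Del (p : T.Branch) {z : ℝ} (hz : z ∈ p.dom) : (z, p.lev) ∈ T.Del :=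
  (p.2.2 z hz).1

omit hT in
theorem branch_R (p : T.Branch) {z : ℝ} (hz : z ∈ p.dom) : T.R z = p.lev + 1 :=
  (p.2.2 z hz).2

omit hT in
theorem branch_F (p : T.Branch) {z : ℝ} (hz : z ∈ p.dom) : T.F (z, p.lev) = (T.G z, 0) := by
  simp [F, branch_R p hz]

omit hT in
theorem branch_dF (p : T.Branch) {z : ℝ} (hz : z ∈ p.dom) :
    T.dF (z, p.lev) = deriv T.G z := by
  simp [dF, branch_R p hz]

theorem branch_eq {p q : T.Branch} {z : ℝ} (hp : z ∈ p.dom) (hq : z ∈ q.dom) : p = q := by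
  have h1 := hT.Z_eq (branch_Z p) (branch_Z q) hp hq
  have h2 : p.lev = q.lev := by
    have := branch_R p hp
    have := branch_R q hq
    omega
  exact Subtype.ext (Prod.ext h2 h1)

theorem countable_branch : Countable T.Branch := by
  have : Countable T.Z := hT.Z_countable.to_subtype
  refine Function.Injective.countable (f := fun p : T.Branch => (⟨p.dom, branch_Z p⟩ : T.Z)) ?_
  intro p q h
  obtain ⟨z, hz⟩ := hT.Z_nonempty (branch_Z p)
  have h' : p.dom = q.dom := congrArg Subtype.val h
  exact hT.branch_eq hz (h' ▸ hz)

theorem branch_return (p : T.Branch) :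
    ContinuousOn T.G p.dom ∧ InjOn T.G p.dom ∧ ∃ i < T.N, T.G '' p.dom = baseInt i :=
  hT.Z_return p.lev p.dom (branch_Z p) p.2.2

theorem exists_part {ω : Set ℝ} (h : ω ∈ T.Z) {z : ℝ} (hz : z ∈ ω) {l : ℕ}
    (hl : (z, l) ∈ T.Del) : ∃ J ∈ T.part l, ω ⊆ J := by
  have : z ∈ ⋃₀ T.part l ∩ T.cells := by rw [hT.part_cover]; exact hl
  obtain ⟨⟨J, hJ, hzJ⟩, -⟩ := this
  refine ⟨J, hJ, ?_⟩
  rcases hT.part_union l J hJ ω h with h1 | h1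
  · exact h1
  · exact absurd hzJ (disjoint_left.1 h1 hz)

theorem exists_returning_part (p : T.Branch) :
    ∃ J ∈ T.part p.lev, T.Returns p.lev J ∧ p.dom ⊆ J := by
  obtain ⟨z, hz⟩ := hT.Z_nonempty (branch_Z p)
  obtain ⟨J, hJ, hsub⟩ := hT.exists_part (branch_Z p) hz (branch_Del p hz)
  refine ⟨J, hJ, ?_, hsub⟩
  rcases hT.markov_or _ J hJ with h | h
  · exact h
  · have := h z ⟨hsub hz, p.dom, branch_Z p, hz⟩
    have := branch_R p hz
    omega

omit hT in
theorem inv_mem (p : T.Branch) {x : ℝ} (hx : x ∈ T.G '' p.dom) : p.inv x ∈ p.dom :=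
  Function.invFunOn_mem hx

omit hT in
theorem G_inv (p : T.Branch) {x : ℝ} (hx : x ∈ T.G '' p.dom) : T.G (p.inv x) = x :=
  Function.invFunOn_eq hx

theorem inv_G (p : T.Branch) {z : ℝ} (hz : z ∈ p.dom) : p.inv (T.G z) = z :=
  (hT.branch_return p).2.1 (inv_mem p ⟨z, hz, rfl⟩) hz (G_inv p ⟨z, hz, rfl⟩)

theorem Del_open : IsOpen T.Del := by
  have : T.Del = ⋃ p ∈ {p : ℕ × Set ℝ | p.2 ∈ T.Z ∧ ∀ z ∈ p.2, (z, p.1) ∈ T.Del},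
      p.2 ×ˢ ({p.1} : Set ℕ) := by
    ext ⟨z, l⟩
    simp only [mem_ofPred_eq, mem_iUnion, mem_prod, mem_singleton_iff, exists_prop, Prod.exists]
    constructor
    · intro h
      obtain ⟨ω, hω, hz⟩ := exists_Z h
      exact ⟨l, ω, ⟨hω, fun w hw => (hT.Del_iff hω hz hw).1 h⟩, hz, rfl⟩
    · rintro ⟨l', ω, ⟨-, h⟩, hz, rfl⟩
      exact h z hz
  rw [this]
  exact isOpen_biUnion fun p hp => (hT.Z_open hp.1).prod (isOpen_discrete _)

theorem Del_measurable : MeasurableSet T.Del := hT.Del_open.measurableSet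

end IsTower

namespace IsExpanding

variable {α γ β C ξ : ℝ} (h : T.IsExpanding α γ β C ξ)
include h

theorem diff (p : T.Branch) {z : ℝ} (hz : z ∈ p.dom) : DifferentiableAt ℝ T.G z := by
  obtain ⟨J, hJ, hret, hsub⟩ := h.tower.exists_returning_part p
  exact (h.propA _ J hJ hret p.dom (IsTower.branch_Z p) hsub).1 z hz

theorem deriv_ge (p : T.Branch) {z : ℝ} (hz : z ∈ p.dom) :
    γ * Real.exp (β * p.lev) ≤ |deriv T.G z| := by
  obtain ⟨J, hJ, hret, hsub⟩ := h.tower.exists_returning_part p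
  exact h.propB _ J hJ hret z ⟨hsub hz, p.dom, IsTower.branch_Z p, hz⟩

theorem deriv_pos (p : T.Branch) {z : ℝ} (hz : z ∈ p.dom) : 0 < |deriv T.G z| :=
  lt_of_lt_of_le (mul_pos (by linarith [h.one_lt_gamma]) (Real.exp_pos _)) (h.deriv_ge p hz)

theorem dist_image_le_one (p : T.Branch) {x y : ℝ} (hx : x ∈ p.dom) (hy : y ∈ p.dom) :
    |T.G x - T.G y| ≤ 1 := by
  obtain ⟨-, -, i, -, hi⟩ := h.tower.branch_return p
  have h1 : T.G x ∈ baseInt i := hi ▸ ⟨x, hx, rfl⟩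
  have h2 : T.G y ∈ baseInt i := hi ▸ ⟨y, hy, rfl⟩
  rw [abs_le]
  constructor <;> linarith [h1.1, h1.2, h2.1, h2.2]

theorem distortion (p : T.Branch) {x y : ℝ} (hx : x ∈ p.dom) (hy : y ∈ p.dom) :
    |deriv T.G x / deriv T.G y - 1| ≤ C * |T.G x - T.G y| ^ α := by
  obtain ⟨J, hJ, hret, hsub⟩ := h.tower.exists_returning_part p
  obtain ⟨-, -, i, hi, hGi⟩ := h.tower.branch_return p
  exact h.propC _ J hJ hret i hi x ⟨hsub hx, p.dom, IsTower.branch_Z p, hx⟩ y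
    ⟨hsub hy, p.dom, IsTower.branch_Z p, hy⟩ (hGi ▸ ⟨x, hx, rfl⟩) (hGi ▸ ⟨y, hy, rfl⟩)

theorem deriv_le (p : T.Branch) {x y : ℝ} (hx : x ∈ p.dom) (hy : y ∈ p.dom) :
    |deriv T.G x| ≤ (1 + C) * |deriv T.G y| := by
  have h1 := h.distortion p hx hy
  have h2 : |T.G x - T.G y| ^ α ≤ 1 :=
    Real.rpow_le_one (abs_nonneg _) (h.dist_image_le_one p hx hy) h.alpha_pos.le
  have h3 : |deriv T.G x / deriv T.G y| ≤ 1 + C := by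
    have := abs_sub_abs_le_abs_sub (deriv T.G x / deriv T.G y) 1
    rw [abs_one] at this
    nlinarith [h.C_pos]
  rwa [abs_div, div_le_iff₀ (h.deriv_pos p hy)] at h3

theorem expand (p : T.Branch) {x y : ℝ} (hx : x ∈ p.dom) (hy : y ∈ p.dom) :
    γ * Real.exp (β * p.lev) * |x - y| ≤ |T.G x - T.G y| := by
  have key : ∀ x ∈ p.dom, ∀ y ∈ p.dom, x < y →
      γ * Real.exp (β * p.lev) * |x - y| ≤ |T.G x - T.G y| := by
    intro x hx y hy hxy
    have hsub : Icc x y ⊆ p.dom := (h.tower.Z_ordConnected (IsTower.branch_Z p)).out hx hy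
    obtain ⟨c, hc, hcd⟩ := exists_deriv_eq_slope T.G hxy
      ((h.tower.branch_return p).1.mono hsub)
      (fun z hz => (h.diff p (hsub (Ioo_subset_Icc_self hz))).differentiableWithinAt)
    have h1 := h.deriv_ge p (hsub (Ioo_subset_Icc_self hc))
    rw [hcd, abs_div, le_div_iff₀ (abs_pos.2 (by linarith))] at h1
    rwa [abs_sub_comm x, abs_sub_comm (T.G x)]
  rcases lt_trichotomy x y with hxy | rfl | hxy
  · exact key x hx y hy hxy
  · simp
  · rw [abs_sub_comm x, abs_sub_comm (T.G x)]
    exact key y hy x hx hxy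

theorem gamma_rpow_pos : 0 < γ ^ α := Real.rpow_pos_of_pos (by linarith [h.one_lt_gamma]) _

/-- The weight `e^{ξ l}` is compensated by the contraction of the inverse branches. -/
theorem weight_contract (p : T.Branch) {x y : ℝ} (hx : x ∈ p.dom) (hy : y ∈ p.dom) :
    Real.exp (ξ * p.lev) * |x - y| ^ α ≤ |T.G x - T.G y| ^ α / γ ^ α := by
  have hg : 0 < γ := by linarith [h.one_lt_gamma]
  rw [le_div_iff₀ h.gamma_rpow_pos]
  have h1 := Real.rpow_le_rpow (by positivity) (h.expand p hx hy) h.alpha_pos.le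
  rw [Real.mul_rpow (by positivity) (abs_nonneg _), Real.mul_rpow hg.le (Real.exp_pos _).le,
    ← Real.exp_mul] at h1
  refine le_trans ?_ h1
  have h2 : Real.exp (ξ * p.lev) ≤ Real.exp (β * p.lev * α) := by
    apply Real.exp_le_exp.2
    nlinarith [h.xi_lt, (Nat.cast_nonneg p.lev : (0 : ℝ) ≤ p.lev)]
  have h3 : 0 ≤ |x - y| ^ α := Real.rpow_nonneg (abs_nonneg _) _
  have h4 := mul_le_mul_of_nonneg_left h2 (mul_nonneg h.gamma_rpow_pos.le h3)
  nlinarith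

omit h in
theorem consA_pos : 0 < consA C γ α ξ := lt_max_of_lt_left (Real.exp_pos _)

theorem consA_lt_one : consA C γ α ξ < 1 :=
  max_lt (by simpa using h.xi_pos) h.nonlin

theorem volume_dom_lt_top (p : T.Branch) : volume p.dom < ∞ := by
  obtain ⟨⟨a, b, -, hab⟩, -⟩ := h.tower.Z_cell _ (IsTower.branch_Z p)
  rw [hab]
  exact measure_Ioo_lt_top

theorem dom_measurable (p : T.Branch) : MeasurableSet p.dom :=
  (h.tower.Z_open (IsTower.branch_Z p)).measurableSet

/-- Change of variables along a branch. -/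
theorem lintegral_image (p : T.Branch) {s : Set ℝ} (hs : MeasurableSet s) (hsub : s ⊆ p.dom)
    (g : ℝ → ℝ≥0∞) :
    ∫⁻ x in T.G '' s, g x = ∫⁻ x in s, ENNReal.ofReal |deriv T.G x| * g (T.G x) :=
  lintegral_image_eq_lintegral_abs_deriv_mul hs
    (fun _ hx => (h.diff p (hsub hx)).hasDerivAt.hasDerivWithinAt)
    ((h.tower.branch_return p).2.1.mono hsub) g

/-- Bounded distortion: the derivative on a branch is at least of the order of the inverse of the
length of its domain. -/
theorem inv_deriv_le (p : T.Branch) {y : ℝ} (hy : y ∈ p.dom) :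
    1 ≤ (1 + C) * |deriv T.G y| * (volume p.dom).toReal := by
  obtain ⟨-, -, i, -, hi⟩ := h.tower.branch_return p
  have h1 := h.lintegral_image p (h.dom_measurable p) subset_rfl (fun _ => 1)
  rw [hi] at h1
  simp only [lintegral_const, mul_one, one_mul, Measure.restrict_apply_univ, baseInt,
    Real.volume_Ioo] at h1
  have h2 : (1 : ℝ≥0∞) ≤ ENNReal.ofReal ((1 + C) * |deriv T.G y|) * volume p.dom := by
    calc (1 : ℝ≥0∞) = ∫⁻ x in p.dom, ENNReal.ofReal |deriv T.G x| := by rw [← h1]; simp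
      _ ≤ ∫⁻ x in p.dom, ENNReal.ofReal ((1 + C) * |deriv T.G y|) :=
          setLIntegral_mono' (h.dom_measurable p)
            fun x hx => ENNReal.ofReal_le_ofReal (h.deriv_le p hx hy)
      _ = _ := by simp
  have h3 := ENNReal.toReal_mono (ENNReal.mul_ne_top ENNReal.ofReal_ne_top
    (h.volume_dom_lt_top p).ne) h2
  rwa [ENNReal.toReal_mul, ENNReal.toReal_ofReal (by have := h.C_pos; positivity),
    ENNReal.toReal_one] at h3

end IsExpanding

/-- The weighted length `e^{ξ l} m(ω)` of a branch `(l, ω)`. -/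
def Branch.wt (ξ : ℝ) (p : T.Branch) : ℝ≥0∞ :=
  ENNReal.ofReal (Real.exp (ξ * p.lev)) * volume p.dom

namespace IsExpanding

variable {α γ β C ξ : ℝ} (h : T.IsExpanding α γ β C ξ)
include h

theorem tsum_branch_volume_le (l : ℕ) {s : Set ℝ}
    (hs : ∀ p : T.Branch, p.lev = l → p.dom ⊆ s) :
    ∑' p : {p : T.Branch // p.lev = l}, volume p.1.dom ≤ volume s := by
  have := h.tower.countable_branch
  rw [← measure_iUnion]
  · exact measure_mono (iUnion_subset fun p => hs p.1 p.2)
  · intro p q hpq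
    refine disjoint_left.2 fun z hz hz' => hpq (Subtype.ext (h.tower.branch_eq hz hz'))
  · exact fun p => h.dom_measurable p.1

omit h in
theorem tsum_wt_eq : ∑' p : T.Branch, p.wt ξ =
    ∑' l : ℕ, ENNReal.ofReal (Real.exp (ξ * l)) *
      ∑' p : {p : T.Branch // p.lev = l}, volume p.1.dom := by
  rw [← (Equiv.sigmaFiberEquiv (Branch.lev (T := T))).tsum_eq, ENNReal.tsum_sigma']
  refine tsum_congr fun l => ?_
  rw [← ENNReal.tsum_mul_left]
  refine tsum_congr fun p => ?_
  simp [Branch.wt, Equiv.sigmaFiberEquiv, p.2]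

theorem tsum_wt_ne_top : ∑' p : T.Branch, p.wt ξ ≠ ∞ := by
  refine ne_top_of_le_ne_top h.weight_ne_top ?_
  rw [tsum_wt_eq]
  refine ENNReal.tsum_le_tsum fun l => mul_le_mul_right (h.tsum_branch_volume_le l ?_) _
  rintro p rfl z hz
  exact IsTower.branch_Del p hz

theorem tsum_wt_le_consD :
    ENNReal.ofReal (1 + C) * ∑' p : T.Branch, p.wt ξ ≤ T.consD C ξ := by
  rw [tsum_wt_eq, consD]
  refine mul_le_mul_right (ENNReal.tsum_le_tsum fun l => ?_) _
  rw [ENNReal.tsum_mul_left]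
  refine mul_le_mul_right ?_ _
  have : Countable {J : Set ℝ // J ∈ T.part l ∧ T.Returns l J} :=
    ((h.tower.part_countable l).mono fun J hJ => hJ.1).to_subtype
  refine le_trans (h.tsum_branch_volume_le l (s := ⋃ J : {J : Set ℝ // J ∈ T.part l ∧
    T.Returns l J}, J.1) ?_) (measure_iUnion_le _)
  rintro p rfl
  obtain ⟨J, hJ, hret, hsub⟩ := h.tower.exists_returning_part p
  exact fun z hz => mem_iUnion.2 ⟨⟨J, hJ, hret⟩, hsub hz⟩

theorem summable_wt : Summable fun p : T.Branch => (p.wt ξ).toReal :=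
  ENNReal.summable_toReal h.tsum_wt_ne_top

end IsExpanding

/-! ### The transfer operator -/

/-- The contribution of a branch to the transfer operator at the point `(x, 0)` of the base. -/
def brTerm (f : ℝ × ℕ → ℝ) (p : T.Branch) (x : ℝ) : ℝ :=
  (T.G '' p.dom).indicator (fun x => f (p.inv x, p.lev) / |deriv T.G (p.inv x)|) x

/-- `f` is nonnegative and at most a multiple of `e^{ξ l}` on level `l`. -/
def NonnegBdd (T : TowerData) (ξ M : ℝ) (f : ℝ × ℕ → ℝ) : Prop :=
  ∀ x ∈ T.Del, 0 ≤ f x ∧ f x ≤ M * Real.exp (ξ * x.2)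

/-- The oscillation of `f` at distance `t` from a point of level `l`, inside an element of `Z`, is
at most `e^{ξ l} t ^ α` times the value of `g` at the point.  For nonnegative `f` and `g = K f` this
is the condition `‖f‖_r ≤ K`, except that it also applies at zeros of `f` and that the elements of
the Markov partition are replaced by those of `Z`, which suffices because eigenfunctions of the
transfer operator turn out to be Hölder over whole base intervals.  Allowing any `g` covers
differences of two elements of the space `X`. -/
def HolderRel (T : TowerData) (α ξ : ℝ) (f g : ℝ × ℕ → ℝ) : Prop :=
  ∀ l, ∀ ω ∈ T.Z, (∀ z ∈ ω, (z, l) ∈ T.Del) → ∀ x ∈ ω, ∀ y ∈ ω,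
    |f (x, l) - f (y, l)| ≤ Real.exp (ξ * l) * |x - y| ^ α * g (x, l)

namespace IsTower

variable (hT : T.IsTower)
include hT

omit hT in
theorem transfer_succ (f : ℝ × ℕ → ℝ) {z : ℝ} {l : ℕ} (hz : (z, l + 1) ∈ T.Del) :
    T.transfer f (z, l + 1) = f (z, l) := by
  have hmem : (z, l) ∈ T.Del ∧ T.F (z, l) = (z, l + 1) := ⟨Del_pred hz, F_of_Del_succ hz⟩
  rw [transfer, tsum_eq_single ⟨(z, l), hmem⟩]
  · simp [dF, R_of_Del_succ hz]
  · rintro ⟨⟨w, k⟩, hw, hF⟩ hne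
    refine absurd (Subtype.ext ?_) hne
    rcases F_eq_or hw with ⟨-, h1⟩ | ⟨-, h1⟩
    · rw [h1, Prod.mk.injEq] at hF
      exact Prod.ext hF.1 (by simpa using hF.2)
    · rw [h1, Prod.mk.injEq] at hF
      exact absurd hF.2 (by simp)

/-- On the base, the sum over all preimages is a sum over the returning branches. -/
theorem transfer_zero (f : ℝ × ℕ → ℝ) (x : ℝ) :
    T.transfer f (x, 0) = ∑' p : T.Branch, brTerm f p x := by
  let e : {p : T.Branch | x ∈ T.G '' p.dom} → {y : ℝ × ℕ // y ∈ T.Del ∧ T.F y = (x, 0)} :=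
    fun p => ⟨(p.1.inv x, p.1.lev), branch_Del _ (inv_mem _ p.2), by
      rw [branch_F _ (inv_mem _ p.2), G_inv _ p.2]⟩
  have he : Function.Bijective e := by
    refine ⟨?_, ?_⟩
    · rintro ⟨p, hp⟩ ⟨q, hq⟩ hpq
      have h1 : p.inv x = q.inv x := congrArg (fun y => y.1.1) hpq
      exact Subtype.ext (hT.branch_eq (inv_mem p hp) (h1 ▸ inv_mem q hq))
    · rintro ⟨⟨w, k⟩, hw, hF⟩
      rcases F_eq_or hw with ⟨-, h1⟩ | ⟨hR, h1⟩
      · rw [hF, Prod.mk.injEq] at h1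
        exact absurd h1.2 (by simp)
      · rw [hF, Prod.mk.injEq] at h1
        obtain ⟨p, hwp, rfl⟩ := hT.exists_branch hw hR
        refine ⟨⟨p, w, hwp, h1.1.symm⟩, Subtype.ext (Prod.ext ?_ rfl)⟩
        change p.inv x = w
        rw [h1.1, hT.inv_G p hwp]
  rw [transfer, ← (Equiv.ofBijective e he).tsum_eq]
  have h2 : ∀ p : T.Branch, brTerm f p x = {p : T.Branch | x ∈ T.G '' p.dom}.indicator
      (fun p => f (p.inv x, p.lev) / |deriv T.G (p.inv x)|) p := by
    intro p
    rfl
  rw [tsum_congr h2, ← tsum_subtype]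
  refine tsum_congr fun p => ?_
  change f (p.1.inv x, p.1.lev) / |T.dF (p.1.inv x, p.1.lev)| = _
  rw [branch_dF _ (inv_mem _ p.2)]

end IsTower

theorem NonnegBdd.add {ξ M N : ℝ} {f g : ℝ × ℕ → ℝ} (hf : T.NonnegBdd ξ M f)
    (hg : T.NonnegBdd ξ N g) : T.NonnegBdd ξ (M + N) (f + g) := fun x hx => by
  have h1 := hf x hx
  have h2 := hg x hx
  simp only [Pi.add_apply, add_mul]
  exact ⟨by linarith, by linarith⟩

theorem NonnegBdd.smul {ξ M c : ℝ} {f : ℝ × ℕ → ℝ} (hf : T.NonnegBdd ξ M f) (hc : 0 ≤ c) :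
    T.NonnegBdd ξ (c * M) (c • f) := fun x hx => by
  have h1 := hf x hx
  simp only [Pi.smul_apply, smul_eq_mul]
  exact ⟨mul_nonneg hc h1.1, by rw [mul_assoc]; exact mul_le_mul_of_nonneg_left h1.2 hc⟩

theorem brTerm_add (f g : ℝ × ℕ → ℝ) (p : T.Branch) (x : ℝ) :
    brTerm (f + g) p x = brTerm f p x + brTerm g p x := by
  by_cases hx : x ∈ T.G '' p.dom
  · simp [brTerm, hx, add_div]
  · simp [brTerm, hx]

theorem transfer_smul (c : ℝ) (f : ℝ × ℕ → ℝ) : T.transfer (c • f) = c • T.transfer f := by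
  ext x
  simp only [transfer, Pi.smul_apply, smul_eq_mul, ← tsum_mul_left, mul_div_assoc]

/-- A function which is Hölder in this sense on the elements of `Z` is continuous, the tower being
a union of open intervals. -/
theorem HolderRel.continuousOn (hT : T.IsTower) {α ξ : ℝ} (hα : 0 < α) {f g : ℝ × ℕ → ℝ}
    (hfg : T.HolderRel α ξ f g) : ContinuousOn f T.Del := by
  rintro ⟨z, l⟩ hz
  refine ContinuousAt.continuousWithinAt ?_
  obtain ⟨ω, hω, hzω⟩ := IsTower.exists_Z hz
  have hD : ∀ w ∈ ω, (w, l) ∈ T.Del := fun w hw => (hT.Del_iff hω hzω hw).1 hz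
  rw [ContinuousAt, nhds_prod_eq, nhds_discrete ℕ, tendsto_iff_norm_sub_tendsto_zero]
  have h0 : Tendsto (fun y : ℝ × ℕ => Real.exp (ξ * l) * |z - y.1| ^ α * g (z, l))
      (𝓝 z ×ˢ pure l) (𝓝 0) := by
    have : Tendsto (fun w : ℝ => Real.exp (ξ * l) * |z - w| ^ α * g (z, l)) (𝓝 z) (𝓝 0) := by
      have hc : Continuous fun w : ℝ => Real.exp (ξ * l) * |z - w| ^ α * g (z, l) := by
        have : Continuous fun w : ℝ => |z - w| ^ α :=
          (continuous_const.sub continuous_id).abs.rpow_const fun _ => Or.inr hα.le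
        fun_prop
      have := hc.tendsto z
      simpa [Real.zero_rpow hα.ne'] using this
    exact this.comp tendsto_fst
  refine squeeze_zero' (Eventually.of_forall fun _ => norm_nonneg _) ?_ h0
  have hev : ∀ᶠ y : ℝ × ℕ in 𝓝 z ×ˢ pure l, y.1 ∈ ω ∧ y.2 = l :=
    Eventually.prod_mk (la := 𝓝 z) (pa := fun w => w ∈ ω) ((hT.Z_open hω).mem_nhds hzω)
      (by simp : ∀ᶠ k in pure l, k = l)
  filter_upwards [hev] with y hy
  obtain ⟨w, k⟩ := y
  obtain ⟨hw, rfl⟩ := hy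
  rw [Real.norm_eq_abs, abs_sub_comm]
  exact hfg _ ω hω hD z hzω w hw

namespace IsExpanding

variable {α γ β C ξ : ℝ} (h : T.IsExpanding α γ β C ξ)
include h

theorem inv_abs_deriv_le (p : T.Branch) {y : ℝ} (hy : y ∈ p.dom) :
    1 / |deriv T.G y| ≤ (1 + C) * (volume p.dom).toReal := by
  rw [div_le_iff₀ (h.deriv_pos p hy)]
  linarith [h.inv_deriv_le p hy]

omit h in
theorem brTerm_nonneg {M : ℝ} {f : ℝ × ℕ → ℝ} (hf : T.NonnegBdd ξ M f) (p : T.Branch) (x : ℝ) :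
    0 ≤ brTerm f p x :=
  indicator_nonneg (fun _ hx => div_nonneg
    (hf _ (IsTower.branch_Del p (IsTower.inv_mem p hx))).1 (abs_nonneg _)) _

omit h in
theorem toReal_wt (p : T.Branch) :
    (p.wt ξ).toReal = Real.exp (ξ * p.lev) * (volume p.dom).toReal := by
  rw [Branch.wt, ENNReal.toReal_mul, ENNReal.toReal_ofReal (Real.exp_pos _).le]

theorem brTerm_le {M : ℝ} (hM : 0 ≤ M) {f : ℝ × ℕ → ℝ} (hf : T.NonnegBdd ξ M f) (p : T.Branch)
    (x : ℝ) : brTerm f p x ≤ M * (1 + C) * (p.wt ξ).toReal := by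
  have hC := h.C_pos
  have h0 : 0 ≤ M * (1 + C) * (p.wt ξ).toReal :=
    mul_nonneg (by positivity) ENNReal.toReal_nonneg
  refine indicator_le' (fun x hx => ?_) (fun x _ => h0) x
  have hy := IsTower.inv_mem p hx
  have h1 := (hf _ (IsTower.branch_Del p hy))
  have h2 := h.inv_abs_deriv_le p hy
  calc f (p.inv x, p.lev) / |deriv T.G (p.inv x)|
      = f (p.inv x, p.lev) * (1 / |deriv T.G (p.inv x)|) := by ring
    _ ≤ (M * Real.exp (ξ * p.lev)) * ((1 + C) * (volume p.dom).toReal) :=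
        mul_le_mul h1.2 h2 (by positivity) (by positivity)
    _ = _ := by rw [toReal_wt]; ring

theorem summable_brTerm {M : ℝ} {f : ℝ × ℕ → ℝ} (hf : T.NonnegBdd ξ M f) (x : ℝ) :
    Summable fun p : T.Branch => brTerm f p x := by
  have hf' : T.NonnegBdd ξ (max M 0) f := fun x hx => ⟨(hf x hx).1, (hf x hx).2.trans
    (mul_le_mul_of_nonneg_right (le_max_left _ _) (Real.exp_pos _).le)⟩
  exact Summable.of_nonneg_of_le (brTerm_nonneg hf · x)
    (h.brTerm_le (le_max_right M 0) hf' · x) (h.summable_wt.mul_left _)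

theorem transfer_nonneg {M : ℝ} {f : ℝ × ℕ → ℝ} (hf : T.NonnegBdd ξ M f) {x : ℝ × ℕ}
    (hx : x ∈ T.Del) : 0 ≤ T.transfer f x := by
  obtain ⟨z, l⟩ := x
  cases l with
  | zero =>
    rw [h.tower.transfer_zero]
    exact tsum_nonneg (brTerm_nonneg hf · z)
  | succ l =>
    rw [IsTower.transfer_succ f hx]
    exact (hf _ (IsTower.Del_pred hx)).1

theorem transfer_add {M N : ℝ} {f g : ℝ × ℕ → ℝ} (hf : T.NonnegBdd ξ M f)
    (hg : T.NonnegBdd ξ N g) {x : ℝ × ℕ} (hx : x ∈ T.Del) :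
    T.transfer (f + g) x = T.transfer f x + T.transfer g x := by
  obtain ⟨z, l⟩ := x
  cases l with
  | zero =>
    simp only [h.tower.transfer_zero, brTerm_add]
    exact (h.summable_brTerm hf z).tsum_add (h.summable_brTerm hg z)
  | succ l => simp [IsTower.transfer_succ _ hx]

theorem transfer_mono {M N : ℝ} {f g : ℝ × ℕ → ℝ} (hf : T.NonnegBdd ξ M f)
    (hg : T.NonnegBdd ξ N g) (hfg : ∀ x ∈ T.Del, f x ≤ g x) {x : ℝ × ℕ} (hx : x ∈ T.Del) :
    T.transfer f x ≤ T.transfer g x := by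
  obtain ⟨z, l⟩ := x
  cases l with
  | zero =>
    simp only [h.tower.transfer_zero]
    refine (h.summable_brTerm hf z).tsum_le_tsum (fun p => ?_) (h.summable_brTerm hg z)
    exact indicator_le_indicator' fun hz => div_le_div_of_nonneg_right
      (hfg _ (IsTower.branch_Del p (IsTower.inv_mem p hz))) (abs_nonneg _)
  | succ l =>
    simp only [IsTower.transfer_succ _ hx]
    exact hfg _ (IsTower.Del_pred hx)

/-- The value of the transferred function at a point of the base is at least the contribution of
any one preimage. -/
theorem le_transfer {M : ℝ} {f : ℝ × ℕ → ℝ} (hf : T.NonnegBdd ξ M f) (p : T.Branch) {z : ℝ}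
    (hz : z ∈ p.dom) : f (z, p.lev) / |deriv T.G z| ≤ T.transfer f (T.G z, 0) := by
  rw [h.tower.transfer_zero]
  refine le_trans (le_of_eq ?_) ((h.summable_brTerm hf _).le_tsum p fun q _ => brTerm_nonneg hf q _)
  rw [brTerm, indicator_of_mem (mem_image_of_mem T.G hz), h.tower.inv_G p hz]

theorem tendsto_transfer {M : ℝ} (hM : 0 ≤ M) {u : ℕ → ℝ × ℕ → ℝ} {f : ℝ × ℕ → ℝ}
    (hu : ∀ n, T.NonnegBdd ξ M (u n))
    (hf : ∀ x ∈ T.Del, Tendsto (fun n => u n x) atTop (𝓝 (f x))) {x : ℝ × ℕ} (hx : x ∈ T.Del) :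
    Tendsto (fun n => T.transfer (u n) x) atTop (𝓝 (T.transfer f x)) := by
  obtain ⟨z, l⟩ := x
  cases l with
  | zero =>
    simp only [h.tower.transfer_zero]
    refine tendsto_tsum_of_dominated_convergence (h.summable_wt.mul_left (M * (1 + C))) ?_ ?_
    · intro p
      by_cases hz : z ∈ T.G '' p.dom
      · simp only [brTerm, indicator_of_mem hz]
        exact (hf _ (IsTower.branch_Del p (IsTower.inv_mem p hz))).div_const _
      · simp [brTerm, hz]
    · refine Eventually.of_forall fun n p => ?_
      rw [Real.norm_of_nonneg (brTerm_nonneg (hu n) p z)]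
      exact h.brTerm_le hM (hu n) p z
  | succ l =>
    simp only [IsTower.transfer_succ _ hx]
    exact hf _ (IsTower.Del_pred hx)

/-! ### The Lasota-Yorke inequality -/

theorem brTerm_holder {f g : ℝ × ℕ → ℝ} {M N : ℝ} (hf : T.NonnegBdd ξ M f)
    (hg : T.NonnegBdd ξ N g) (hfg : T.HolderRel α ξ f g) (p : T.Branch) {i : ℕ} {x y : ℝ}
    (hx : x ∈ baseInt i) (hy : y ∈ baseInt i) :
    |brTerm f p x - brTerm f p y| ≤
      |x - y| ^ α * (consA C γ α ξ * brTerm g p x + C * brTerm f p x) := by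
  obtain ⟨-, -, j, -, hj⟩ := h.tower.branch_return p
  by_cases hij : j = i
  · subst hij
    rw [← hj] at hx hy
    have hX := IsTower.inv_mem p hx
    have hY := IsTower.inv_mem p hy
    have hGX := IsTower.G_inv p hx
    have hGY := IsTower.G_inv p hy
    simp only [brTerm, indicator_of_mem hx, indicator_of_mem hy]
    set X := p.inv x
    set Y := p.inv y
    have hC := h.C_pos
    have dX := h.deriv_pos p hX
    have dY := h.deriv_pos p hY
    have hfX := (hf _ (IsTower.branch_Del p hX)).1
    have hgX := (hg _ (IsTower.branch_Del p hX)).1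
    have hDel : ∀ z ∈ p.dom, (z, p.lev) ∈ T.Del := fun z hz => IsTower.branch_Del p hz
    have h1 := hfg p.lev p.dom (IsTower.branch_Z p) hDel X hX Y hY
    have h2 := h.distortion p hX hY
    have h3 := h.weight_contract p hX hY
    rw [hGX, hGY] at h2 h3
    set t := |x - y| ^ α
    have ht : 0 ≤ t := Real.rpow_nonneg (abs_nonneg _) _
    set r := |deriv T.G X| / |deriv T.G Y| with hr
    have hr1 : r ≤ 1 + C := by
      rw [hr, div_le_iff₀ dY]; exact h.deriv_le p hX hY
    have hr0 : 0 ≤ r := by positivity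
    have h4 : |1 - r| ≤ C * t := by
      refine le_trans ?_ h2
      rw [hr, ← abs_div]
      have := abs_abs_sub_abs_le (deriv T.G X / deriv T.G Y) 1
      rw [abs_one, abs_sub_comm] at this
      exact this
    have h5 : f (X, p.lev) / |deriv T.G X| - f (Y, p.lev) / |deriv T.G Y| =
        ((f (X, p.lev) - f (Y, p.lev)) * r + f (X, p.lev) * (1 - r)) / |deriv T.G X| := by
      rw [hr]; field_simp; ring
    have ha : (1 + C) / γ ^ α ≤ consA C γ α ξ := le_max_right _ _
    have hgam := h.gamma_rpow_pos
    rw [h5, abs_div, abs_abs]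
    have h6 : |(f (X, p.lev) - f (Y, p.lev)) * r + f (X, p.lev) * (1 - r)| ≤
        t * (consA C γ α ξ * g (X, p.lev) + C * f (X, p.lev)) := by
      calc _ ≤ |f (X, p.lev) - f (Y, p.lev)| * r + f (X, p.lev) * |1 - r| := by
            refine (abs_add_le _ _).trans (le_of_eq ?_)
            rw [abs_mul, abs_mul, abs_of_nonneg hr0, abs_of_nonneg hfX]
        _ ≤ (t / γ ^ α * g (X, p.lev)) * (1 + C) + f (X, p.lev) * (C * t) := by
            refine add_le_add (mul_le_mul (h1.trans ?_) hr1 hr0 (by positivity))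
              (mul_le_mul_of_nonneg_left h4 hfX)
            exact mul_le_mul_of_nonneg_right h3 hgX
        _ = t * ((1 + C) / γ ^ α * g (X, p.lev) + C * f (X, p.lev)) := by
            field_simp
        _ ≤ _ := by gcongr
    calc _ ≤ t * (consA C γ α ξ * g (X, p.lev) + C * f (X, p.lev)) / |deriv T.G X| := by gcongr
      _ = _ := by ring
  · have hd : ∀ z ∈ baseInt i, z ∉ T.G '' p.dom := by
      intro z hz hz'
      rw [hj] at hz'
      have h1 : (i : ℝ) < j + 1 := hz.1.trans hz'.2
      have h2 : (j : ℝ) < i + 1 := hz'.1.trans hz.2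
      have h1' : i < j + 1 := by exact_mod_cast h1
      have h2' : j < i + 1 := by exact_mod_cast h2
      omega
    simp [brTerm, hd x hx, hd y hy]

/-- On the base, the transfer operator makes a function Hölder on all of each base interval, across
the elements of `Z`. -/
theorem transfer_holder_base {f g : ℝ × ℕ → ℝ} {M N : ℝ} (hf : T.NonnegBdd ξ M f)
    (hg : T.NonnegBdd ξ N g) (hfg : T.HolderRel α ξ f g) {i : ℕ} {x y : ℝ}
    (hx : x ∈ baseInt i) (hy : y ∈ baseInt i) :
    |T.transfer f (x, 0) - T.transfer f (y, 0)| ≤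
      |x - y| ^ α * (consA C γ α ξ * T.transfer g (x, 0) + C * T.transfer f (x, 0)) := by
  simp only [h.tower.transfer_zero]
  have s1 := h.summable_brTerm hf x
  have s2 := h.summable_brTerm hf y
  have s3 := h.summable_brTerm hg x
  have s4 : Summable fun p : T.Branch =>
      |x - y| ^ α * (consA C γ α ξ * brTerm g p x + C * brTerm f p x) :=
    ((s3.mul_left _).add (s1.mul_left C)).mul_left _
  have s5 : Summable fun p : T.Branch => |brTerm f p x - brTerm f p y| := (s1.sub s2).abs
  have h1 : ∑' p : T.Branch, |x - y| ^ α * (consA C γ α ξ * brTerm g p x + C * brTerm f p x) =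
      |x - y| ^ α * (consA C γ α ξ * ∑' p : T.Branch, brTerm g p x +
        C * ∑' p : T.Branch, brTerm f p x) := by
    rw [tsum_mul_left, (s3.mul_left _).tsum_add (s1.mul_left _), tsum_mul_left, tsum_mul_left]
  have h2 : |∑' p : T.Branch, (brTerm f p x - brTerm f p y)| ≤
      ∑' p : T.Branch, |brTerm f p x - brTerm f p y| := by
    have := norm_tsum_le_tsum_norm (f := fun p : T.Branch => brTerm f p x - brTerm f p y)
      (by simpa only [Real.norm_eq_abs] using s5)
    simpa only [Real.norm_eq_abs] using this
  rw [s1.tsum_sub s2] at h2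
  rw [← h1]
  exact h2.trans (s5.tsum_le_tsum (fun p => h.brTerm_holder hf hg hfg p hx hy) s4)

/-- The Lasota-Yorke inequality for the Hölder quotient. -/
theorem transfer_holder {f g : ℝ × ℕ → ℝ} {M N : ℝ} (hf : T.NonnegBdd ξ M f)
    (hg : T.NonnegBdd ξ N g) (hfg : T.HolderRel α ξ f g) :
    T.HolderRel α ξ (T.transfer f)
      (fun x => consA C γ α ξ * T.transfer g x + C * T.transfer f x) := by
  intro l ω hω hD x hx y hy
  cases l with
  | zero =>
    obtain ⟨i, -, hi⟩ := h.tower.Z_base hω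
    simpa using h.transfer_holder_base hf hg hfg (hi hx) (hi hy)
  | succ l =>
    simp only [IsTower.transfer_succ _ (hD x hx), IsTower.transfer_succ _ (hD y hy)]
    have h1 := hfg l ω hω (fun z hz => IsTower.Del_pred (hD z hz)) x hx y hy
    have hfx := (hf _ (IsTower.Del_pred (hD x hx))).1
    have hgx := (hg _ (IsTower.Del_pred (hD x hx))).1
    have hC := h.C_pos
    have he : Real.exp (ξ * l) ≤ Real.exp (ξ * (l + 1 : ℕ)) * consA C γ α ξ := by
      have : Real.exp (ξ * l) = Real.exp (ξ * (l + 1 : ℕ)) * Real.exp (-ξ) := by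
        rw [← Real.exp_add]; congr 1; push_cast; ring
      rw [this]
      exact mul_le_mul_of_nonneg_left (le_max_left _ _) (Real.exp_pos _).le
    have ht : 0 ≤ |x - y| ^ α := Real.rpow_nonneg (abs_nonneg _) _
    calc _ ≤ _ := h1
      _ ≤ (Real.exp (ξ * (l + 1 : ℕ)) * consA C γ α ξ) * |x - y| ^ α * g (x, l) := by gcongr
      _ = Real.exp (ξ * (l + 1 : ℕ)) * |x - y| ^ α * (consA C γ α ξ * g (x, l)) := by ring
      _ ≤ _ := by
        refine mul_le_mul_of_nonneg_left ?_ (by positivity)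
        nlinarith

end IsExpanding

/-! ### Duality and the mass lost to the hole -/

/-- The slice of a subset of the tower at level `l`. -/
def slice (A : Set (ℝ × ℕ)) (l : ℕ) : Set ℝ := {z | (z, l) ∈ A}

theorem measurableSet_slice {A : Set (ℝ × ℕ)} (hA : MeasurableSet A) (l : ℕ) :
    MeasurableSet (slice A l) := by
  have : Measurable fun z : ℝ => (z, l) := measurable_prodMk_right
  exact this hA

theorem setLIntegral_prod_singleton (s : Set ℝ) (l : ℕ) (f : ℝ × ℕ → ℝ≥0∞) :
    ∫⁻ x in s ×ˢ {l}, f x ∂leb = ∫⁻ z in s, f (z, l) := by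
  rw [leb, ← Measure.prod_restrict, Measure.restrict_singleton, Measure.count_singleton, one_smul,
    Measure.prod_dirac, MeasurableEmbedding.lintegral_map]
  exact MeasurableEmbedding.prodMk_right MeasurableEmbedding.id l

theorem setLIntegral_slices {A : Set (ℝ × ℕ)} (hA : MeasurableSet A) (f : ℝ × ℕ → ℝ≥0∞) :
    ∫⁻ x in A, f x ∂leb = ∑' l, ∫⁻ z in slice A l, f (z, l) := by
  have h1 : A = ⋃ l, slice A l ×ˢ ({l} : Set ℕ) := by
    ext ⟨z, l⟩
    simp [slice]
  conv_lhs => rw [h1]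
  rw [lintegral_iUnion]
  · simp only [setLIntegral_prod_singleton]
  · exact fun l => (measurableSet_slice hA l).prod (measurableSet_singleton l)
  · intro l k hlk
    refine disjoint_left.2 ?_
    rintro ⟨z, m⟩ ⟨-, h1⟩ ⟨-, h2⟩
    exact hlk (h1.symm.trans h2)

/-- The part of the tower that is mapped to the base, with base point in `S`. -/
def returning (T : TowerData) (S : Set ℝ) : Set (ℝ × ℕ) :=
  ⋃ p : T.Branch, (p.dom ∩ T.G ⁻¹' S) ×ˢ ({p.lev} : Set ℕ)

/-- The points `(z, l)` with `(z, l + 1)` in `A`.  For a subset `A` of the tower these are the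
points which are mapped up into `A`. -/
def rising (A : Set (ℝ × ℕ)) : Set (ℝ × ℕ) :=
  ⋃ l : ℕ, slice A (l + 1) ×ˢ ({l} : Set ℕ)

theorem measurableSet_rising {A : Set (ℝ × ℕ)} (hA : MeasurableSet A) :
    MeasurableSet (rising A) :=
  MeasurableSet.iUnion fun l => (measurableSet_slice hA _).prod (measurableSet_singleton l)

theorem setLIntegral_rising {A : Set (ℝ × ℕ)} (hA : MeasurableSet A) (f : ℝ × ℕ → ℝ≥0∞) :
    ∫⁻ x in rising A, f x ∂leb = ∑' l, ∫⁻ z in slice A (l + 1), f (z, l) := by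
  rw [setLIntegral_slices (measurableSet_rising hA)]
  have : ∀ l, slice (rising A) l = slice A (l + 1) := by
    intro l
    ext z
    simp [slice, rising]
  simp only [this]

namespace IsTower

variable (hT : T.IsTower)
include hT

theorem preim_eq {A : Set (ℝ × ℕ)} (hA : A ⊆ T.Del) :
    T.preim A = rising A ∪ T.returning (slice A 0) := by
  ext ⟨z, l⟩
  simp only [preim, rising, returning, mem_ofPred_eq, mem_union, mem_iUnion, mem_prod, slice,
    mem_singleton_iff, mem_inter_iff, mem_preimage]
  constructor
  · rintro ⟨hz, hF⟩
    rcases F_eq_or hz with ⟨-, h1⟩ | ⟨hR, h1⟩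
    · exact Or.inl ⟨l, by rwa [h1] at hF, rfl⟩
    · obtain ⟨p, hp, rfl⟩ := hT.exists_branch hz hR
      exact Or.inr ⟨p, ⟨hp, by rwa [h1] at hF⟩, rfl⟩
  · rintro (⟨l, hl, rfl⟩ | ⟨p, ⟨hp, hG⟩, rfl⟩)
    · exact ⟨Del_pred (hA hl), by rwa [F_of_Del_succ (hA hl)]⟩
    · exact ⟨branch_Del p hp, by rwa [branch_F p hp]⟩

omit hT in
theorem disjoint_rising_returning {A : Set (ℝ × ℕ)} (hA : A ⊆ T.Del) (S : Set ℝ) :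
    Disjoint (rising A) (T.returning S) := by
  refine disjoint_left.2 ?_
  rintro ⟨z, l⟩ h1 h2
  simp only [rising, returning, mem_iUnion, mem_prod, slice, mem_ofPred_eq,
    mem_singleton_iff, mem_inter_iff] at h1 h2
  obtain ⟨l, hl, rfl⟩ := h1
  obtain ⟨p, ⟨hp, -⟩, rfl⟩ := h2
  have := R_of_Del_succ (hA hl)
  have := branch_R p hp
  omega

theorem measurableSet_branch (p : T.Branch) {S : Set ℝ} (hS : MeasurableSet S) :
    MeasurableSet (p.dom ∩ T.G ⁻¹' S) := by
  have ho := hT.Z_open (branch_Z p)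
  have hm : Measurable (p.dom.domRestrict T.G) :=
    (continuousOn_iff_continuous_domRestrict.1 (hT.branch_return p).1).measurable
  have := (MeasurableEmbedding.subtype_coe ho.measurableSet).measurableSet_image.2 (hm hS)
  convert this using 1
  ext z
  simp [domRestrict, and_comm]

theorem measurableSet_returning {S : Set ℝ} (hS : MeasurableSet S) :
    MeasurableSet (T.returning S) := by
  have := hT.countable_branch
  exact MeasurableSet.iUnion fun p =>
    (hT.measurableSet_branch p hS).prod (measurableSet_singleton _)

theorem measurableSet_preim {A : Set (ℝ × ℕ)} (hA : MeasurableSet A) (hAD : A ⊆ T.Del) :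
    MeasurableSet (T.preim A) := by
  rw [hT.preim_eq hAD]
  exact (measurableSet_rising hA).union (hT.measurableSet_returning (measurableSet_slice hA 0))

theorem setLIntegral_returning {S : Set ℝ} (hS : MeasurableSet S) (f : ℝ × ℕ → ℝ≥0∞) :
    ∫⁻ x in T.returning S, f x ∂leb = ∑' p : T.Branch, ∫⁻ z in p.dom ∩ T.G ⁻¹' S, f (z, p.lev) := by
  have := hT.countable_branch
  rw [returning, lintegral_iUnion]
  · simp only [setLIntegral_prod_singleton]
  · exact fun p => (hT.measurableSet_branch p hS).prod (measurableSet_singleton _)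
  · intro p q hpq
    refine disjoint_left.2 ?_
    rintro ⟨z, m⟩ ⟨h1, -⟩ ⟨h2, -⟩
    exact hpq (hT.branch_eq h1.1 h2.1)

theorem setLIntegral_preim {A : Set (ℝ × ℕ)} (hA : MeasurableSet A) (hAD : A ⊆ T.Del)
    (f : ℝ × ℕ → ℝ≥0∞) :
    ∫⁻ x in T.preim A, f x ∂leb = (∑' l, ∫⁻ z in slice A (l + 1), f (z, l)) +
      ∑' p : T.Branch, ∫⁻ z in p.dom ∩ T.G ⁻¹' slice A 0, f (z, p.lev) := by
  have hS := measurableSet_slice hA 0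
  rw [hT.preim_eq hAD, lintegral_union (hT.measurableSet_returning hS)
    (disjoint_rising_returning hAD _), setLIntegral_rising hA, hT.setLIntegral_returning hS]

end IsTower

namespace IsExpanding

variable {α γ β C ξ : ℝ} (h : T.IsExpanding α γ β C ξ)
include h

theorem continuousOn_inv (p : T.Branch) : ContinuousOn p.inv (T.G '' p.dom) := by
  have hg : 0 < γ * Real.exp (β * p.lev) :=
    mul_pos (by linarith [h.one_lt_gamma]) (Real.exp_pos _)
  refine (LipschitzOnWith.of_dist_le_mul (K := Real.toNNReal (γ * Real.exp (β * p.lev))⁻¹)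
    fun x hx y hy => ?_).continuousOn
  have := h.expand p (IsTower.inv_mem p hx) (IsTower.inv_mem p hy)
  rw [IsTower.G_inv p hx, IsTower.G_inv p hy] at this
  rw [Real.dist_eq, Real.dist_eq, Real.coe_toNNReal _ (by positivity), inv_mul_eq_div,
    le_div_iff₀ hg]
  linarith

theorem measurable_brTerm {f : ℝ × ℕ → ℝ} (hf : ContinuousOn f T.Del) (p : T.Branch) :
    Measurable (brTerm f p) := by
  classical
  obtain ⟨y, hy⟩ := h.tower.Z_nonempty (IsTower.branch_Z p)
  obtain ⟨-, -, i, -, hi⟩ := h.tower.branch_return p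
  have hs : MeasurableSet (T.G '' p.dom) := hi ▸ measurableSet_Ioo
  have h1 : Measurable ((T.G '' p.dom).piecewise p.inv fun _ => y) :=
    (h.continuousOn_inv p).measurable_piecewise continuousOn_const hs
  have h2 : Measurable (p.dom.piecewise (fun z => f (z, p.lev)) fun _ => 0) := by
    refine ContinuousOn.measurable_piecewise ?_ continuousOn_const (h.dom_measurable p)
    exact hf.comp (by fun_prop) fun z hz => IsTower.branch_Del p hz
  have h3 : brTerm f p = (T.G '' p.dom).indicator (fun x =>
      p.dom.piecewise (fun z => f (z, p.lev)) (fun _ => 0)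
        ((T.G '' p.dom).piecewise p.inv (fun _ => y) x) /
      |deriv T.G ((T.G '' p.dom).piecewise p.inv (fun _ => y) x)|) := by
    ext x
    by_cases hx : x ∈ T.G '' p.dom
    · rw [brTerm, indicator_of_mem hx, indicator_of_mem hx, piecewise_eq_of_mem _ _ _ hx,
        piecewise_eq_of_mem _ _ _ (IsTower.inv_mem p hx)]
    · rw [brTerm, indicator_of_notMem hx, indicator_of_notMem hx]
  rw [h3]
  have h4 : Measurable fun z => |deriv T.G z| := (measurable_deriv T.G).abs
  exact ((h2.comp h1).div (h4.comp h1)).indicator hs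

theorem ofReal_transfer_zero {M : ℝ} {f : ℝ × ℕ → ℝ} (hf : T.NonnegBdd ξ M f) (x : ℝ) :
    ENNReal.ofReal (T.transfer f (x, 0)) = ∑' p : T.Branch, ENNReal.ofReal (brTerm f p x) := by
  rw [h.tower.transfer_zero, ENNReal.ofReal_tsum_of_nonneg (fun p => brTerm_nonneg hf p x)
    (h.summable_brTerm hf x)]

/-- The transfer operator is dual to the open map. -/
theorem setLIntegral_transfer {M : ℝ} {f : ℝ × ℕ → ℝ} (hf : T.NonnegBdd ξ M f)
    (hfc : ContinuousOn f T.Del) {A : Set (ℝ × ℕ)} (hA : MeasurableSet A) (hAD : A ⊆ T.Del) :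
    ∫⁻ x in A, ENNReal.ofReal (T.transfer f x) ∂leb =
      ∫⁻ x in T.preim A, ENNReal.ofReal (f x) ∂leb := by
  have := h.tower.countable_branch
  rw [setLIntegral_slices hA, tsum_eq_zero_add' ENNReal.summable, h.tower.setLIntegral_preim hA hAD,
    add_comm]
  congr 1
  · refine tsum_congr fun l => setLIntegral_congr_fun (measurableSet_slice hA _) fun z hz => ?_
    simp only [IsTower.transfer_succ f (hAD hz)]
  · simp only [h.ofReal_transfer_zero hf]
    rw [lintegral_tsum fun p => (h.measurable_brTerm hfc p).ennreal_ofReal.aemeasurable]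
    refine tsum_congr fun p => ?_
    obtain ⟨-, -, i, -, hi⟩ := h.tower.branch_return p
    have hs : MeasurableSet (T.G '' p.dom) := hi ▸ measurableSet_Ioo
    have h1 : ∀ x, ENNReal.ofReal (brTerm f p x) = (T.G '' p.dom).indicator
        (fun x => ENNReal.ofReal (f (p.inv x, p.lev) / |deriv T.G (p.inv x)|)) x := by
      intro x
      by_cases hx : x ∈ T.G '' p.dom
      · rw [brTerm, indicator_of_mem hx, indicator_of_mem hx]
      · rw [brTerm, indicator_of_notMem hx, indicator_of_notMem hx, ENNReal.ofReal_zero]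
    have h2 : T.G '' p.dom ∩ slice A 0 = T.G '' (p.dom ∩ T.G ⁻¹' slice A 0) :=
      (image_inter_preimage _ _ _).symm
    have hm := h.tower.measurableSet_branch p (measurableSet_slice hA 0)
    simp only [h1]
    rw [setLIntegral_indicator hs, h2, h.lintegral_image p hm inter_subset_left]
    refine setLIntegral_congr_fun hm fun z hz => ?_
    simp only [h.tower.inv_G p hz.1]
    rw [← ENNReal.ofReal_mul (abs_nonneg _), mul_div_cancel₀ _ (h.deriv_pos p hz.1).ne']

/-- The supremum of the transferred function over the base is controlled by the integral of the
function over the returning part of the tower. -/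
theorem transfer_base_le {M K : ℝ} (hK : 0 ≤ K) {f : ℝ × ℕ → ℝ} (hf : T.NonnegBdd ξ M f)
    (hfK : T.HolderRel α ξ f (fun x => K * f x)) (x : ℝ) :
    ENNReal.ofReal (T.transfer f (x, 0)) ≤ ENNReal.ofReal (consB C + consA C γ α ξ * K) *
      ∫⁻ y in T.returning univ, ENNReal.ofReal (f y) ∂leb := by
  rw [h.ofReal_transfer_zero hf, h.tower.setLIntegral_returning MeasurableSet.univ,
    ← ENNReal.tsum_mul_left]
  refine ENNReal.tsum_le_tsum fun p => ?_
  rw [preimage_univ, inter_univ]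
  by_cases hx : x ∈ T.G '' p.dom
  swap
  · simp [brTerm, hx]
  have hC := h.C_pos
  have hgam := h.gamma_rpow_pos
  have hy := IsTower.inv_mem p hx
  rw [brTerm, indicator_of_mem hx]
  set y := p.inv x
  have hDel : ∀ z ∈ p.dom, (z, p.lev) ∈ T.Del := fun z hz => IsTower.branch_Del p hz
  have hfy := (hf _ (hDel y hy)).1
  have h1 : ∀ w ∈ p.dom, f (y, p.lev) ≤ (1 + K / γ ^ α) * f (w, p.lev) := by
    intro w hw
    have h2 := hfK p.lev p.dom (IsTower.branch_Z p) hDel w hw y hy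
    have h3 := h.weight_contract p hw hy
    have h4 : |T.G w - T.G y| ^ α ≤ 1 :=
      Real.rpow_le_one (abs_nonneg _) (h.dist_image_le_one p hw hy) h.alpha_pos.le
    have h5 : Real.exp (ξ * p.lev) * |w - y| ^ α ≤ 1 / γ ^ α :=
      h3.trans (by gcongr)
    have hfw := (hf _ (hDel w hw)).1
    have h6 := mul_le_mul_of_nonneg_right h5 (mul_nonneg hK hfw)
    have h7 := (abs_le.1 h2).1
    have h8 : 1 / γ ^ α * (K * f (w, p.lev)) = K / γ ^ α * f (w, p.lev) := by ring
    linarith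
  have h2 : f (y, p.lev) / |deriv T.G y| ≤ (1 + C) * (f (y, p.lev) * (volume p.dom).toReal) := by
    calc _ = f (y, p.lev) * (1 / |deriv T.G y|) := by ring
      _ ≤ f (y, p.lev) * ((1 + C) * (volume p.dom).toReal) :=
        mul_le_mul_of_nonneg_left (h.inv_abs_deriv_le p hy) hfy
      _ = _ := by ring
  have h3 : ENNReal.ofReal (f (y, p.lev)) * volume p.dom ≤
      ENNReal.ofReal (1 + K / γ ^ α) * ∫⁻ w in p.dom, ENNReal.ofReal (f (w, p.lev)) := by
    rw [← setLIntegral_const, ← lintegral_const_mul' _ _ ENNReal.ofReal_ne_top]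
    refine setLIntegral_mono' (h.dom_measurable p) fun w hw => ?_
    rw [← ENNReal.ofReal_mul (by positivity)]
    exact ENNReal.ofReal_le_ofReal (h1 w hw)
  calc ENNReal.ofReal (f (y, p.lev) / |deriv T.G y|)
      ≤ ENNReal.ofReal ((1 + C) * (f (y, p.lev) * (volume p.dom).toReal)) :=
        ENNReal.ofReal_le_ofReal h2
    _ = ENNReal.ofReal (1 + C) * (ENNReal.ofReal (f (y, p.lev)) * volume p.dom) := by
        rw [ENNReal.ofReal_mul (by positivity), ENNReal.ofReal_mul hfy,
          ENNReal.ofReal_toReal (h.volume_dom_lt_top p).ne]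
    _ ≤ ENNReal.ofReal (1 + C) * (ENNReal.ofReal (1 + K / γ ^ α) *
          ∫⁻ w in p.dom, ENNReal.ofReal (f (w, p.lev))) := mul_le_mul_right h3 _
    _ ≤ _ := by
        rw [← mul_assoc, ← ENNReal.ofReal_mul (by positivity)]
        refine mul_le_mul_left (ENNReal.ofReal_le_ofReal ?_) _
        have : (1 + C) / γ ^ α ≤ consA C γ α ξ := le_max_right _ _
        have h9 := mul_le_mul_of_nonneg_right this hK
        rw [consB]
        calc (1 + C) * (1 + K / γ ^ α) = (1 + C) + (1 + C) / γ ^ α * K := by ring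
          _ ≤ _ := by linarith

/-- The part of a branch that is mapped into `S` has measure at most a multiple of that of `S`, by
bounded distortion. -/
theorem volume_branch_preimage_le (p : T.Branch) {S : Set ℝ} (hS : MeasurableSet S) :
    volume (p.dom ∩ T.G ⁻¹' S) ≤
      ENNReal.ofReal (1 + C) * volume p.dom * volume (S ∩ Icc 0 T.N) := by
  obtain ⟨-, -, i, hiN, hi⟩ := h.tower.branch_return p
  have hC := h.C_pos
  have hm := h.tower.measurableSet_branch p hS
  have h1 := h.lintegral_image p hm inter_subset_left (fun _ => 1)
  simp only [lintegral_const, mul_one, one_mul, Measure.restrict_apply_univ] at h1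
  have h2 : volume (p.dom ∩ T.G ⁻¹' S) ≤ ENNReal.ofReal (1 + C) * volume p.dom *
      volume (T.G '' (p.dom ∩ T.G ⁻¹' S)) := by
    have hne : ENNReal.ofReal (1 + C) * volume p.dom ≠ ∞ :=
      ENNReal.mul_ne_top ENNReal.ofReal_ne_top (h.volume_dom_lt_top p).ne
    rw [h1, ← lintegral_const_mul' _ _ hne, ← setLIntegral_one]
    refine setLIntegral_mono' hm fun z hz => ?_
    rw [← ENNReal.ofReal_toReal (h.volume_dom_lt_top p).ne, ← ENNReal.ofReal_mul (by positivity),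
      ← ENNReal.ofReal_mul (by positivity), ← ENNReal.ofReal_one]
    refine ENNReal.ofReal_le_ofReal ((h.inv_deriv_le p hz.1).trans (le_of_eq ?_))
    ring
  refine h2.trans (mul_le_mul_right (measure_mono ?_) _)
  rintro _ ⟨z, ⟨hz, hzS⟩, rfl⟩
  have hb : T.G z ∈ baseInt i := hi ▸ ⟨z, hz, rfl⟩
  have : (i : ℝ) + 1 ≤ T.N := by exact_mod_cast hiN
  have : (0 : ℝ) ≤ i := Nat.cast_nonneg i
  exact ⟨hzS, by linarith [hb.1], by linarith [hb.2]⟩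

theorem volume_compl_level_zero_le :
    volume ((slice T.Del 0)ᶜ ∩ Icc 0 T.N) ≤ volume (T.holeAt 0) := by
  have : (slice T.Del 0)ᶜ ∩ Icc (0 : ℝ) T.N ⊆ T.holeAt 0 ∪ (Icc (0 : ℝ) T.N \ T.cells) := by
    rintro z ⟨hz, hzN⟩
    by_cases hc : z ∈ T.cells
    · refine Or.inl ?_
      by_contra hh
      exact hz ⟨⟨hc, h.tower.R_pos z hc, fun k hk => absurd hk (by simp)⟩, hh⟩
    · exact Or.inr ⟨hzN, hc⟩
  refine (measure_mono this).trans ((measure_union_le _ _).trans ?_)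
  rw [h.tower.Z_cover, add_zero]

/-- The mass that falls into the hole of the base. -/
theorem lost_base_le {M : ℝ} {f : ℝ × ℕ → ℝ} (hf : T.NonnegBdd ξ M f) :
    ∫⁻ x in T.returning (slice T.Del 0)ᶜ, ENNReal.ofReal (f x) ∂leb ≤
      ENNReal.ofReal M * (T.consD C ξ * volume (T.holeAt 0)) := by
  have hS : MeasurableSet (slice T.Del 0)ᶜ := (measurableSet_slice h.tower.Del_measurable 0).compl
  rw [h.tower.setLIntegral_returning hS]
  calc _ ≤ ∑' p : T.Branch, ENNReal.ofReal M * (ENNReal.ofReal (1 + C) * p.wt ξ *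
          volume (T.holeAt 0)) := by
        refine ENNReal.tsum_le_tsum fun p => ?_
        calc _ ≤ ∫⁻ z in p.dom ∩ T.G ⁻¹' (slice T.Del 0)ᶜ,
                ENNReal.ofReal M * ENNReal.ofReal (Real.exp (ξ * p.lev)) := by
              refine setLIntegral_mono' (h.tower.measurableSet_branch p hS) fun z hz => ?_
              rw [← ENNReal.ofReal_mul' (Real.exp_pos _).le]
              exact ENNReal.ofReal_le_ofReal (hf _ (IsTower.branch_Del p hz.1)).2
          _ = ENNReal.ofReal M * ENNReal.ofReal (Real.exp (ξ * p.lev)) *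
                volume (p.dom ∩ T.G ⁻¹' (slice T.Del 0)ᶜ) := by rw [setLIntegral_const]
          _ ≤ ENNReal.ofReal M * ENNReal.ofReal (Real.exp (ξ * p.lev)) *
                (ENNReal.ofReal (1 + C) * volume p.dom * volume (T.holeAt 0)) :=
              mul_le_mul_right ((h.volume_branch_preimage_le p hS).trans
                (mul_le_mul_right h.volume_compl_level_zero_le _)) _
          _ = _ := by rw [Branch.wt]; ring
    _ = ENNReal.ofReal M * (ENNReal.ofReal (1 + C) * (∑' p : T.Branch, p.wt ξ) *
          volume (T.holeAt 0)) := by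
        rw [ENNReal.tsum_mul_left, ENNReal.tsum_mul_right, ENNReal.tsum_mul_left]
    _ ≤ _ := mul_le_mul_right (mul_le_mul_left h.tsum_wt_le_consD _) _

/-- The points that fall into the hole of a level other than the base. -/
def fallingUp (T : TowerData) : Set (ℝ × ℕ) :=
  ⋃ l : ℕ, (T.holeAt (l + 1) ∩ slice T.Del l) ×ˢ ({l} : Set ℕ)

omit h in
theorem measurableSet_holeAt (hT : T.IsTower) (l : ℕ) : MeasurableSet (T.holeAt l) := by
  refine (isOpen_sUnion fun I hI => ?_).measurableSet
  obtain ⟨⟨a, b, -, rfl⟩, -⟩ := hT.hole_cell l I hI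
  exact isOpen_Ioo

theorem lost_up_le {M : ℝ} {f : ℝ × ℕ → ℝ} (hf : T.NonnegBdd ξ M f) :
    ∫⁻ x in fallingUp T, ENNReal.ofReal (f x) ∂leb ≤ ENNReal.ofReal M * T.upperHole ξ := by
  refine (lintegral_iUnion_le _ _).trans ?_
  rw [upperHole, ← ENNReal.tsum_mul_left]
  refine ENNReal.tsum_le_tsum fun l => ?_
  rw [setLIntegral_prod_singleton]
  have hm : MeasurableSet (T.holeAt (l + 1) ∩ slice T.Del l) :=
    (measurableSet_holeAt h.tower _).inter (measurableSet_slice h.tower.Del_measurable l)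
  calc _ ≤ ∫⁻ z in T.holeAt (l + 1) ∩ slice T.Del l,
          ENNReal.ofReal M * ENNReal.ofReal (Real.exp (ξ * l)) := by
        refine setLIntegral_mono' hm fun z hz => ?_
        rw [← ENNReal.ofReal_mul' (Real.exp_pos _).le]
        exact ENNReal.ofReal_le_ofReal (hf (z, l) hz.2).2
    _ ≤ _ := by
        rw [setLIntegral_const, mul_assoc]
        exact mul_le_mul_right (mul_le_mul_right (measure_mono inter_subset_left) _) _

theorem Del_subset : T.Del ⊆ T.preim T.Del ∪ (fallingUp T ∪ T.returning (slice T.Del 0)ᶜ) := by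
  rintro ⟨z, l⟩ hz
  by_cases hF : T.F (z, l) ∈ T.Del
  · exact Or.inl ⟨hz, hF⟩
  refine Or.inr ?_
  rcases IsTower.F_eq_or hz with ⟨hR, h1⟩ | ⟨hR, h1⟩
  · refine Or.inl (mem_iUnion.2 ⟨l, ⟨?_, hz⟩, rfl⟩)
    by_contra hh
    rw [h1] at hF
    refine hF ⟨⟨hz.1.1, hR, fun k hk => ?_⟩, hh⟩
    rcases Nat.lt_succ_iff_lt_or_eq.1 hk with hk | rfl
    · exact hz.1.2.2 k hk
    · exact hz.2
  · obtain ⟨p, hp, rfl⟩ := h.tower.exists_branch hz hR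
    rw [h1] at hF
    exact Or.inr (mem_iUnion.2 ⟨p, ⟨hp, hF⟩, rfl⟩)

omit h in
theorem returning_subset :
    T.returning univ ⊆ T.preim T.Del ∪ T.returning (slice T.Del 0)ᶜ := by
  rintro ⟨z, l⟩ hz
  obtain ⟨p, ⟨hp, -⟩, rfl⟩ := mem_iUnion.1 hz
  by_cases hG : (T.G z, 0) ∈ T.Del
  · exact Or.inl ⟨IsTower.branch_Del p hp, by rwa [IsTower.branch_F p hp]⟩
  · exact Or.inr (mem_iUnion.2 ⟨p, ⟨hp, hG⟩, rfl⟩)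

end IsExpanding

end TowerData

/-! ### Approximate eigenvectors of positive maps on a cone -/

section Cone

variable {V : Type*} [AddCommGroup V] [Module ℝ V]

/-- `P` maps the convex cone `K` to itself, is additive and homogeneous on it, and changes the
additive functional `I`, the total mass, by a factor between `a > 0` and `1`. -/
structure IsPositiveMap (K : Set V) (I : V → ℝ) (P : V → V) (a : ℝ) : Prop where
  a_pos : 0 < a
  add_mem : ∀ f ∈ K, ∀ g ∈ K, f + g ∈ K
  smul_mem : ∀ c : ℝ, 0 ≤ c → ∀ f ∈ K, c • f ∈ K
  map_mem : ∀ f ∈ K, P f ∈ K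
  map_add : ∀ f ∈ K, ∀ g ∈ K, P (f + g) = P f + P g
  map_smul : ∀ c : ℝ, 0 ≤ c → ∀ f ∈ K, P (c • f) = c • P f
  I_add : ∀ f ∈ K, ∀ g ∈ K, I (f + g) = I f + I g
  I_smul : ∀ c : ℝ, 0 ≤ c → ∀ f ∈ K, I (c • f) = c * I f
  I_nonneg : ∀ f ∈ K, 0 ≤ I f
  le_I_map : ∀ f ∈ K, a * I f ≤ I (P f)
  I_map_le : ∀ f ∈ K, I (P f) ≤ I f

namespace IsPositiveMap

variable {K : Set V} {I : V → ℝ} {P : V → V} {a : ℝ} (h : IsPositiveMap K I P a)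
include h

theorem iterate_mem {f : V} (hf : f ∈ K) (n : ℕ) : P^[n] f ∈ K := by
  induction n with
  | zero => exact hf
  | succ n ih => rw [Function.iterate_succ_apply']; exact h.map_mem _ ih

theorem I_iterate_le {f : V} (hf : f ∈ K) (n : ℕ) : I (P^[n] f) ≤ I f := by
  induction n with
  | zero => exact le_rfl
  | succ n ih =>
    rw [Function.iterate_succ_apply']
    exact (h.I_map_le _ (h.iterate_mem hf n)).trans ih

theorem le_I_iterate {f : V} (hf : f ∈ K) (n : ℕ) : a ^ n * I f ≤ I (P^[n] f) := by
  induction n with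
  | zero => simp
  | succ n ih =>
    rw [Function.iterate_succ_apply', pow_succ']
    refine le_trans ?_ (h.le_I_map _ (h.iterate_mem hf n))
    rw [mul_assoc]
    exact mul_le_mul_of_nonneg_left ih h.a_pos.le

/-- The partial sums of the Neumann series. -/
theorem neumann {f : V} (hf : f ∈ K) {x : ℝ} (hx : 0 ≤ x) (m : ℕ) :
    (∑ n ∈ Finset.range m, x ^ n • P^[n] f) ∈ K ∧
    I (∑ n ∈ Finset.range m, x ^ n • P^[n] f) =
      ∑ n ∈ Finset.range m, x ^ n * I (P^[n] f) ∧
    x • P (∑ n ∈ Finset.range m, x ^ n • P^[n] f) + f =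
      (∑ n ∈ Finset.range m, x ^ n • P^[n] f) + x ^ m • P^[m] f := by
  induction m with
  | zero =>
    have h0 : (0 : V) ∈ K := by simpa using h.smul_mem 0 le_rfl f hf
    have h1 : I (0 : V) = 0 := by simpa using h.I_smul 0 le_rfl f hf
    have h2 : P (0 : V) = 0 := by simpa using h.map_smul 0 le_rfl f hf
    simp [h0, h1, h2]
  | succ m ih =>
    obtain ⟨i1, i2, i3⟩ := ih
    have hm := h.iterate_mem hf m
    have hxm : 0 ≤ x ^ m := pow_nonneg hx m
    have hm' := h.smul_mem _ hxm _ hm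
    rw [Finset.sum_range_succ, Finset.sum_range_succ]
    refine ⟨h.add_mem _ i1 _ hm', ?_, ?_⟩
    · rw [h.I_add _ i1 _ hm', i2, h.I_smul _ hxm _ hm]
    · rw [h.map_add _ i1 _ hm', h.map_smul _ hxm _ hm, Function.iterate_succ_apply', pow_succ',
        mul_smul, smul_add, add_right_comm, i3]

/-- If the Neumann series are bounded by `Q`, their terms decay geometrically at a rate which
depends on `Q` only: each tail is at most `Q` times its first term. -/
theorem term_le {x Q : ℝ} (hx : 0 < x) (hQ : 1 ≤ Q)
    (hb : ∀ f ∈ K, ∀ m, ∑ n ∈ Finset.range m, x ^ n * I (P^[n] f) ≤ Q * I f)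
    {f : V} (hf : f ∈ K) (k : ℕ) :
    x ^ k * I (P^[k] f) ≤ (1 - 1 / Q) ^ k * (Q * I f) := by
  have hQ0 : 0 < Q := by linarith
  have key : ∀ k m, ∑ n ∈ Finset.range m, x ^ (k + n) * I (P^[k + n] f) ≤
      (1 - 1 / Q) ^ k * (Q * I f) := by
    intro k
    induction k with
    | zero => intro m; simpa using hb f hf m
    | succ k ih =>
      intro m
      have h1 := ih (m + 1)
      have h2 := hb _ (h.iterate_mem hf k) (m + 1)
      have h3 : ∑ n ∈ Finset.range (m + 1), x ^ (k + n) * I (P^[k + n] f) ≤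
          Q * (x ^ k * I (P^[k] f)) := by
        have h4 := mul_le_mul_of_nonneg_left h2 (pow_nonneg hx.le k)
        rw [Finset.mul_sum] at h4
        calc _ = ∑ n ∈ Finset.range (m + 1), x ^ k * (x ^ n * I (P^[n] (P^[k] f))) := by
              refine Finset.sum_congr rfl fun n _ => ?_
              rw [pow_add, mul_assoc, ← Function.iterate_add_apply, add_comm k n]
          _ ≤ _ := h4
          _ = _ := by ring
      rw [Finset.sum_range_succ'] at h1 h3
      have h5 : ∑ n ∈ Finset.range m, x ^ (k + 1 + n) * I (P^[k + 1 + n] f) =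
          ∑ n ∈ Finset.range m, x ^ (k + (n + 1)) * I (P^[k + (n + 1)] f) :=
        Finset.sum_congr rfl fun n _ => by rw [show k + 1 + n = k + (n + 1) by ring]
      rw [h5, pow_succ]
      set S := ∑ n ∈ Finset.range m, x ^ (k + (n + 1)) * I (P^[k + (n + 1)] f)
      rw [add_zero] at h1 h3
      set t := x ^ k * I (P^[k] f)
      -- the tail satisfies `S + t ≤ Q t`, so that `S ≤ (1 - 1 / Q) (S + t)`
      have h6 : S ≤ (1 - 1 / Q) * (S + t) := by
        have : (1 / Q) * (S + t) ≤ t := by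
          rw [one_div, inv_mul_le_iff₀ hQ0]; exact h3
        linarith
      have h7 : 0 ≤ 1 - 1 / Q := by
        rw [sub_nonneg, div_le_one hQ0]; exact hQ
      calc S ≤ (1 - 1 / Q) * (S + t) := h6
        _ ≤ (1 - 1 / Q) * ((1 - 1 / Q) ^ k * (Q * I f)) := mul_le_mul_of_nonneg_left h1 h7
        _ = _ := by ring
  simpa using key k 1

/-- A positive map has approximate eigenvectors in the cone, for approximations of some eigenvalue
`r > 0`.  They are partial sums of Neumann series at points where these are large; such points
exist near the radius of convergence, since a uniform bound there would let the series converge on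
a larger disc. -/
theorem exists_approx_eigenvector (hne : ∃ f ∈ K, 0 < I f) :
    ∃ r : ℝ, 0 < r ∧ ∀ ε > 0, ∃ lam : ℝ, |lam - r| < ε ∧ ∃ u ∈ K, I u = 1 ∧
      ∃ f ∈ K, ∃ g ∈ K, I f ≤ ε ∧ I g ≤ ε ∧ P u + f = lam • u + g := by
  set L : Set ℝ := {x | 0 < x ∧ ∃ Q : ℝ, ∀ f ∈ K, ∀ m,
    ∑ n ∈ Finset.range m, x ^ n * I (P^[n] f) ≤ Q * I f} with hL
  obtain ⟨f₀, hf₀, hI₀⟩ := hne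
  have ha := h.a_pos
  have hhalf : (1 / 2 : ℝ) ∈ L := by
    refine ⟨by norm_num, 2, fun f hf m => ?_⟩
    calc _ ≤ ∑ n ∈ Finset.range m, (1 / 2 : ℝ) ^ n * I f := Finset.sum_le_sum fun n _ =>
          mul_le_mul_of_nonneg_left (h.I_iterate_le hf n) (by positivity)
      _ ≤ _ := by
        rw [← Finset.sum_mul]
        exact mul_le_mul_of_nonneg_right (sum_geometric_two_le m) (h.I_nonneg f hf)
  have hbdd : BddAbove L := by
    refine ⟨1 / a, ?_⟩
    rintro x ⟨hx, Q, hQ⟩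
    by_contra hxa
    push Not at hxa
    have h1 : 1 ≤ x * a := by
      rw [div_lt_iff₀ ha] at hxa; exact hxa.le
    obtain ⟨m, hm⟩ := exists_nat_gt Q
    have h2 := hQ f₀ hf₀ m
    have h3 : (m : ℝ) * I f₀ ≤ ∑ n ∈ Finset.range m, x ^ n * I (P^[n] f₀) := by
      have : ∀ n ∈ Finset.range m, I f₀ ≤ x ^ n * I (P^[n] f₀) := by
        intro n _
        calc I f₀ ≤ (x * a) ^ n * I f₀ := le_mul_of_one_le_left hI₀.le (one_le_pow₀ h1)
          _ = x ^ n * (a ^ n * I f₀) := by rw [mul_pow]; ring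
          _ ≤ _ := mul_le_mul_of_nonneg_left (h.le_I_iterate hf₀ n) (by positivity)
      simpa using Finset.card_nsmul_le_sum _ _ _ this
    nlinarith
  have hdown : ∀ x ∈ L, ∀ y, 0 < y → y ≤ x → y ∈ L := by
    rintro x ⟨hx, Q, hQ⟩ y hy hyx
    refine ⟨hy, Q, fun f hf m => (Finset.sum_le_sum fun n _ => ?_).trans (hQ f hf m)⟩
    exact mul_le_mul_of_nonneg_right (pow_le_pow_left₀ hy.le hyx n)
      (h.I_nonneg _ (h.iterate_mem hf n))
  set ρ := sSup L with hρ
  have hρ0 : 0 < ρ := lt_of_lt_of_le (by norm_num) (le_csSup hbdd hhalf)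
  have hlt : ∀ x, 0 < x → x < ρ → x ∈ L := by
    intro x hx hxρ
    obtain ⟨y, hy, hxy⟩ := exists_lt_of_lt_csSup ⟨_, hhalf⟩ hxρ
    exact hdown y hy x hx hxy.le
  have hlarge : ∀ k : ℝ, ∀ y < ρ, ∃ x, y < x ∧ 0 < x ∧ x < ρ ∧ ∃ f ∈ K, ∃ m,
      k * I f < ∑ n ∈ Finset.range m, x ^ n * I (P^[n] f) := by
    intro k y hy
    by_contra hcon
    push Not at hcon
    set Q := max k 2
    have hQ2 : 2 ≤ Q := le_max_right _ _
    set q := 1 - 1 / Q with hq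
    have hQ0 : 0 < Q := by linarith
    have hq0 : 0 < q := by
      have : 1 / Q ≤ 1 / 2 := one_div_le_one_div_of_le (by norm_num) hQ2
      linarith
    have hq1 : q < 1 := by
      have : 0 < 1 / Q := by positivity
      linarith
    -- a bound `Q` at `x > q ρ` extends the convergence up to `x / q > ρ`
    obtain ⟨x, hx1, hx2⟩ : ∃ x, max y (q * ρ) < x ∧ x < ρ :=
      exists_between (max_lt hy (by nlinarith))
    have hyx := lt_of_le_of_lt (le_max_left _ _) hx1
    have hqx := lt_of_le_of_lt (le_max_right _ _) hx1
    have hx0 : 0 < x := lt_trans (by positivity) hqx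
    have hb : ∀ f ∈ K, ∀ m, ∑ n ∈ Finset.range m, x ^ n * I (P^[n] f) ≤ Q * I f :=
      fun f hf m => (hcon x hyx hx0 hx2 f hf m).trans
        (mul_le_mul_of_nonneg_right (le_max_left _ _) (h.I_nonneg f hf))
    have hρq : ρ < x / q := by rw [lt_div_iff₀ hq0]; linarith
    obtain ⟨w, hw1, hw2⟩ := exists_between hρq
    have hw0 : 0 < w := hρ0.trans hw1
    have hs : w * q / x < 1 := by
      rw [div_lt_one hx0]; rwa [lt_div_iff₀ hq0] at hw2
    have hs0 : 0 ≤ w * q / x := by positivity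
    have hwL : w ∈ L := by
      refine ⟨hw0, (1 - w * q / x)⁻¹ * Q, fun f hf m => ?_⟩
      calc _ ≤ ∑ n ∈ Finset.range m, (w * q / x) ^ n * (Q * I f) := by
            refine Finset.sum_le_sum fun n _ => ?_
            have h1 := h.term_le hx0 (by linarith) hb hf n
            have h2 : I (P^[n] f) ≤ q ^ n * (Q * I f) / x ^ n := by
              rw [le_div_iff₀ (by positivity)]; linarith
            calc _ ≤ w ^ n * (q ^ n * (Q * I f) / x ^ n) :=
                  mul_le_mul_of_nonneg_left h2 (by positivity)
              _ = _ := by rw [div_pow, mul_pow]; ring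
        _ ≤ _ := by
            rw [← Finset.sum_mul, mul_assoc]
            refine mul_le_mul_of_nonneg_right ?_ (mul_nonneg hQ0.le (h.I_nonneg f hf))
            rw [← tsum_geometric_of_lt_one hs0 hs]
            exact (summable_geometric_of_lt_one hs0 hs).sum_le_tsum _ fun n _ => by positivity
    exact absurd (le_csSup hbdd hwL) (not_le.2 hw1)
  refine ⟨ρ⁻¹, inv_pos.2 hρ0, fun ε hε => ?_⟩
  -- for `x` close to `ρ`, the eigenvalue `1 / x` is close to `1 / ρ`
  have hcont : ∀ᶠ x in 𝓝 ρ, |x⁻¹ - ρ⁻¹| < ε := by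
    have := (tendsto_inv₀ hρ0.ne').eventually (Metric.ball_mem_nhds ρ⁻¹ hε)
    simpa [Metric.mem_ball, Real.dist_eq] using this
  obtain ⟨δ, hδ, hδε⟩ := Metric.eventually_nhds_iff.1 hcont
  set k := 2 / (ρ * ε) with hk
  have hk0 : 0 < k := by positivity
  obtain ⟨x, hx1, hx0, hxρ, f, hf, m₀, hm₀⟩ := hlarge k (max (ρ - δ) (ρ / 2))
    (max_lt (by linarith) (by linarith))
  have hxδ := lt_of_le_of_lt (le_max_left _ _) hx1
  have hxh := lt_of_le_of_lt (le_max_right _ _) hx1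
  obtain ⟨-, Q, hQ⟩ := hlt x hx0 hxρ
  have hterm : ∀ n, 0 ≤ x ^ n * I (P^[n] f) := fun n =>
    mul_nonneg (by positivity) (h.I_nonneg _ (h.iterate_mem hf n))
  have hIf : 0 < I f := by
    refine lt_of_le_of_ne (h.I_nonneg f hf) fun h0 => ?_
    have := hQ f hf m₀
    rw [← h0] at this hm₀
    linarith
  have hsum : Summable fun n => x ^ n * I (P^[n] f) :=
    summable_of_sum_range_le hterm (hQ f hf)
  obtain ⟨m, hm, hmt⟩ : ∃ m, m₀ ≤ m ∧ x ^ m * I (P^[m] f) < I f :=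
    ((eventually_ge_atTop m₀).and (hsum.tendsto_atTop_zero.eventually_lt_const hIf)).exists
  set S := ∑ n ∈ Finset.range m, x ^ n * I (P^[n] f) with hS
  have hSk : k * I f < S := lt_of_lt_of_le hm₀
    (Finset.sum_le_sum_of_subset_of_nonneg (Finset.range_mono hm) fun n _ _ => hterm n)
  have hS0 : 0 < S := lt_trans (by positivity) hSk
  obtain ⟨n1, n2, n3⟩ := h.neumann hf hx0.le m
  set U := ∑ n ∈ Finset.range m, x ^ n • P^[n] f
  have hPm := h.iterate_mem hf m
  have hbound : (x * S)⁻¹ * I f ≤ ε := by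
    rw [inv_mul_le_iff₀ (by positivity)]
    have h1 : ρ / 2 * (k * I f) * ε = I f := by rw [hk]; field_simp
    have h2 : ρ / 2 * (k * I f) ≤ x * S := by
      gcongr
    nlinarith
  refine ⟨x⁻¹, hδε (by rw [Real.dist_eq, abs_lt]; constructor <;> linarith), S⁻¹ • U,
    h.smul_mem _ (by positivity) _ n1, ?_, (x * S)⁻¹ • f, h.smul_mem _ (by positivity) _ hf,
    (x * S)⁻¹ • x ^ m • P^[m] f,
    h.smul_mem _ (by positivity) _ (h.smul_mem _ (by positivity) _ hPm), ?_, ?_, ?_⟩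
  · rw [h.I_smul _ (by positivity) _ n1, n2, inv_mul_cancel₀ hS0.ne']
  · rw [h.I_smul _ (by positivity) _ hf]
    exact hbound
  · rw [h.I_smul _ (by positivity) _ (h.smul_mem _ (by positivity) _ hPm),
      h.I_smul _ (by positivity) _ hPm]
    refine le_trans ?_ hbound
    exact mul_le_mul_of_nonneg_left hmt.le (by positivity)
  · rw [h.map_smul _ (by positivity) _ n1]
    have h1 : S⁻¹ • P U = (x * S)⁻¹ • x • P U := by
      rw [smul_smul]; congr 1; field_simp
    have h2 : x⁻¹ • S⁻¹ • U = (x * S)⁻¹ • U := by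
      rw [smul_smul, mul_inv]
    rw [h1, h2, ← smul_add, ← smul_add, n3]

end IsPositiveMap

end Cone

namespace TowerData

variable {T : TowerData}

/-! ### The invariant cone of densities -/

/-- The integral over the tower without its hole. -/
def total (T : TowerData) (f : ℝ × ℕ → ℝ) : ℝ := ∫ x in T.Del, f x ∂leb

/-- The cone of nonnegative functions `f` with `‖f‖_r ≤ K`, in the sense of `HolderRel`, and
`‖f‖_∞ ≤ M ∫ f`. -/
def cone (T : TowerData) (α ξ K M : ℝ) : Set (ℝ × ℕ → ℝ) :=
  {f | T.NonnegBdd ξ (M * T.total f) f ∧ T.HolderRel α ξ f (fun x => K * f x)}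

/-- The solution `K = b / (1 - a)` of `b + a K = K`.  As `C ≤ b`, the Lasota-Yorke inequality
preserves the bound `‖f‖_r ≤ K`. -/
def consK (C γ α ξ : ℝ) : ℝ := consB C / (1 - consA C γ α ξ)

namespace IsExpanding

variable {α γ β C ξ : ℝ} (h : T.IsExpanding α γ β C ξ)
include h

theorem consK_pos : 0 < consK C γ α ξ :=
  div_pos (by rw [consB]; linarith [h.C_pos]) (by linarith [h.consA_lt_one])

theorem consK_eq : consB C + consA C γ α ξ * consK C γ α ξ = consK C γ α ξ := by
  have : 1 - consA C γ α ξ ≠ 0 := by linarith [h.consA_lt_one]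
  rw [consK]
  field_simp
  ring

theorem weight_lintegral_ne_top (M : ℝ) :
    ∫⁻ x in T.Del, ENNReal.ofReal (M * Real.exp (ξ * x.2)) ∂leb ≠ ∞ := by
  rw [setLIntegral_slices h.tower.Del_measurable]
  have : ∀ l : ℕ, ∫⁻ z in slice T.Del l, ENNReal.ofReal (M * Real.exp (ξ * ((z, l) : ℝ × ℕ).2)) =
      ENNReal.ofReal M * (ENNReal.ofReal (Real.exp (ξ * l)) * volume (T.level l)) := by
    intro l
    simp only [setLIntegral_const]
    rw [ENNReal.ofReal_mul' (Real.exp_pos _).le, mul_assoc]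
    rfl
  simp only [this]
  rw [ENNReal.tsum_mul_left]
  exact ENNReal.mul_ne_top ENNReal.ofReal_ne_top h.weight_ne_top

theorem lintegral_ne_top {M : ℝ} {f : ℝ × ℕ → ℝ} (hf : T.NonnegBdd ξ M f) :
    ∫⁻ x in T.Del, ENNReal.ofReal (f x) ∂leb ≠ ∞ :=
  ne_top_of_le_ne_top (h.weight_lintegral_ne_top M)
    (setLIntegral_mono' h.tower.Del_measurable
      fun x hx => ENNReal.ofReal_le_ofReal (hf x hx).2)

theorem nonneg_ae {M : ℝ} {f : ℝ × ℕ → ℝ} (hf : T.NonnegBdd ξ M f) :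
    0 ≤ᵐ[leb.restrict T.Del] f :=
  (ae_restrict_iff' h.tower.Del_measurable).2 (Eventually.of_forall fun x hx => (hf x hx).1)

theorem aesm {f : ℝ × ℕ → ℝ} (hc : ContinuousOn f T.Del) :
    AEStronglyMeasurable f (leb.restrict T.Del) :=
  hc.aestronglyMeasurable h.tower.Del_measurable

theorem integrableOn {M : ℝ} {f : ℝ × ℕ → ℝ} (hf : T.NonnegBdd ξ M f)
    (hc : ContinuousOn f T.Del) : IntegrableOn f T.Del leb :=
  (lintegral_ofReal_ne_top_iff_integrable (h.aesm hc) (h.nonneg_ae hf)).1 (h.lintegral_ne_top hf)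

theorem ofReal_total {M : ℝ} {f : ℝ × ℕ → ℝ} (hf : T.NonnegBdd ξ M f)
    (hc : ContinuousOn f T.Del) :
    ENNReal.ofReal (T.total f) = ∫⁻ x in T.Del, ENNReal.ofReal (f x) ∂leb :=
  ofReal_integral_eq_lintegral_ofReal (h.integrableOn hf hc) (h.nonneg_ae hf)

theorem total_nonneg {M : ℝ} {f : ℝ × ℕ → ℝ} (hf : T.NonnegBdd ξ M f) : 0 ≤ T.total f :=
  setIntegral_nonneg h.tower.Del_measurable fun x hx => (hf x hx).1

theorem transfer_nonnegBdd {M : ℝ} (hM : 0 ≤ M) {f : ℝ × ℕ → ℝ} (hf : T.NonnegBdd ξ M f) :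
    ∃ N, 0 ≤ N ∧ T.NonnegBdd ξ N (T.transfer f) := by
  have hC := h.C_pos
  set W := ∑' p : T.Branch, (p.wt ξ).toReal with hW
  have hW0 : 0 ≤ W := tsum_nonneg fun p => ENNReal.toReal_nonneg
  refine ⟨M + M * (1 + C) * W, by positivity, fun x hx => ⟨h.transfer_nonneg hf hx, ?_⟩⟩
  obtain ⟨z, l⟩ := x
  have hc : 0 ≤ M * (1 + C) * W := by positivity
  cases l with
  | zero =>
    rw [h.tower.transfer_zero]
    have h1 := (h.summable_brTerm hf z).tsum_le_tsum (fun p => h.brTerm_le hM hf p z)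
      (h.summable_wt.mul_left _)
    rw [tsum_mul_left] at h1
    simpa using h1.trans (by linarith)
  | succ l =>
    rw [IsTower.transfer_succ f hx]
    refine (hf _ (IsTower.Del_pred hx)).2.trans ?_
    have h2 : Real.exp (ξ * l) ≤ Real.exp (ξ * (l + 1 : ℕ)) := by
      apply Real.exp_le_exp.2
      push_cast
      nlinarith [h.xi_pos]
    exact mul_le_mul (by linarith) h2 (Real.exp_pos _).le (by linarith)

theorem ofReal_total_transfer {M K : ℝ} (hM : 0 ≤ M) {f : ℝ × ℕ → ℝ}
    (hf : T.NonnegBdd ξ M f) (hfK : T.HolderRel α ξ f (fun x => K * f x))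
    (hK : 0 ≤ K) :
    ENNReal.ofReal (T.total (T.transfer f)) =
      ∫⁻ x in T.preim T.Del, ENNReal.ofReal (f x) ∂leb := by
  obtain ⟨N, -, hN⟩ := h.transfer_nonnegBdd hM hf
  have h1 := h.transfer_holder hf (hf.smul hK) hfK
  rw [h.ofReal_total hN (h1.continuousOn h.tower h.alpha_pos),
    h.setLIntegral_transfer hf (hfK.continuousOn h.tower h.alpha_pos) h.tower.Del_measurable
      subset_rfl]

theorem cone_continuousOn {K M : ℝ} {f : ℝ × ℕ → ℝ} (hf : f ∈ T.cone α ξ K M) :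
    ContinuousOn f T.Del :=
  hf.2.continuousOn h.tower h.alpha_pos

theorem total_add {K M : ℝ} {f g : ℝ × ℕ → ℝ} (hf : f ∈ T.cone α ξ K M)
    (hg : g ∈ T.cone α ξ K M) : T.total (f + g) = T.total f + T.total g :=
  integral_add (h.integrableOn hf.1 (h.cone_continuousOn hf))
    (h.integrableOn hg.1 (h.cone_continuousOn hg))

omit h in
theorem total_smul (c : ℝ) (f : ℝ × ℕ → ℝ) : T.total (c • f) = c * T.total f :=
  integral_const_mul c _

omit h in
theorem HolderRel_add {f g f' g' : ℝ × ℕ → ℝ} (hf : T.HolderRel α ξ f f')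
    (hg : T.HolderRel α ξ g g') : T.HolderRel α ξ (f + g) (f' + g') := by
  intro l ω hω hD x hx y hy
  have h1 := hf l ω hω hD x hx y hy
  have h2 := hg l ω hω hD x hx y hy
  simp only [Pi.add_apply]
  calc _ = |(f (x, l) - f (y, l)) + (g (x, l) - g (y, l))| := by congr 1; ring
    _ ≤ _ := abs_add_le _ _
    _ ≤ _ := by linarith

omit h in
theorem HolderRel_smul {f f' : ℝ × ℕ → ℝ} (c : ℝ) (hf : T.HolderRel α ξ f f') :
    T.HolderRel α ξ (c • f) (|c| • f') := by
  intro l ω hω hD x hx y hy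
  have h1 := mul_le_mul_of_nonneg_left (hf l ω hω hD x hx y hy) (abs_nonneg c)
  simp only [Pi.smul_apply, smul_eq_mul]
  rw [← mul_sub, abs_mul]
  linarith

omit h in
theorem HolderRel_mono {f g g' : ℝ × ℕ → ℝ} (hf : T.HolderRel α ξ f g)
    (hg : ∀ x ∈ T.Del, g x ≤ g' x) : T.HolderRel α ξ f g' := by
  intro l ω hω hD x hx y hy
  exact (hf l ω hω hD x hx y hy).trans (mul_le_mul_of_nonneg_left (hg _ (hD x hx))
    (mul_nonneg (Real.exp_pos _).le (Real.rpow_nonneg (abs_nonneg _) _)))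

omit h in
theorem HolderRel_congr {f f' g g' : ℝ × ℕ → ℝ} (hf : T.HolderRel α ξ f g)
    (hff' : EqOn f f' T.Del) (hg : EqOn g g' T.Del) : T.HolderRel α ξ f' g' := by
  intro l ω hω hD x hx y hy
  rw [← hff' (hD x hx), ← hff' (hD y hy), ← hg (hD x hx)]
  exact hf l ω hω hD x hx y hy

theorem add_mem_cone {K M : ℝ} {f g : ℝ × ℕ → ℝ} (hf : f ∈ T.cone α ξ K M)
    (hg : g ∈ T.cone α ξ K M) : f + g ∈ T.cone α ξ K M := by
  refine ⟨?_, ?_⟩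
  · rw [h.total_add hf hg, mul_add]
    exact hf.1.add hg.1
  · refine HolderRel_congr (HolderRel_add hf.2 hg.2) (fun _ _ => rfl) fun x _ => ?_
    simp [mul_add]

omit h in
theorem smul_mem_cone {K M c : ℝ} (hc : 0 ≤ c) {f : ℝ × ℕ → ℝ} (hf : f ∈ T.cone α ξ K M) :
    c • f ∈ T.cone α ξ K M := by
  refine ⟨?_, ?_⟩
  · have := hf.1.smul hc
    rw [total_smul]
    convert this using 1
    ring
  · refine HolderRel_congr (HolderRel_smul c hf.2) (fun _ _ => rfl) fun x _ => ?_
    simp [abs_of_nonneg hc]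
    ring

/-- The condition on `M` under which the cone is invariant: at least the proportion `a` of the mass
of a function of the cone survives, and, on the base, the transfer operator does not increase the
supremum relative to the mass. -/
def Admissible (T : TowerData) (α γ C ξ M : ℝ) : Prop :=
  0 ≤ M ∧ ∀ f ∈ T.cone α ξ (consK C γ α ξ) M,
    consA C γ α ξ * T.total f ≤ T.total (T.transfer f) ∧
    ∀ z : ℝ, T.transfer f (z, 0) ≤ M * T.total (T.transfer f)

/-- Bounds in terms of the weighted measure of the hole for the mass that falls into it.  The number
`q` is the mass that returns to the base, which controls the image on the base; without a hole in
the base, `q` is at most the surviving mass, which allows the better constant in this case. -/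
theorem mass_balance {M : ℝ} (hM : 0 ≤ M) {f : ℝ × ℕ → ℝ}
    (hf : f ∈ T.cone α ξ (consK C γ α ξ) M) {e₀ e₁ : ℝ} (he₀ : 0 ≤ e₀) (he₁ : 0 ≤ e₁)
    (h0 : T.consD C ξ * volume (T.holeAt 0) ≤ ENNReal.ofReal e₀)
    (h1 : T.consD C ξ * volume (T.holeAt 0) + T.upperHole ξ ≤ ENNReal.ofReal e₁) :
    T.total f ≤ T.total (T.transfer f) + M * T.total f * e₁ ∧
    ∃ q, q ≤ T.total f ∧ q ≤ T.total (T.transfer f) + M * T.total f * e₀ ∧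
      ∀ z : ℝ, T.transfer f (z, 0) ≤ consK C γ α ξ * q := by
  have hK := h.consK_pos.le
  have hc := h.cone_continuousOn hf
  have hft := h.total_nonneg hf.1
  have hMt : 0 ≤ M * T.total f := mul_nonneg hM hft
  obtain ⟨N, hN0, hN⟩ := h.transfer_nonnegBdd hMt hf.1
  have hst := h.total_nonneg hN
  have e1 := h.ofReal_total hf.1 hc
  have e2 := h.ofReal_total_transfer hMt hf.1 hf.2 hK
  have e3 := h.lost_base_le hf.1
  have e4 := h.lost_up_le hf.1
  have hq : ∫⁻ x in T.returning univ, ENNReal.ofReal (f x) ∂leb ≤ ENNReal.ofReal (T.total f) := by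
    rw [e1]
    refine lintegral_mono_set ?_
    rintro ⟨z, l⟩ hz
    obtain ⟨p, ⟨hp, -⟩, rfl⟩ := mem_iUnion.1 hz
    exact IsTower.branch_Del p hp
  refine ⟨?_, (∫⁻ x in T.returning univ, ENNReal.ofReal (f x) ∂leb).toReal, ?_, ?_, ?_⟩
  · rw [← ENNReal.ofReal_le_ofReal_iff (by positivity), ENNReal.ofReal_add hst (by positivity), e1,
      e2, ENNReal.ofReal_mul hMt]
    calc _ ≤ _ := lintegral_mono_set h.Del_subset
      _ ≤ _ := lintegral_union_le _ _ _
      _ ≤ _ := add_le_add_right (lintegral_union_le _ _ _) _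
      _ ≤ _ := add_le_add_right (add_le_add e4 e3) _
      _ ≤ _ := by
        rw [← mul_add, add_comm (T.upperHole ξ)]
        exact add_le_add_right (mul_le_mul_right h1 _) _
  · exact ENNReal.toReal_le_of_le_ofReal hft hq
  · refine ENNReal.toReal_le_of_le_ofReal (by positivity) ?_
    rw [ENNReal.ofReal_add hst (by positivity), e2, ENNReal.ofReal_mul hMt]
    calc _ ≤ _ := lintegral_mono_set returning_subset
      _ ≤ _ := lintegral_union_le _ _ _
      _ ≤ _ := add_le_add_right (e3.trans (mul_le_mul_right h0 _)) _
  · intro z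
    have := h.transfer_base_le hK hf.1 hf.2 z
    rw [h.consK_eq, ← ENNReal.ofReal_toReal (ne_top_of_le_ne_top ENNReal.ofReal_ne_top hq),
      ← ENNReal.ofReal_mul hK] at this
    exact (ENNReal.ofReal_le_ofReal_iff (mul_nonneg hK ENNReal.toReal_nonneg)).1 this

theorem admissible_of_H3gen (h3 : T.H3gen C γ α ξ) :
    Admissible T α γ C ξ (2 * consK C γ α ξ) := by
  have hK := h.consK_pos
  have ha0 : 0 < consA C γ α ξ := consA_pos
  have ha1 := h.consA_lt_one
  have hb : 0 < consB C := by rw [consB]; linarith [h.C_pos]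
  refine ⟨by positivity, fun f hf => ?_⟩
  have he : 0 ≤ (1 - consA C γ α ξ) ^ 2 / (4 * consB C) := by positivity
  obtain ⟨h1, q, hq, -, hz⟩ := h.mass_balance (by positivity) hf he he
    (le_self_add.trans h3) h3
  have hft := h.total_nonneg hf.1
  -- at most the proportion `(1 - a) / 2` of the mass is lost
  have h4 : 2 * consK C γ α ξ * T.total f * ((1 - consA C γ α ξ) ^ 2 / (4 * consB C)) =
      T.total f * (1 - consA C γ α ξ) / 2 := by
    have : 1 - consA C γ α ξ ≠ 0 := by linarith
    rw [consK]; field_simp; ring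
  rw [h4] at h1
  refine ⟨by nlinarith, fun z => (hz z).trans ?_⟩
  have h5 : q ≤ 2 * T.total (T.transfer f) := by nlinarith
  calc _ ≤ consK C γ α ξ * (2 * T.total (T.transfer f)) := mul_le_mul_of_nonneg_left h5 hK.le
    _ = _ := by ring

theorem admissible_of_H3noBase (h3 : T.H3noBase C γ α ξ) :
    Admissible T α γ C ξ (consK C γ α ξ) := by
  have hK := h.consK_pos
  have ha0 : 0 < consA C γ α ξ := consA_pos
  have ha1 := h.consA_lt_one
  have hb : 0 < consB C := by rw [consB]; linarith [h.C_pos]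
  refine ⟨hK.le, fun f hf => ?_⟩
  have he : 0 ≤ (1 - consA C γ α ξ) ^ 2 / consB C := by positivity
  obtain ⟨h1, q, -, hq, hz⟩ := h.mass_balance hK.le hf le_rfl he
    (by rw [h3.1, mul_zero]; exact zero_le) (by rw [h3.1, mul_zero, zero_add]; exact h3.2)
  have hft := h.total_nonneg hf.1
  -- at most the proportion `1 - a` of the mass is lost
  have h4 : consK C γ α ξ * T.total f * ((1 - consA C γ α ξ) ^ 2 / consB C) =
      T.total f * (1 - consA C γ α ξ) := by
    have : 1 - consA C γ α ξ ≠ 0 := by linarith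
    rw [consK]; field_simp
  rw [h4] at h1
  refine ⟨by linarith, fun z => (hz z).trans ?_⟩
  rw [mul_zero, add_zero] at hq
  exact mul_le_mul_of_nonneg_left hq hK.le

theorem transfer_mem_cone {M : ℝ} (hM : Admissible T α γ C ξ M) {f : ℝ × ℕ → ℝ}
    (hf : f ∈ T.cone α ξ (consK C γ α ξ) M) :
    T.transfer f ∈ T.cone α ξ (consK C γ α ξ) M := by
  obtain ⟨hM0, hM⟩ := hM
  obtain ⟨h1, h2⟩ := hM f hf
  refine ⟨fun x hx => ⟨h.transfer_nonneg hf.1 hx, ?_⟩, ?_⟩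
  · obtain ⟨z, l⟩ := x
    cases l with
    | zero => simpa using h2 z
    | succ l =>
      rw [IsTower.transfer_succ f hx]
      refine (hf.1 _ (IsTower.Del_pred hx)).2.trans ?_
      have he : Real.exp (ξ * l) ≤ consA C γ α ξ * Real.exp (ξ * (l + 1 : ℕ)) := by
        have : Real.exp (ξ * l) = Real.exp (-ξ) * Real.exp (ξ * (l + 1 : ℕ)) := by
          rw [← Real.exp_add]; congr 1; push_cast; ring
        rw [this]
        exact mul_le_mul_of_nonneg_right (le_max_left _ _) (Real.exp_pos _).le
      have ht := h.total_nonneg hf.1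
      calc _ ≤ M * T.total f * (consA C γ α ξ * Real.exp (ξ * (l + 1 : ℕ))) := by
            exact mul_le_mul_of_nonneg_left he (mul_nonneg hM0 ht)
        _ = M * (consA C γ α ξ * T.total f) * Real.exp (ξ * (l + 1 : ℕ)) := by ring
        _ ≤ _ := by gcongr
  · refine HolderRel_mono (h.transfer_holder hf.1 (hf.1.smul h.consK_pos.le) hf.2) fun x hx => ?_
    rw [transfer_smul, Pi.smul_apply, smul_eq_mul]
    have h4 := h.transfer_nonneg hf.1 hx
    have h5 := h.consK_eq
    rw [consB] at h5
    nlinarith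

/-- The transfer operator, cut off outside of the tower, is a positive map of the cone. -/
theorem isPositiveMap {M : ℝ} (hM : Admissible T α γ C ξ M) :
    IsPositiveMap (T.cone α ξ (consK C γ α ξ) M) T.total
      (fun f => T.Del.indicator (T.transfer f)) (consA C γ α ξ) := by
  have htot : ∀ f, T.total (T.Del.indicator (T.transfer f)) = T.total (T.transfer f) := fun f =>
    setIntegral_congr_fun h.tower.Del_measurable fun x hx => indicator_of_mem hx _
  refine ⟨consA_pos, fun f hf g hg => h.add_mem_cone hf hg, fun c hc f hf => smul_mem_cone hc hf,
    fun f hf => ?_, fun f hf g hg => ?_, fun c _ f _ => ?_, fun f hf g hg => h.total_add hf hg,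
    fun c _ f _ => total_smul c f, fun f hf => h.total_nonneg hf.1, fun f hf => ?_, fun f hf => ?_⟩
  · obtain ⟨h1, h2⟩ := h.transfer_mem_cone hM hf
    refine ⟨fun x hx => ?_, HolderRel_congr h2 (fun x hx => ?_) fun x hx => ?_⟩
    · rw [htot, indicator_of_mem hx]
      exact h1 x hx
    · simp only [indicator_of_mem hx]
    · simp only [indicator_of_mem hx]
  · ext x
    by_cases hx : x ∈ T.Del
    · simp [hx, h.transfer_add hf.1 hg.1 hx]
    · simp [hx]
  · simp only [transfer_smul]
    ext x
    by_cases hx : x ∈ T.Del <;> simp [hx]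
  · rw [htot]
    exact (hM.2 f hf).1
  · have hMt : 0 ≤ M * T.total f := mul_nonneg hM.1 (h.total_nonneg hf.1)
    rw [htot, ← ENNReal.ofReal_le_ofReal_iff (h.total_nonneg hf.1),
      h.ofReal_total_transfer hMt hf.1 hf.2 h.consK_pos.le,
      h.ofReal_total hf.1 (h.cone_continuousOn hf)]
    exact lintegral_mono_set fun x hx => hx.1

/-! ### Compactness of the normalized cone -/

/-- Functions of the normalized cone are equicontinuous at each point of the tower. -/
theorem cone_equicontinuous {K M : ℝ} (hK : 0 ≤ K) (hM : 0 ≤ M) {x : ℝ × ℕ} (hx : x ∈ T.Del)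
    {ε : ℝ} (hε : 0 < ε) : ∃ U ∈ 𝓝 x, U ⊆ T.Del ∧ ∀ u ∈ T.cone α ξ K M, T.total u = 1 →
      ∀ y ∈ U, |u x - u y| < ε := by
  obtain ⟨z, l⟩ := x
  obtain ⟨ω, hω, hz⟩ := IsTower.exists_Z hx
  have hD : ∀ w ∈ ω, (w, l) ∈ T.Del := fun w hw => (h.tower.Del_iff hω hz hw).1 hx
  set B := Real.exp (ξ * l) * (K * (M * Real.exp (ξ * l))) with hB
  have hB0 : 0 ≤ B := by positivity
  have hc : Continuous fun w : ℝ => B * |z - w| ^ α := by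
    have : Continuous fun w : ℝ => |z - w| ^ α :=
      (continuous_const.sub continuous_id).abs.rpow_const fun _ => Or.inr h.alpha_pos.le
    fun_prop
  have hev : ∀ᶠ w in 𝓝 z, B * |z - w| ^ α < ε := by
    have := hc.tendsto z
    simp only [sub_self, abs_zero, Real.zero_rpow h.alpha_pos.ne', mul_zero] at this
    exact this.eventually_lt_const hε
  refine ⟨(ω ∩ {w | B * |z - w| ^ α < ε}) ×ˢ {l}, ?_, ?_, ?_⟩
  · exact prod_mem_nhds (inter_mem ((h.tower.Z_open hω).mem_nhds hz) hev) (by simp)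
  · rintro ⟨w, k⟩ ⟨hw, rfl⟩
    exact hD w hw.1
  · rintro u hu hu1 ⟨w, k⟩ ⟨hw, rfl⟩
    refine lt_of_le_of_lt ((hu.2 _ ω hω hD z hz w hw.1).trans ?_) hw.2
    have h1 := (hu.1 _ hx).2
    rw [hu1, mul_one] at h1
    have : 0 ≤ |z - w| ^ α := Real.rpow_nonneg (abs_nonneg _) _
    calc _ ≤ Real.exp (ξ * k) * |z - w| ^ α * (K * (M * Real.exp (ξ * k))) :=
          mul_le_mul_of_nonneg_left (mul_le_mul_of_nonneg_left h1 hK) (by positivity)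
      _ = _ := by rw [hB]; ring

theorem exists_tendsto_subseq {K M : ℝ} (hK : 0 ≤ K) (hM : 0 ≤ M) {u : ℕ → ℝ × ℕ → ℝ}
    (hu : ∀ n, u n ∈ T.cone α ξ K M) (hu1 : ∀ n, T.total (u n) = 1) :
    ∃ φ : ℕ → ℕ, StrictMono φ ∧ ∃ v : ℝ × ℕ → ℝ,
      ∀ x ∈ T.Del, Tendsto (fun n => u (φ n) x) atTop (𝓝 (v x)) := by
  obtain ⟨Q, hQc, hQd⟩ := TopologicalSpace.exists_countable_dense T.Del
  have : Countable Q := hQc.to_subtype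
  have hcomp : IsCompact (univ.pi fun q : Q => Icc (0 : ℝ) (M * Real.exp (ξ * q.1.1.2))) :=
    isCompact_univ_pi fun q => isCompact_Icc
  obtain ⟨w, -, φ, hφ, hw⟩ := hcomp.tendsto_subseq (x := fun n (q : Q) => u n q.1.1) (by
    intro n q _
    have := (hu n).1 q.1.1 q.1.2
    rw [hu1, mul_one] at this
    exact this)
  rw [tendsto_pi_nhds] at hw
  have hcau : ∀ x ∈ T.Del, ∃ y, Tendsto (fun n => u (φ n) x) atTop (𝓝 y) := by
    intro x hx
    refine cauchySeq_tendsto_of_complete (Metric.cauchySeq_iff'.2 fun ε hε => ?_)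
    obtain ⟨U, hU, hUD, hUe⟩ := h.cone_equicontinuous hK hM hx (by positivity : 0 < ε / 4)
    obtain ⟨V, hVU, hVo, hxV⟩ := mem_nhds_iff.1 hU
    obtain ⟨q, hqQ, hqV⟩ := hQd.exists_mem_open (hVo.preimage continuous_subtype_val)
      ⟨⟨x, hx⟩, hxV⟩
    have hq := (hw ⟨q, hqQ⟩).cauchySeq
    obtain ⟨n₀, hn₀⟩ := Metric.cauchySeq_iff'.1 hq (ε / 4) (by positivity)
    refine ⟨n₀, fun n hn => ?_⟩
    have h1 := hUe _ (hu (φ n)) (hu1 _) q (hVU hqV)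
    have h2 := hUe _ (hu (φ n₀)) (hu1 _) q (hVU hqV)
    have h3 := hn₀ n hn
    simp only [Function.comp, Real.dist_eq] at h3 ⊢
    rw [abs_lt] at *
    constructor <;> linarith [h1.1, h1.2, h2.1, h2.2, h3.1, h3.2]
  choose! v hv using hcau
  exact ⟨φ, hφ, v, hv⟩

theorem cone_closed {K M : ℝ} {u : ℕ → ℝ × ℕ → ℝ}
    (hu : ∀ n, u n ∈ T.cone α ξ K M) (hu1 : ∀ n, T.total (u n) = 1) {v : ℝ × ℕ → ℝ}
    (hv : ∀ x ∈ T.Del, Tendsto (fun n => u n x) atTop (𝓝 (v x))) :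
    v ∈ T.cone α ξ K M ∧ T.total v = 1 := by
  have hb : ∀ n, T.NonnegBdd ξ M (u n) := fun n => by
    have := (hu n).1
    rwa [hu1, mul_one] at this
  have htot : T.total v = 1 := by
    have h1 : Tendsto (fun n => T.total (u n)) atTop (𝓝 (T.total v)) := by
      refine tendsto_integral_of_dominated_convergence
        (fun x => M * Real.exp (ξ * x.2)) (fun n => h.aesm (h.cone_continuousOn (hu n))) ?_ ?_ ?_
      · refine IntegrableOn.integrable ?_
        by_cases hne : T.Del.Nonempty
        · obtain ⟨x, hx⟩ := hne
          have hM : 0 ≤ M := by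
            have := (hb 0 x hx).1.trans (hb 0 x hx).2
            exact nonneg_of_mul_nonneg_left this (Real.exp_pos _)
          refine (lintegral_ofReal_ne_top_iff_integrable ?_ ?_).1 (h.weight_lintegral_ne_top M)
          · refine Continuous.aestronglyMeasurable ?_
            have : Continuous fun x : ℝ × ℕ => (x.2 : ℝ) :=
              continuous_of_discreteTopology.comp continuous_snd
            fun_prop
          · exact Eventually.of_forall fun x => by positivity
        · rw [not_nonempty_iff_eq_empty.1 hne]
          exact integrableOn_empty
      · intro n
        refine (ae_restrict_iff' h.tower.Del_measurable).2 (Eventually.of_forall fun x hx => ?_)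
        rw [Real.norm_of_nonneg (hb n x hx).1]
        exact (hb n x hx).2
      · exact (ae_restrict_iff' h.tower.Del_measurable).2 (Eventually.of_forall hv)
    simp only [hu1] at h1
    exact tendsto_nhds_unique h1 tendsto_const_nhds
  refine ⟨⟨?_, ?_⟩, htot⟩
  · rw [htot, mul_one]
    exact fun x hx => ⟨ge_of_tendsto' (hv x hx) fun n => (hb n x hx).1,
      le_of_tendsto' (hv x hx) fun n => (hb n x hx).2⟩
  · intro l ω hω hD x hx y hy
    refine le_of_tendsto_of_tendsto' ((hv _ (hD x hx)).sub (hv _ (hD y hy))).abs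
      (((hv _ (hD x hx)).const_mul K).const_mul _) fun n => (hu n).2 l ω hω hD x hx y hy

/-- Approximate eigenvectors converge to an eigenvector along a subsequence. -/
theorem exists_eigenfunction {M : ℝ} (hM : Admissible T α γ C ξ M)
    (hne : ∃ f ∈ T.cone α ξ (consK C γ α ξ) M, 0 < T.total f) :
    ∃ r, 0 < r ∧ ∃ φ ∈ T.cone α ξ (consK C γ α ξ) M, T.total φ = 1 ∧
      ∀ x ∈ T.Del, T.transfer φ x = r * φ x := by
  obtain ⟨r, hr, hap⟩ := (h.isPositiveMap hM).exists_approx_eigenvector hne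
  choose lam hlam u hu hu1 f hf g hg hfI hgI heq using
    fun n : ℕ => hap (1 / (n + 1 : ℝ)) (by positivity)
  obtain ⟨φ, hφ, v, hv⟩ := h.exists_tendsto_subseq h.consK_pos.le hM.1 hu hu1
  obtain ⟨hvc, hv1⟩ := h.cone_closed (fun n => hu (φ n)) (fun n => hu1 (φ n)) hv
  refine ⟨r, hr, v, hvc, hv1, fun x hx => ?_⟩
  have h0 : Tendsto (fun n => 1 / ((φ n : ℝ) + 1)) atTop (𝓝 0) :=
    tendsto_one_div_add_atTop_nhds_zero_nat.comp hφ.tendsto_atTop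
  have hl : Tendsto (fun n => lam (φ n)) atTop (𝓝 r) := by
    rw [tendsto_iff_norm_sub_tendsto_zero]
    exact squeeze_zero (fun n => norm_nonneg _) (fun n => (hlam (φ n)).le) h0
  have hsmall : ∀ w : ℕ → ℝ × ℕ → ℝ, (∀ n, w n ∈ T.cone α ξ (consK C γ α ξ) M) →
      (∀ n : ℕ, T.total (w n) ≤ 1 / (n + 1 : ℝ)) →
      Tendsto (fun n => w (φ n) x) atTop (𝓝 0) := by
    intro w hw hwI
    have h1 : Tendsto (fun n => M * (1 / ((φ n : ℝ) + 1)) * Real.exp (ξ * x.2)) atTop (𝓝 0) := by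
      simpa using (h0.const_mul M).mul_const (Real.exp (ξ * x.2))
    refine squeeze_zero (fun n => ((hw (φ n)).1 x hx).1) (fun n => ?_) h1
    refine ((hw (φ n)).1 x hx).2.trans ?_
    exact mul_le_mul_of_nonneg_right (mul_le_mul_of_nonneg_left (hwI _) hM.1) (Real.exp_pos _).le
  have hP : Tendsto (fun n => T.transfer (u (φ n)) x) atTop (𝓝 (T.transfer v x)) :=
    h.tendsto_transfer hM.1 (fun n => by
      have := (hu (φ n)).1
      rwa [hu1, mul_one] at this) hv hx
  have hR : Tendsto (fun n => lam (φ n) * u (φ n) x + g (φ n) x - f (φ n) x) atTop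
      (𝓝 (r * v x + 0 - 0)) :=
    ((hl.mul (hv x hx)).add (hsmall g hg hgI)).sub (hsmall f hf hfI)
  have he : ∀ n, T.transfer (u n) x = lam n * u n x + g n x - f n x := by
    intro n
    have := congrFun (heq n) x
    simp only [Pi.add_apply, indicator_of_mem hx, Pi.smul_apply, smul_eq_mul] at this
    linarith
  simp only [← he, add_zero, sub_zero] at hR
  exact tendsto_nhds_unique hP hR

/-! ### Nontriviality of the cone -/

omit h in
theorem holderRel_exp {K : ℝ} (hK : 0 ≤ K) :
    T.HolderRel α ξ (fun x => Real.exp (ξ * x.2)) (fun x => K * Real.exp (ξ * x.2)) := by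
  intro l ω _ _ x _ y _
  simp only [sub_self, abs_zero]
  have : 0 ≤ |x - y| ^ α := Real.rpow_nonneg (abs_nonneg _) _
  positivity

theorem ofReal_total_exp : ENNReal.ofReal (T.total fun x => Real.exp (ξ * x.2)) =
    ∑' l : ℕ, ENNReal.ofReal (Real.exp (ξ * l)) * volume (T.level l) := by
  rw [h.ofReal_total (M := 1) (fun x _ => ⟨(Real.exp_pos _).le, by simp⟩)
    ((holderRel_exp zero_le_one).continuousOn h.tower h.alpha_pos),
    setLIntegral_slices h.tower.Del_measurable]
  refine tsum_congr fun l => ?_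
  simp only [setLIntegral_const]
  rfl

/-- The function `e^{ξ l}` is in the cone as soon as the weighted measure of the tower is at least
`1 / M`. -/
theorem exp_mem_cone {K M w : ℝ} (hK : 0 ≤ K) (hM : 0 ≤ M) (hw : 0 < w) (hMw : 1 ≤ M * w)
    (hT : ENNReal.ofReal w ≤ ∑' l : ℕ, ENNReal.ofReal (Real.exp (ξ * l)) * volume (T.level l)) :
    ∃ f ∈ T.cone α ξ K M, 0 < T.total f := by
  rw [← h.ofReal_total_exp, ENNReal.ofReal_le_ofReal_iff'] at hT
  have hw' : w ≤ T.total fun x => Real.exp (ξ * x.2) := by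
    rcases hT with hT | hT
    · exact hT
    · linarith
  refine ⟨fun x => Real.exp (ξ * x.2), ⟨fun x _ => ⟨(Real.exp_pos _).le, ?_⟩,
    holderRel_exp hK⟩, hw.trans_le hw'⟩
  refine le_mul_of_one_le_left (Real.exp_pos _).le (hMw.trans ?_)
  exact mul_le_mul_of_nonneg_left hw' hM

theorem one_le_volume_level_zero (h0 : volume (T.holeAt 0) = 0) : 1 ≤ volume (T.level 0) := by
  have h1 : volume ((slice T.Del 0)ᶜ ∩ Icc 0 T.N) = 0 :=
    le_antisymm (h.volume_compl_level_zero_le.trans h0.le) zero_le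
  have h2 : Icc (0 : ℝ) T.N ⊆ T.level 0 ∪ ((slice T.Del 0)ᶜ ∩ Icc 0 T.N) := by
    intro z hz
    by_cases hz' : z ∈ slice T.Del 0
    · exact Or.inl hz'
    · exact Or.inr ⟨hz', hz⟩
  have h3 := (measure_mono h2).trans (measure_union_le (μ := volume) _ _)
  rw [h1, add_zero, Real.volume_Icc, sub_zero, ENNReal.ofReal_natCast] at h3
  refine le_trans ?_ h3
  exact_mod_cast h.tower.N_pos

theorem one_le_consK : 1 ≤ consK C γ α ξ := by
  have := h.consA_lt_one
  have h2 : 0 < consA C γ α ξ := consA_pos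
  rw [consK, le_div_iff₀ (by linarith), consB]
  linarith [h.C_pos]

/-- There is an admissible constant for which the cone is nontrivial: `2 b / (1 - a)` in general,
and `b / (1 - a)` if there is no hole in the base. -/
theorem exists_admissible (h3 : T.H3 C γ α ξ) (hne : T.HoleNotHuge C γ α ξ) :
    ∃ M, Admissible T α γ C ξ M ∧ ∃ f ∈ T.cone α ξ (consK C γ α ξ) M, 0 < T.total f := by
  have hK := h.consK_pos
  have ha1 := h.consA_lt_one
  have hb : 0 < consB C := by rw [consB]; linarith [h.C_pos]
  rcases h3 with h3 | h3
  · refine ⟨_, h.admissible_of_H3gen h3, h.exp_mem_cone hK.le (by positivity)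
      (div_pos (by linarith) (by positivity)) (le_of_eq ?_) hne⟩
    have : 1 - consA C γ α ξ ≠ 0 := by linarith
    rw [consK]
    field_simp
  · refine ⟨_, h.admissible_of_H3noBase h3, h.exp_mem_cone hK.le hK.le zero_lt_one
      (by simpa using h.one_le_consK) ?_⟩
    rw [ENNReal.ofReal_one]
    refine le_trans ?_ (ENNReal.le_tsum 0)
    simpa using h.one_le_volume_level_zero h3.1

end IsExpanding

/-! ### Eigenfunctions of the transfer operator -/

/-- A nonnegative eigenfunction of the transfer operator, regular in the sense of the space `X`. -/
structure IsEigen (T : TowerData) (α ξ r : ℝ) (f : ℝ × ℕ → ℝ) : Prop where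
  pos : 0 < r
  bdd : ∃ M, 0 ≤ M ∧ T.NonnegBdd ξ M f
  holder : ∃ K, 0 ≤ K ∧ T.HolderRel α ξ f (fun x => K * f x)
  eq : ∀ x ∈ T.Del, T.transfer f x = r * f x

namespace IsEigen

variable {α ξ r : ℝ} {f : ℝ × ℕ → ℝ} (hf : T.IsEigen α ξ r f)
include hf

theorem nonneg {x : ℝ × ℕ} (hx : x ∈ T.Del) : 0 ≤ f x := by
  obtain ⟨M, -, hM⟩ := hf.bdd
  exact (hM x hx).1

/-- An eigenfunction is determined by its values on the base. -/
theorem level {z : ℝ} {l : ℕ} (hz : (z, l) ∈ T.Del) : f (z, l) = f (z, 0) / r ^ l := by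
  induction l with
  | zero => simp
  | succ l ih =>
    have h1 := hf.eq _ hz
    rw [IsTower.transfer_succ f hz, ih (IsTower.Del_pred hz)] at h1
    have := hf.pos
    rw [pow_succ, ← div_div, h1]
    field_simp

variable {γ β C : ℝ} (h : T.IsExpanding α γ β C ξ)
include h

theorem holder_base : ∃ K, 0 ≤ K ∧ ∀ l i x y, (x, l) ∈ T.Del → (y, l) ∈ T.Del →
    x ∈ baseInt i → y ∈ baseInt i → |f (x, l) - f (y, l)| ≤ |x - y| ^ α * (K * f (x, l)) := by
  obtain ⟨M, hM, hMf⟩ := hf.bdd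
  obtain ⟨K, hK, hKf⟩ := hf.holder
  have hC := h.C_pos
  have ha : 0 < consA C γ α ξ := IsExpanding.consA_pos
  refine ⟨consA C γ α ξ * K + C, by positivity, fun l i x y hx hy hxi hyi => ?_⟩
  have h1 := h.transfer_holder_base hMf (hMf.smul hK) hKf hxi hyi
  have hx0 := IsTower.Del_zero hx
  have hy0 := IsTower.Del_zero hy
  rw [transfer_smul, Pi.smul_apply, smul_eq_mul, hf.eq _ hx0, hf.eq _ hy0, ← mul_sub, abs_mul,
    abs_of_pos hf.pos] at h1
  have h2 : |f (x, 0) - f (y, 0)| ≤ |x - y| ^ α * ((consA C γ α ξ * K + C) * f (x, 0)) := by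
    refine le_of_mul_le_mul_left (h1.trans (le_of_eq ?_)) hf.pos
    ring
  have hrl : 0 < r ^ l := pow_pos hf.pos l
  rw [hf.level hx, hf.level hy, ← sub_div, abs_div, abs_of_pos hrl, div_le_iff₀ hrl]
  refine h2.trans (le_of_eq ?_)
  field_simp

theorem memX : T.MemX α ξ f := by
  obtain ⟨M, hM, hMf⟩ := hf.bdd
  obtain ⟨K, hK, hKf⟩ := hf.holder_base h
  have hDel : ∀ l, ∀ J ∈ T.part l, ∀ z ∈ J ∩ T.cells, (z, l) ∈ T.Del := by
    intro l J hJ z hz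
    have : z ∈ ⋃₀ T.part l ∩ T.cells := ⟨⟨J, hJ, hz.1⟩, hz.2⟩
    rw [h.tower.part_cover] at this
    exact this
  refine max_lt (lt_of_le_of_lt ?_ (ENNReal.ofReal_lt_top (r := M)))
    (lt_of_le_of_lt ?_ (ENNReal.ofReal_lt_top (r := K)))
  · refine iSup_le fun l => iSup₂_le fun J hJ => iSup₂_le fun z hz => ENNReal.ofReal_le_ofReal ?_
    have h1 := hMf _ (hDel l J hJ z hz)
    rw [abs_of_nonneg h1.1]
    calc _ ≤ Real.exp (-(ξ * l)) * (M * Real.exp (ξ * l)) :=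
          mul_le_mul_of_nonneg_left h1.2 (Real.exp_pos _).le
      _ = M * (Real.exp (-(ξ * l)) * Real.exp (ξ * l)) := by ring
      _ = M := by rw [← Real.exp_add]; simp
  · refine iSup_le fun l => iSup₂_le fun J hJ => iSup₂_le fun x hx => iSup₂_le fun y hy =>
      iSup_le fun _ => ENNReal.ofReal_le_ofReal ?_
    obtain ⟨i, -, hi⟩ := (h.tower.part_cell l J hJ).2
    have h1 := hKf l i x y (hDel l J hJ x hx) (hDel l J hJ y hy) (hi hx.1) (hi hy.1)
    have h2 := hf.nonneg (hDel l J hJ x hx)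
    have h3 : 0 ≤ |x - y| ^ α := Real.rpow_nonneg (abs_nonneg _) _
    have h4 : |f (x, l) - f (y, l)| / (|x - y| ^ α * |f (x, l)|) ≤ K := by
      rw [abs_of_nonneg h2]
      exact div_le_of_le_mul₀ (by positivity) hK (h1.trans (le_of_eq (by ring)))
    have h5 : Real.exp (-(ξ * l)) ≤ 1 := by
      rw [Real.exp_le_one_iff]
      have := h.xi_pos
      have : (0 : ℝ) ≤ l := Nat.cast_nonneg l
      nlinarith
    calc _ ≤ K * 1 := mul_le_mul h4 h5 (Real.exp_pos _).le hK
      _ = K := mul_one K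

end IsEigen

/-- Comparison along a chain of small steps. -/
theorem chain_le {s : Set ℝ} (hs : s.OrdConnected) {f : ℝ → ℝ} {c δ : ℝ} (hc : 0 ≤ c)
    (hstep : ∀ u ∈ s, ∀ v ∈ s, |u - v| ≤ δ → c * f u ≤ f v) (n : ℕ) :
    ∀ x ∈ s, ∀ y ∈ s, |x - y| ≤ n * δ → c ^ n * f x ≤ f y := by
  induction n with
  | zero =>
    intro x _ y _ hxy
    have : x = y := by
      have : |x - y| = 0 := le_antisymm (by simpa using hxy) (abs_nonneg _)
      exact sub_eq_zero.1 (abs_eq_zero.1 this)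
    simp [this]
  | succ n ih =>
    intro x hx y hy hxy
    set t : ℝ := n / (n + 1) with ht
    have hn : (0 : ℝ) < n + 1 := by positivity
    have ht0 : 0 ≤ t := by positivity
    have ht1 : 1 - t = 1 / (n + 1) := by rw [ht]; field_simp; ring
    have ht1' : 0 ≤ 1 - t := by rw [ht1]; positivity
    have hw : (1 - t) * x + t * y ∈ s := hs.convex hx hy ht1' ht0 (by ring)
    push_cast at hxy
    have h1 := ih x hx _ hw (by
      have : x - ((1 - t) * x + t * y) = t * (x - y) := by ring
      rw [this, abs_mul, abs_of_nonneg ht0, ht, div_mul_eq_mul_div, div_le_iff₀ hn]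
      have : (0 : ℝ) ≤ n := Nat.cast_nonneg n
      nlinarith)
    have h2 := hstep _ hw y hy (by
      have : (1 - t) * x + t * y - y = (1 - t) * (x - y) := by ring
      rw [this, abs_mul, abs_of_nonneg ht1', ht1, div_mul_eq_mul_div, div_le_iff₀ hn]
      linarith)
    calc _ = c * (c ^ n * f x) := by ring
      _ ≤ c * f ((1 - t) * x + t * y) := mul_le_mul_of_nonneg_left h1 hc
      _ ≤ f y := h2

namespace IsExpanding

variable {α γ β C ξ : ℝ} (h : T.IsExpanding α γ β C ξ)
include h

/-- The values of a Hölder function on a branch are comparable, uniformly in the branch: the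
contraction of the inverse branches allows chains of the same number of steps for all of them. -/
theorem exists_branch_comparable {M K : ℝ} (hK : 0 ≤ K) {f : ℝ × ℕ → ℝ}
    (hf : T.NonnegBdd ξ M f) (hfK : T.HolderRel α ξ f (fun x => K * f x)) :
    ∃ c, 0 < c ∧ ∀ p : T.Branch, ∀ x ∈ p.dom, ∀ y ∈ p.dom,
      c * f (x, p.lev) ≤ f (y, p.lev) := by
  have hg : 0 < γ := by linarith [h.one_lt_gamma]
  obtain ⟨n, hn1, hn⟩ : ∃ n : ℕ, 1 ≤ n ∧ K * (n : ℝ) ^ (-α) ≤ 1 / 2 := by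
    have h1 : Tendsto (fun n : ℕ => K * (n : ℝ) ^ (-α)) atTop (𝓝 (K * 0)) :=
      ((tendsto_rpow_neg_atTop h.alpha_pos).comp tendsto_natCast_atTop_atTop).const_mul K
    rw [mul_zero] at h1
    exact ((eventually_ge_atTop 1).and (h1.eventually_le_const (by norm_num))).exists
  have hn0 : (0 : ℝ) < n := by exact_mod_cast hn1
  refine ⟨(1 / 2) ^ n, by positivity, fun p x hx y hy => ?_⟩
  have hE : 0 < γ * Real.exp (β * p.lev) := by positivity
  have hDel : ∀ z ∈ p.dom, (z, p.lev) ∈ T.Del := fun z hz => IsTower.branch_Del p hz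
  refine chain_le (h.tower.Z_ordConnected (IsTower.branch_Z p)) (f := fun z => f (z, p.lev))
    (δ := 1 / (n * (γ * Real.exp (β * p.lev)))) (by norm_num) ?_ n x hx y hy ?_
  · intro u hu v hv huv
    have h1 := hfK p.lev p.dom (IsTower.branch_Z p) hDel u hu v hv
    have hfu := (hf _ (hDel u hu)).1
    have h2 : Real.exp (ξ * p.lev) * |u - v| ^ α ≤ (n : ℝ) ^ (-α) := by
      have h3 : |u - v| ^ α ≤ (1 / (n * (γ * Real.exp (β * p.lev)))) ^ α :=
        Real.rpow_le_rpow (abs_nonneg _) huv h.alpha_pos.le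
      have h4 : (1 / (n * (γ * Real.exp (β * p.lev)))) ^ α =
          (n : ℝ) ^ (-α) * (γ ^ α)⁻¹ * Real.exp (-(β * p.lev * α)) := by
        rw [one_div, Real.inv_rpow (by positivity), Real.mul_rpow hn0.le hE.le,
          Real.mul_rpow hg.le (Real.exp_pos _).le, ← Real.exp_mul, Real.exp_neg,
          Real.rpow_neg hn0.le]
        simp only [mul_inv]
        ring
      have h5 : (γ ^ α)⁻¹ ≤ 1 :=
        inv_le_one_of_one_le₀ (Real.one_le_rpow h.one_lt_gamma.le h.alpha_pos.le)
      have h6 : Real.exp (ξ * p.lev) * Real.exp (-(β * p.lev * α)) ≤ 1 := by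
        rw [← Real.exp_add, Real.exp_le_one_iff]
        have : (0 : ℝ) ≤ p.lev := Nat.cast_nonneg _
        nlinarith [h.xi_lt]
      have hnα : 0 ≤ (n : ℝ) ^ (-α) := by positivity
      calc _ ≤ Real.exp (ξ * p.lev) *
            ((n : ℝ) ^ (-α) * (γ ^ α)⁻¹ * Real.exp (-(β * p.lev * α))) := by
            rw [← h4]; gcongr
        _ = (n : ℝ) ^ (-α) * ((γ ^ α)⁻¹ *
            (Real.exp (ξ * p.lev) * Real.exp (-(β * p.lev * α)))) := by ring
        _ ≤ (n : ℝ) ^ (-α) * (1 * 1) := by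
            have := h.gamma_rpow_pos
            gcongr
        _ = _ := by ring
    have h7 : Real.exp (ξ * p.lev) * |u - v| ^ α * (K * f (u, p.lev)) ≤ 1 / 2 * f (u, p.lev) := by
      calc _ = Real.exp (ξ * p.lev) * |u - v| ^ α * K * f (u, p.lev) := by ring
        _ ≤ (n : ℝ) ^ (-α) * K * f (u, p.lev) := by gcongr
        _ = K * (n : ℝ) ^ (-α) * f (u, p.lev) := by ring
        _ ≤ _ := by gcongr
    have := (abs_le.1 h1).2
    linarith
  · have h1 := (h.expand p hx hy).trans (h.dist_image_le_one p hx hy)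
    have h2 : (n : ℝ) * (1 / (n * (γ * Real.exp (β * p.lev)))) =
        1 / (γ * Real.exp (β * p.lev)) := by field_simp
    rw [h2, le_div_iff₀ hE]
    linarith

/-- The values of an eigenfunction at the points over one base interval are comparable. -/
theorem exists_base_comparable {r : ℝ} {f : ℝ × ℕ → ℝ} (hf : T.IsEigen α ξ r f) :
    ∃ c, 0 < c ∧ ∀ i, ∀ x ∈ T.base i, ∀ y ∈ T.base i, c * f x ≤ f y := by
  obtain ⟨M, hM, hMf⟩ := hf.bdd
  obtain ⟨K, hK, hKf⟩ := hf.holder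
  obtain ⟨c, hc, hcf⟩ := h.exists_branch_comparable hK hMf hKf
  have hC := h.C_pos
  refine ⟨c / (1 + C), by positivity, ?_⟩
  rintro i ⟨x, l⟩ ⟨hx, hl, hxi⟩ ⟨y, k⟩ ⟨hy, hk, hyi⟩
  obtain rfl : l = 0 := hl
  obtain rfl : k = 0 := hk
  have key : c / (1 + C) * T.transfer f (x, 0) ≤ T.transfer f (y, 0) := by
    rw [h.tower.transfer_zero, h.tower.transfer_zero, ← tsum_mul_left]
    refine ((h.summable_brTerm hMf x).mul_left _).tsum_le_tsum (fun p => ?_)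
      (h.summable_brTerm hMf y)
    obtain ⟨-, -, j, -, hj⟩ := h.tower.branch_return p
    by_cases hx' : x ∈ T.G '' p.dom
    · have hy' : y ∈ T.G '' p.dom := by
        have h1 := hx'
        rw [hj] at h1 ⊢
        have h2 : (i : ℝ) < j + 1 := hxi.1.trans h1.2
        have h3 : (j : ℝ) < i + 1 := h1.1.trans hxi.2
        have h2' : i < j + 1 := by exact_mod_cast h2
        have h3' : j < i + 1 := by exact_mod_cast h3
        obtain rfl : i = j := by omega
        exact hyi
      have hX := IsTower.inv_mem p hx'
      have hY := IsTower.inv_mem p hy'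
      rw [brTerm, brTerm, indicator_of_mem hx', indicator_of_mem hy']
      have dX := h.deriv_pos p hX
      have dY := h.deriv_pos p hY
      have h1 := hcf p _ hX _ hY
      have h2 := h.deriv_le p hY hX
      have h3 := (hMf _ (IsTower.branch_Del p hX)).1
      rw [div_mul_div_comm]
      exact div_le_div₀ (h1.trans' (by positivity)) h1 dY h2
    · rw [brTerm, indicator_of_notMem hx', mul_zero]
      exact brTerm_nonneg hMf p y
  rw [hf.eq _ hx, hf.eq _ hy] at key
  refine le_of_mul_le_mul_left (le_trans (le_of_eq ?_) key) hf.pos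
  ring

omit h in
theorem exists_base (hT : T.IsTower) {z : ℝ} (hz : (z, 0) ∈ T.Del) :
    ∃ i < T.N, (z, 0) ∈ T.base i := by
  obtain ⟨ω, hω, hzω⟩ := IsTower.exists_Z hz
  obtain ⟨i, hi, hsub⟩ := hT.Z_base hω
  exact ⟨i, hi, hz, rfl, hsub hzω⟩

theorem eigen_pos_F {r : ℝ} {f : ℝ × ℕ → ℝ} (hf : T.IsEigen α ξ r f) {x : ℝ × ℕ}
    (hx : x ∈ T.Del) (hFx : T.F x ∈ T.Del) (hpos : 0 < f x) : 0 < f (T.F x) := by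
  obtain ⟨M, hM, hMf⟩ := hf.bdd
  obtain ⟨z, l⟩ := x
  have h1 := hf.eq _ hFx
  have h2 : 0 < T.transfer f (T.F (z, l)) := by
    rcases IsTower.F_eq_or hx with ⟨hR, hF⟩ | ⟨hR, hF⟩
    · rw [hF] at hFx ⊢
      rwa [IsTower.transfer_succ f hFx]
    · obtain ⟨p, hp, rfl⟩ := h.tower.exists_branch hx hR
      rw [hF]
      exact lt_of_lt_of_le (div_pos hpos (h.deriv_pos p hp)) (h.le_transfer hMf p hp)
  rw [h1] at h2
  exact pos_of_mul_pos_right h2 hf.pos.le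

/-- If the open map is transitive on components, a nonzero eigenfunction is bounded away from zero
on the base. -/
theorem exists_base_lower (htr : T.TransitiveOnComponents) {r : ℝ} {f : ℝ × ℕ → ℝ}
    (hf : T.IsEigen α ξ r f) (hne : ∃ x ∈ T.Del, f x ≠ 0) :
    ∃ c, 0 < c ∧ ∀ z, (z, 0) ∈ T.Del → c ≤ f (z, 0) := by
  obtain ⟨c, hc, hcf⟩ := h.exists_base_comparable hf
  obtain ⟨⟨z, l⟩, hz, hfz⟩ := hne
  have hz0 := IsTower.Del_zero hz
  have hfz0 : 0 < f (z, 0) := by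
    refine lt_of_le_of_ne (hf.nonneg hz0) fun h0 => hfz ?_
    rw [hf.level hz, ← h0, zero_div]
  obtain ⟨i, hi, hzi⟩ := exists_base h.tower hz0
  have hpos : ∀ j < T.N, ∀ y ∈ T.base j, 0 < f y := by
    intro j hj y hy
    obtain ⟨m, -, hm⟩ := htr i hi j hj
    obtain ⟨w, ⟨hw, horb⟩, rfl⟩ := hm hy
    have hfw : 0 < f w := lt_of_lt_of_le (mul_pos hc hfz0) (hcf i _ hzi w hw)
    have key : ∀ k ≤ m, 0 < f (T.F^[k] w) := by
      intro k
      induction k with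
      | zero => exact fun _ => hfw
      | succ k ih =>
        intro hk
        have h1 := horb (k + 1) hk
        rw [Function.iterate_succ_apply'] at h1 ⊢
        exact h.eigen_pos_F hf (horb k (by omega)) h1 (ih (by omega))
    exact key m le_rfl
  have hlow : ∀ j, ∃ d : ℝ, 0 < d ∧ (j < T.N → ∀ y ∈ T.base j, d ≤ f y) := by
    intro j
    by_cases hj : j < T.N ∧ (T.base j).Nonempty
    · obtain ⟨hj, y, hy⟩ := hj
      exact ⟨c * f y, mul_pos hc (hpos j hj y hy), fun _ x hx => hcf j y hy x hx⟩
    · exact ⟨1, one_pos, fun hj' y hy => absurd ⟨hj', y, hy⟩ hj⟩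
  choose d hd0 hd using hlow
  have hN : (Finset.range T.N).Nonempty := ⟨i, Finset.mem_range.2 hi⟩
  refine ⟨(Finset.range T.N).inf' hN d, (Finset.lt_inf'_iff hN).2 fun j _ => hd0 j,
    fun z hz => ?_⟩
  obtain ⟨j, hj, hzj⟩ := exists_base h.tower hz
  exact (Finset.inf'_le d (Finset.mem_range.2 hj)).trans (hd j hj _ hzj)

/-! ### Uniqueness of the eigenfunction -/

theorem exists_mul_le (htr : T.TransitiveOnComponents) {r s : ℝ} {f g : ℝ × ℕ → ℝ}
    (hf : T.IsEigen α ξ r f) (hg : T.IsEigen α ξ s g) (hne : ∃ x ∈ T.Del, f x ≠ 0)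
    (hrs : r ≤ s) : ∃ c, 0 < c ∧ ∀ x ∈ T.Del, c * g x ≤ f x := by
  obtain ⟨c, hc, hcf⟩ := h.exists_base_lower htr hf hne
  obtain ⟨M, hM, hMg⟩ := hg.bdd
  refine ⟨c / (M + 1), by positivity, ?_⟩
  rintro ⟨z, l⟩ hz
  have hz0 := IsTower.Del_zero hz
  have h1 := hcf z hz0
  have h2 : g (z, 0) ≤ M := by simpa using (hMg _ hz0).2
  have h3 := hg.nonneg hz0
  have hs := hg.pos
  have hr := hf.pos
  rw [hf.level hz, hg.level hz]
  calc c / (M + 1) * (g (z, 0) / s ^ l) = (c / (M + 1) * g (z, 0)) / s ^ l := by ring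
    _ ≤ c / s ^ l := by
      gcongr
      rw [div_mul_eq_mul_div, div_le_iff₀ (by positivity)]
      nlinarith
    _ ≤ f (z, 0) / r ^ l := by
      have := hf.nonneg hz0
      gcongr

theorem eigenvalue_le {r s : ℝ} {f g : ℝ × ℕ → ℝ}
    (hf : T.IsEigen α ξ r f) (hg : T.IsEigen α ξ s g) (hne : ∃ x ∈ T.Del, g x ≠ 0)
    {c : ℝ} (hc : 0 < c) (hcg : ∀ x ∈ T.Del, c * g x ≤ f x) : s ≤ r := by
  by_contra hlt
  push Not at hlt
  obtain ⟨M, hM, hMf⟩ := hf.bdd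
  obtain ⟨N, hN, hNg⟩ := hg.bdd
  have hr := hf.pos
  have hs := hg.pos
  have key : ∀ n : ℕ, ∀ x ∈ T.Del, c * (s / r) ^ n * g x ≤ f x := by
    intro n
    induction n with
    | zero => simpa using hcg
    | succ n ih =>
      intro x hx
      have h1 := h.transfer_mono (hNg.smul (c := c * (s / r) ^ n) (by positivity)) hMf
        (fun y hy => by simpa using ih y hy) hx
      rw [transfer_smul, Pi.smul_apply, smul_eq_mul, hf.eq x hx, hg.eq x hx] at h1
      refine le_of_mul_le_mul_left (le_trans (le_of_eq ?_) h1) hr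
      rw [pow_succ]
      field_simp
  obtain ⟨x, hx, hgx⟩ := hne
  have hgx' : 0 < g x := lt_of_le_of_ne (hg.nonneg hx) (Ne.symm hgx)
  obtain ⟨n, hn⟩ := pow_unbounded_of_one_lt (f x / (c * g x)) ((one_lt_div hr).2 hlt)
  have h1 := key n x hx
  rw [div_lt_iff₀ (by positivity)] at hn
  linarith

theorem eigenvalue_eq (htr : T.TransitiveOnComponents) {r s : ℝ} {f g : ℝ × ℕ → ℝ}
    (hf : T.IsEigen α ξ r f) (hg : T.IsEigen α ξ s g) (hfne : ∃ x ∈ T.Del, f x ≠ 0)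
    (hgne : ∃ x ∈ T.Del, g x ≠ 0) : r = s := by
  rcases le_total r s with hrs | hrs
  · obtain ⟨c, hc, hcg⟩ := h.exists_mul_le htr hf hg hfne hrs
    exact le_antisymm hrs (h.eigenvalue_le hf hg hgne hc hcg)
  · obtain ⟨c, hc, hcg⟩ := h.exists_mul_le htr hg hf hgne hrs
    exact le_antisymm (h.eigenvalue_le hg hf hfne hc hcg) hrs

/-- The difference of an eigenfunction and a multiple of another one, if it is nonnegative, is
again an eigenfunction: the part of its Hölder bound which involves the given eigenfunctions is
contracted away by the Lasota-Yorke inequality. -/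
theorem eigen_sub {r c : ℝ} {f g : ℝ × ℕ → ℝ} (hf : T.IsEigen α ξ r f)
    (hg : T.IsEigen α ξ r g) (hc : 0 ≤ c) (hcg : ∀ x ∈ T.Del, c * g x ≤ f x) :
    T.IsEigen α ξ r (fun x => f x - c * g x) := by
  obtain ⟨M, hM, hMf⟩ := hf.bdd
  obtain ⟨N, hN, hNg⟩ := hg.bdd
  obtain ⟨K, hK, hKf⟩ := hf.holder
  obtain ⟨L, hL, hLg⟩ := hg.holder
  set d : ℝ × ℕ → ℝ := fun x => f x - c * g x with hd
  have hr := hf.pos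
  have hC := h.C_pos
  have ha : 0 < consA C γ α ξ := consA_pos
  have ha1 := h.consA_lt_one
  have hMd : T.NonnegBdd ξ M d := fun x hx => by
    have h1 := hMf x hx
    have h2 := hNg x hx
    have h3 := hcg x hx
    have h4 := mul_nonneg hc h2.1
    exact ⟨by simp only [hd]; linarith, by simp only [hd]; linarith⟩
  have heq : ∀ x ∈ T.Del, T.transfer d x = r * d x := by
    intro x hx
    have h1 := h.transfer_add hMd (hNg.smul hc) hx
    have h2 : d + c • g = f := by ext y; simp [hd]
    rw [h2, transfer_smul, Pi.smul_apply, smul_eq_mul, hf.eq x hx, hg.eq x hx] at h1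
    simp only [hd]
    linarith
  set B := max (K + L) (C / (1 - consA C γ α ξ)) with hB
  have hB0 : 0 ≤ B := le_max_of_le_left (by positivity)
  have hBC : consA C γ α ξ * B + C ≤ B := by
    have h1 : C / (1 - consA C γ α ξ) ≤ B := le_max_right _ _
    rw [div_le_iff₀ (by linarith)] at h1
    linarith
  set E := (K + L) * c with hE
  have hE0 : 0 ≤ E := by positivity
  have key : ∀ n : ℕ, T.HolderRel α ξ d
      (B • d + (consA C γ α ξ ^ n * E) • g) := by
    intro n
    induction n with
    | zero =>
      have h1 := HolderRel_add hKf (HolderRel_smul (-c) hLg)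
      have h2 : T.HolderRel α ξ d ((fun x => K * f x) + |-c| • fun x => L * g x) :=
        HolderRel_congr h1 (fun x _ => by simp [hd]; ring) fun x _ => rfl
      refine HolderRel_mono h2 fun x hx => ?_
      have h3 := (hMd x hx).1
      have h4 := (hNg x hx).1
      have h5 : (K + L) * d x ≤ B * d x := mul_le_mul_of_nonneg_right (le_max_left _ _) h3
      have h6 : 0 ≤ L * d x := mul_nonneg hL h3
      simp only [Pi.add_apply, Pi.smul_apply, smul_eq_mul, abs_neg, abs_of_nonneg hc, pow_zero,
        one_mul]
      have h7 : f x = d x + c * g x := by simp [hd]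
      rw [h7, hE]
      nlinarith
    | succ n ih =>
      have hw : T.NonnegBdd ξ _ (B • d + (consA C γ α ξ ^ n * E) • g) :=
        (hMd.smul hB0).add (hNg.smul (by positivity))
      have h1 := h.transfer_holder hMd hw ih
      have h2 := HolderRel_smul r⁻¹ h1
      have h3 : T.HolderRel α ξ d (|r⁻¹| • fun x => consA C γ α ξ *
          T.transfer (B • d + (consA C γ α ξ ^ n * E) • g) x + C * T.transfer d x) :=
        HolderRel_congr h2 (fun x hx => by
          rw [Pi.smul_apply, smul_eq_mul, heq x hx, inv_mul_cancel_left₀ hr.ne']) fun x _ => rfl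
      refine HolderRel_mono h3 fun x hx => ?_
      rw [Pi.smul_apply, smul_eq_mul, h.transfer_add (hMd.smul hB0) (hNg.smul (by positivity)) hx,
        transfer_smul, transfer_smul]
      simp only [Pi.add_apply, Pi.smul_apply, smul_eq_mul]
      rw [heq x hx, hg.eq x hx, abs_of_pos (inv_pos.2 hr)]
      have h4 := mul_le_mul_of_nonneg_right hBC (hMd x hx).1
      have h5 : r⁻¹ * (consA C γ α ξ * (B * (r * d x) + consA C γ α ξ ^ n * E * (r * g x)) +
          C * (r * d x)) =
          (consA C γ α ξ * B + C) * d x + consA C γ α ξ ^ (n + 1) * E * g x := by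
        rw [pow_succ]; field_simp; ring
      rw [h5]
      linarith
  refine ⟨hr, ⟨M, hM, hMd⟩, ⟨B, hB0, ?_⟩, heq⟩
  intro l ω hω hD x hx y hy
  have h1 : Tendsto (fun n : ℕ => Real.exp (ξ * l) * |x - y| ^ α *
      (B * d (x, l) + consA C γ α ξ ^ n * E * g (x, l))) atTop
      (𝓝 (Real.exp (ξ * l) * |x - y| ^ α * (B * d (x, l) + 0 * E * g (x, l)))) :=
    ((((tendsto_pow_atTop_nhds_zero_of_lt_one ha.le ha1).mul_const E).mul_const _).const_add
      _).const_mul _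
  rw [zero_mul, zero_mul, add_zero] at h1
  exact ge_of_tendsto' h1 fun n => key n l ω hω hD x hx y hy

/-- Under transitivity, eigenfunctions with a common eigenvalue are proportional: consider the
difference of the first one and the largest multiple of the second one below it.  If it did not
vanish, it would itself be an eigenfunction, and hence above a further multiple of the second
one. -/
theorem eigen_proportional (htr : T.TransitiveOnComponents) {r : ℝ} {f g : ℝ × ℕ → ℝ}
    (hf : T.IsEigen α ξ r f) (hg : T.IsEigen α ξ r g) (hgne : ∃ x ∈ T.Del, g x ≠ 0) :
    ∃ c, ∀ x ∈ T.Del, f x = c * g x := by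
  obtain ⟨x₀, hx₀, hgx₀⟩ := hgne
  have hgpos : 0 < g x₀ := lt_of_le_of_ne (hg.nonneg hx₀) (Ne.symm hgx₀)
  set S : Set ℝ := {c | 0 ≤ c ∧ ∀ x ∈ T.Del, c * g x ≤ f x} with hS
  have hS0 : (0 : ℝ) ∈ S := ⟨le_rfl, fun x hx => by simpa using hf.nonneg hx⟩
  have hbdd : BddAbove S := ⟨f x₀ / g x₀, fun c hc => by
    rw [le_div_iff₀ hgpos]; exact hc.2 x₀ hx₀⟩
  have hclosed : IsClosed S := by
    have : S = Ici 0 ∩ ⋂ x ∈ T.Del, {c | c * g x ≤ f x} := by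
      ext c; simp [hS]
    rw [this]
    refine isClosed_Ici.inter (isClosed_biInter fun x _ => isClosed_le ?_ continuous_const)
    fun_prop
  obtain ⟨hc0, hcg⟩ := hclosed.csSup_mem ⟨0, hS0⟩ hbdd
  set c := sSup S with hc
  refine ⟨c, ?_⟩
  by_contra hcon
  push Not at hcon
  obtain ⟨x₁, hx₁, hne⟩ := hcon
  have hd := h.eigen_sub hf hg hc0 hcg
  obtain ⟨e, he, heg⟩ := h.exists_mul_le htr hd hg ⟨x₁, hx₁, sub_ne_zero.2 hne⟩ le_rfl
  have : c + e ∈ S := ⟨by positivity, fun x hx => by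
    have := heg x hx
    linarith⟩
  linarith [le_csSup hbdd this]

end IsExpanding

/-! ### Conditionally invariant densities -/

theorem measureOf_apply {f : ℝ × ℕ → ℝ} {A : Set (ℝ × ℕ)} (hA : MeasurableSet A)
    (hAD : A ⊆ T.Del) : T.measureOf f A = ∫⁻ x in A, ENNReal.ofReal (f x) ∂leb := by
  rw [measureOf, withDensity_apply _ hA, Measure.restrict_restrict hA, inter_eq_left.2 hAD]

instance isOpenPosMeasure_leb : Measure.IsOpenPosMeasure leb := by
  have : Measure.IsOpenPosMeasure (Measure.count : Measure ℕ) :=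
    ⟨fun U _ hU => (Measure.count_ne_zero hU)⟩
  exact Measure.prod.instIsOpenPosMeasure

theorem preim_subset (A : Set (ℝ × ℕ)) : T.preim A ⊆ T.Del := fun _ hx => hx.1

namespace IsExpanding

variable {α γ β C ξ : ℝ} (h : T.IsExpanding α γ β C ξ)
include h

/-- The regularity condition of the space `X`, where functions may have zeros. -/
theorem holder_of_memX {f : ℝ × ℕ → ℝ} (hf : T.MemX α ξ f) (hf0 : ∀ x ∈ T.Del, 0 ≤ f x) :
    ∃ K, 0 ≤ K ∧ T.HolderRel α ξ f (fun x => K * f x) := by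
  set K := (T.normR α ξ f).toReal with hK
  have hK0 : 0 ≤ K := ENNReal.toReal_nonneg
  have hne : T.normR α ξ f ≠ ∞ := ((le_max_right _ _).trans_lt hf).ne
  have key : ∀ l, ∀ ω ∈ T.Z, (∀ z ∈ ω, (z, l) ∈ T.Del) → ∀ x ∈ ω, ∀ y ∈ ω, f (x, l) ≠ 0 →
      |f (x, l) - f (y, l)| ≤ Real.exp (ξ * l) * |x - y| ^ α * (K * f (x, l)) := by
    intro l ω hω hD x hx y hy hfx
    rcases eq_or_ne x y with rfl | hxy
    · simp [Real.zero_rpow h.alpha_pos.ne']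
    obtain ⟨J, hJ, hsub⟩ := h.tower.exists_part hω hx (hD x hx)
    have h1 : ENNReal.ofReal (|f (x, l) - f (y, l)| / (|x - y| ^ α * |f (x, l)|) *
        Real.exp (-(ξ * l))) ≤ T.normR α ξ f :=
      le_iSup_of_le l (le_iSup₂_of_le J hJ (le_iSup₂_of_le x ⟨hsub hx, ω, hω, hx⟩
        (le_iSup₂_of_le y ⟨hsub hy, ω, hω, hy⟩ (le_iSup_of_le hfx le_rfl))))
    rw [← ENNReal.ofReal_toReal hne, ENNReal.ofReal_le_ofReal_iff hK0, abs_of_nonneg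
      (hf0 _ (hD x hx)), Real.exp_neg, ← div_eq_mul_inv, div_le_iff₀ (Real.exp_pos _)] at h1
    have h2 : 0 < f (x, l) := lt_of_le_of_ne (hf0 _ (hD x hx)) (Ne.symm hfx)
    have h3 : 0 < |x - y| ^ α := Real.rpow_pos_of_pos (abs_pos.2 (sub_ne_zero.2 hxy)) _
    rw [div_le_iff₀ (by positivity)] at h1
    linarith
  refine ⟨K, hK0, fun l ω hω hD x hx y hy => ?_⟩
  by_cases hfx : f (x, l) = 0
  swap
  · exact key l ω hω hD x hx y hy hfx
  -- `f` has no zero at a distance at most `δ` of a point where it is nonzero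
  obtain ⟨δ, hδ, hδK⟩ : ∃ δ : ℝ, 0 < δ ∧ Real.exp (ξ * l) * δ ^ α * K ≤ 1 / 2 := by
    have h1 : Tendsto (fun δ : ℝ => Real.exp (ξ * l) * δ ^ α * K) (𝓝[>] 0)
        (𝓝 (Real.exp (ξ * l) * 0 ^ α * K)) :=
      (((Real.continuousAt_rpow_const 0 α (Or.inr h.alpha_pos.le)).tendsto.mono_left
        nhdsWithin_le_nhds).const_mul _).mul_const K
    rw [Real.zero_rpow h.alpha_pos.ne', mul_zero, zero_mul] at h1
    obtain ⟨δ, hδ1, hδ2⟩ := ((h1.eventually_le_const (by norm_num : (0 : ℝ) < 1 / 2)).and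
      self_mem_nhdsWithin).exists
    exact ⟨δ, hδ2, hδ1⟩
  obtain ⟨n, hn⟩ := exists_nat_ge (|y - x| / δ)
  have h1 := chain_le (h.tower.Z_ordConnected hω) (f := fun z => f (z, l)) (c := 1 / 2) (δ := δ)
    (by norm_num) (by
      intro u hu v hv huv
      by_cases hfu : f (u, l) = 0
      · simpa [hfu] using hf0 _ (hD v hv)
      have h2 := (abs_le.1 (key l ω hω hD u hu v hv hfu)).2
      have h3 : |u - v| ^ α ≤ δ ^ α := Real.rpow_le_rpow (abs_nonneg _) huv h.alpha_pos.le
      have h4 := hf0 _ (hD u hu)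
      have h5 : Real.exp (ξ * l) * |u - v| ^ α * (K * f (u, l)) ≤ 1 / 2 * f (u, l) := by
        calc _ ≤ Real.exp (ξ * l) * δ ^ α * (K * f (u, l)) := by gcongr
          _ = Real.exp (ξ * l) * δ ^ α * K * f (u, l) := by ring
          _ ≤ _ := by gcongr
      linarith) n y hy x hx (by rwa [div_le_iff₀ hδ] at hn)
  have h2 : f (y, l) = 0 := by
    refine le_antisymm ?_ (hf0 _ (hD y hy))
    simp only [hfx] at h1
    exact nonpos_of_mul_nonpos_right h1 (by positivity)
  simp [hfx, h2]

theorem nonnegBdd_of_memX {f : ℝ × ℕ → ℝ} (hf : T.MemX α ξ f) (hf0 : ∀ x ∈ T.Del, 0 ≤ f x) :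
    ∃ M, 0 ≤ M ∧ T.NonnegBdd ξ M f := by
  have hne : T.normInf ξ f ≠ ∞ := ((le_max_left _ _).trans_lt hf).ne
  refine ⟨(T.normInf ξ f).toReal, ENNReal.toReal_nonneg, ?_⟩
  rintro ⟨z, l⟩ hz
  refine ⟨hf0 _ hz, ?_⟩
  obtain ⟨ω, hω, hzω⟩ := IsTower.exists_Z hz
  obtain ⟨J, hJ, hsub⟩ := h.tower.exists_part hω hzω hz
  have h1 : ENNReal.ofReal (Real.exp (-(ξ * l)) * |f (z, l)|) ≤ T.normInf ξ f :=
    le_iSup_of_le l (le_iSup₂_of_le J hJ (le_iSup₂_of_le z ⟨hsub hzω, ω, hω, hzω⟩ le_rfl))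
  rw [← ENNReal.ofReal_toReal hne, ENNReal.ofReal_le_ofReal_iff ENNReal.toReal_nonneg,
    abs_of_nonneg (hf0 _ hz), Real.exp_neg, inv_mul_le_iff₀ (Real.exp_pos _)] at h1
  linarith

/-- A conditionally invariant density of the space `X` is an eigenfunction of the transfer
operator; by continuity, the equation holds at every point. -/
theorem isEigen_of_condInv {f : ℝ × ℕ → ℝ} (hf : T.MemX α ξ f) (hinv : T.IsCondInvDensity f) :
    ∃ s, T.IsEigen α ξ s f := by
  obtain ⟨⟨hf0, hfi, hf1⟩, hne, hA⟩ := hinv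
  obtain ⟨M, hM, hMf⟩ := h.nonnegBdd_of_memX hf hf0
  obtain ⟨K, hK, hKf⟩ := h.holder_of_memX hf hf0
  have hc := hKf.continuousOn h.tower h.alpha_pos
  have hDm := h.tower.Del_measurable
  have hpre := h.tower.measurableSet_preim hDm subset_rfl
  have hle : T.measureOf f (T.preim T.Del) ≤ ∫⁻ x in T.Del, ENNReal.ofReal (f x) ∂leb := by
    rw [measureOf_apply hpre (preim_subset _)]
    exact lintegral_mono_set (preim_subset _)
  have htop : T.measureOf f (T.preim T.Del) ≠ ∞ :=
    ne_top_of_le_ne_top (h.lintegral_ne_top hMf) hle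
  set s := (T.measureOf f (T.preim T.Del)).toReal with hs
  have hs0 : 0 < s := ENNReal.toReal_pos hne htop
  obtain ⟨N, hN0, hN⟩ := h.transfer_nonnegBdd hM hMf
  have hPc : ContinuousOn (T.transfer f) T.Del :=
    (h.transfer_holder hMf (hMf.smul hK) hKf).continuousOn h.tower h.alpha_pos
  have hsf : T.NonnegBdd ξ (s * M) (s • f) := hMf.smul hs0.le
  have hae : (fun x => ENNReal.ofReal (T.transfer f x)) =ᵐ[leb.restrict T.Del]
      fun x => ENNReal.ofReal ((s • f) x) := by
    refine AEMeasurable.ae_eq_of_forall_setLIntegral_eq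
      (h.aesm hPc).aemeasurable.ennreal_ofReal
      (h.aesm (hc.const_smul s)).aemeasurable.ennreal_ofReal
      (h.lintegral_ne_top hN) (h.lintegral_ne_top hsf) fun A hAm _ => ?_
    rw [Measure.restrict_restrict hAm]
    have hB : MeasurableSet (A ∩ T.Del) := hAm.inter hDm
    have hBD : A ∩ T.Del ⊆ T.Del := inter_subset_right
    have h1 := hA _ hB hBD
    have hpB := h.tower.measurableSet_preim hB hBD
    rw [measureOf_apply hpB (preim_subset _), measureOf_apply hB hBD,
      ← h.setLIntegral_transfer hMf hc hB hBD] at h1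
    rw [← ENNReal.div_mul_cancel (a := T.measureOf f (T.preim T.Del)) hne htop
      (b := ∫⁻ x in A ∩ T.Del, ENNReal.ofReal (T.transfer f x) ∂leb), h1, mul_comm,
      ← ENNReal.ofReal_toReal htop, ← hs, ← lintegral_const_mul' _ _ ENNReal.ofReal_ne_top]
    refine lintegral_congr fun x => ?_
    rw [Pi.smul_apply, smul_eq_mul, ENNReal.ofReal_mul hs0.le]
  have hae' : T.transfer f =ᵐ[leb.restrict T.Del] s • f := by
    have hmem : ∀ᵐ x ∂leb.restrict T.Del, x ∈ T.Del := ae_restrict_mem hDm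
    filter_upwards [hae, hmem] with x hx hxD
    exact (ENNReal.ofReal_eq_ofReal_iff (hN x hxD).1 (hsf x hxD).1).1 hx
  exact ⟨s, hs0, ⟨M, hM, hMf⟩, ⟨K, hK, hKf⟩, fun x hx =>
    Measure.eqOn_open_of_ae_eq hae' h.tower.Del_open hPc (hc.const_smul s) hx⟩

theorem isCondInv_of_isEigen {r : ℝ} {f : ℝ × ℕ → ℝ} (hf : T.IsEigen α ξ r f)
    (hprob : T.IsProbDensity f) : T.IsCondInvDensity f := by
  obtain ⟨M, hM, hMf⟩ := hf.bdd
  obtain ⟨K, hK, hKf⟩ := hf.holder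
  have hc := hKf.continuousOn h.tower h.alpha_pos
  have hDm := h.tower.Del_measurable
  have key : ∀ A, MeasurableSet A → A ⊆ T.Del →
      T.measureOf f (T.preim A) = ENNReal.ofReal r * T.measureOf f A := by
    intro A hA hAD
    rw [measureOf_apply (h.tower.measurableSet_preim hA hAD) (preim_subset _),
      measureOf_apply hA hAD, ← h.setLIntegral_transfer hMf hc hA hAD,
      ← lintegral_const_mul' _ _ ENNReal.ofReal_ne_top]
    refine setLIntegral_congr_fun hA fun x hx => ?_
    simp only [hf.eq x (hAD hx), ENNReal.ofReal_mul hf.pos.le]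
  have h1 : T.measureOf f T.Del = 1 := by
    rw [measureOf_apply hDm subset_rfl, ← h.ofReal_total hMf hc, total, hprob.2.2,
      ENNReal.ofReal_one]
  have hr : ENNReal.ofReal r ≠ 0 := by simpa using hf.pos
  refine ⟨hprob, ?_, fun A hA hAD => ?_⟩
  · rw [key _ hDm subset_rfl, h1, mul_one]
    exact hr
  · rw [key _ hDm subset_rfl, h1, mul_one, key A hA hAD, mul_comm,
      ENNReal.mul_div_cancel_right hr ENNReal.ofReal_ne_top]

theorem exists_ne_zero {f : ℝ × ℕ → ℝ} (hf1 : T.total f = 1) : ∃ x ∈ T.Del, f x ≠ 0 := by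
  by_contra hcon
  push Not at hcon
  rw [total, setIntegral_congr_fun h.tower.Del_measurable hcon] at hf1
  simp at hf1

/-- Two eigenfunctions of total mass one coincide. -/
theorem eigen_unique (htr : T.TransitiveOnComponents) {r s : ℝ} {f g : ℝ × ℕ → ℝ}
    (hf : T.IsEigen α ξ r f) (hg : T.IsEigen α ξ s g) (hf1 : T.total f = 1)
    (hg1 : T.total g = 1) : EqOn f g T.Del := by
  have hgne := h.exists_ne_zero hg1
  obtain rfl := h.eigenvalue_eq htr hf hg (h.exists_ne_zero hf1) hgne
  obtain ⟨c, hc⟩ := h.eigen_proportional htr hf hg hgne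
  have h1 : T.total f = T.total (c • g) := setIntegral_congr_fun h.tower.Del_measurable hc
  rw [total_smul, hf1, hg1, mul_one] at h1
  intro x hx
  rw [hc x hx, ← h1, one_mul]

/-- The eigenvalue is the proportion of the mass that survives, hence at most one. -/
theorem eigenvalue_le_one {r : ℝ} {f : ℝ × ℕ → ℝ} (hf : T.IsEigen α ξ r f)
    (hf1 : T.total f = 1) : r ≤ 1 := by
  obtain ⟨M, hM, hMf⟩ := hf.bdd
  obtain ⟨K, hK, hKf⟩ := hf.holder
  have hc := hKf.continuousOn h.tower h.alpha_pos
  have h1 : T.total (T.transfer f) = T.total (r • f) :=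
    setIntegral_congr_fun h.tower.Del_measurable hf.eq
  have h2 := h.ofReal_total_transfer hM hMf hKf hK
  have h3 := h.ofReal_total hMf hc
  rw [h1, total_smul, hf1, mul_one] at h2
  rw [hf1] at h3
  have h4 : ENNReal.ofReal r ≤ ENNReal.ofReal 1 := by
    rw [h2, h3]
    exact lintegral_mono_set (preim_subset _)
  exact (ENNReal.ofReal_le_ofReal_iff zero_le_one).1 h4

theorem exists_lower (htr : T.TransitiveOnComponents) {r : ℝ} {f : ℝ × ℕ → ℝ}
    (hf : T.IsEigen α ξ r f) (hf1 : T.total f = 1) : ∃ c, 0 < c ∧ ∀ x ∈ T.Del, c ≤ f x := by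
  obtain ⟨c, hc, hcf⟩ := h.exists_base_lower htr hf (h.exists_ne_zero hf1)
  refine ⟨c, hc, ?_⟩
  rintro ⟨z, l⟩ hz
  have hz0 := IsTower.Del_zero hz
  refine (hcf z hz0).trans ?_
  rw [hf.level hz]
  exact le_div_self (hf.nonneg hz0) (pow_pos hf.pos l)
    (pow_le_one₀ hf.pos.le (h.eigenvalue_le_one hf hf1))

end IsExpanding

/-- The decay of the levels makes the weighted measure of the tower finite, as `θ e^ξ < 1`. -/
theorem weight_ne_top_of_H1 {θ ξ : ℝ} (hθ : 0 < θ) (hθξ : θ < Real.exp (-ξ)) (h1 : T.H1 θ) :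
    ∑' l : ℕ, ENNReal.ofReal (Real.exp (ξ * l)) * volume (T.level l) ≠ ∞ := by
  obtain ⟨A, hA, hAl⟩ := h1
  have hq : Real.exp ξ * θ < 1 := by
    have := mul_lt_mul_of_pos_left hθξ (Real.exp_pos ξ)
    rwa [← Real.exp_add, add_neg_cancel, Real.exp_zero] at this
  have hq0 : 0 ≤ Real.exp ξ * θ := by positivity
  have hsum : Summable fun l : ℕ => A * (Real.exp ξ * θ) ^ l :=
    (summable_geometric_of_lt_one hq0 hq).mul_left A
  refine ne_top_of_le_ne_top (hsum.tsum_ofReal_ne_top) (ENNReal.tsum_le_tsum fun l => ?_)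
  have h2 : volume (T.level l) ≤ ENNReal.ofReal (A * θ ^ l) :=
    (measure_mono fun z hz => hz.1).trans (hAl l)
  refine (mul_le_mul_right h2 _).trans (le_of_eq ?_)
  rw [← ENNReal.ofReal_mul (Real.exp_pos _).le, mul_pow, ← Real.exp_nat_mul]
  congr 1
  rw [mul_comm (l : ℝ) ξ]
  ring

end TowerData

end

theorem theorem2p1 (T : TowerData) (hT : T.IsTower) (α γ β C θ ξ : ℝ)
    (hα : 0 < α) (hγ : 1 < γ) (hβ : 0 < β) (hC : 0 < C) (hθ : 0 < θ) (hθ1 : θ < 1)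
    (ha : T.PropA α) (hb : T.PropB γ β) (hc : T.PropC C α)
    (h1 : T.H1 θ) (h2 : TowerData.H2 C γ α)
    (hξ : 0 < ξ) (hξ' : max θ (Real.exp (-(α * β))) < Real.exp (-ξ))
    (h3 : T.H3 C γ α ξ) (hne : T.HoleNotHuge C γ α ξ) :
    ∃ φ : ℝ × ℕ → ℝ,
      T.MemX α ξ φ ∧ T.IsProbDensity φ ∧ Set.EqOn (T.transfer₁ φ) φ T.Del ∧
      (T.TransitiveOnComponents →
        T.IsCondInvDensity φ ∧
        (∀ ψ : ℝ × ℕ → ℝ, T.MemX α ξ ψ → T.IsCondInvDensity ψ → Set.EqOn ψ φ T.Del) ∧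
        ∃ c : ℝ, 0 < c ∧ ∀ x ∈ T.Del, c ≤ φ x) := by
  have h : T.IsExpanding α γ β C ξ :=
    { tower := hT, alpha_pos := hα, one_lt_gamma := hγ, beta_pos := hβ, C_pos := hC, xi_pos := hξ
      xi_lt := by
        have := (le_max_right _ _).trans_lt hξ'
        rw [Real.exp_lt_exp] at this
        linarith
      propA := ha, propB := hb, propC := hc, nonlin := h2
      weight_ne_top := TowerData.weight_ne_top_of_H1 hθ ((le_max_left _ _).trans_lt hξ') h1 }
  obtain ⟨M, hM, hMne⟩ := h.exists_admissible h3 hne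
  obtain ⟨r, hr, φ, hφ, hφ1, heq⟩ := h.exists_eigenfunction hM hMne
  have hE : T.IsEigen α ξ r φ :=
    ⟨hr, ⟨M, hM.1, by simpa [hφ1] using hφ.1⟩, ⟨_, h.consK_pos.le, hφ.2⟩, heq⟩
  have hprob : T.IsProbDensity φ :=
    ⟨fun x hx => hE.nonneg hx, h.integrableOn hφ.1 (h.cone_continuousOn hφ), hφ1⟩
  refine ⟨φ, hE.memX h, hprob, fun x hx => ?_, fun htr => ⟨h.isCondInv_of_isEigen hE hprob,
    fun ψ hψ hψinv => ?_, h.exists_lower htr hE hφ1⟩⟩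
  · have h4 : ∫ y in T.Del, |T.transfer φ y| ∂TowerData.leb = r := by
      have h5 : ∫ y in T.Del, |T.transfer φ y| ∂TowerData.leb = T.total (r • φ) :=
        setIntegral_congr_fun hT.Del_measurable fun y hy => by
          simp only [heq y hy, Pi.smul_apply, smul_eq_mul]
          exact abs_of_nonneg (mul_nonneg hr.le (hE.nonneg hy))
      rw [h5, TowerData.IsExpanding.total_smul, hφ1, mul_one]
    rw [TowerData.transfer₁, h4, heq x hx, mul_div_cancel_left₀ _ hr.ne']
  · obtain ⟨s, hs⟩ := h.isEigen_of_condInv hψ hψinv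
    exact h.eigen_unique htr hs hE hψinv.1.2.2 hφ1
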